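/- **Setting.** Let $x_{k+1}=Ax_k+w_k$, $y_k=Cx_k+v_k$ with noise covariances $Q\succeq0$ and $R\succ0$, let $\bar P$ be the steady-state value (the limit) of the posterior error covariance of the Kalman filter, and let $f(X)=AXA^\top+Q$. Let $\lambda,\lambda_a\in(0,1]$ be the success probabilities of the channel from the sensor to the legitimate estimator and of its acknowledgement, and let $\lambda_e\in(0,1)$ be that of the channel to the adversary, with $(1-\lambda_e)|\lambda_{\max}(A)|^2<1$. The state is $S_k=(\eta^s_k,\eta^e_k)\in\mathbb N^2$ and the action is $a\in\{0,1\}$ ($1$ = transmit). From $(i,j)$, action $0$ leads to $(i+1,j+1)$; action $1$ leads to $(i+1,j+1)$, $(0,j+1)$, $(i+1,0)$, $(0,0)$ with probabilities $(1-\lambda\lambda_a)(1-\lambda_e)$, $\lambda\lambda_a(1-\lambda_e)$, $(1-\lambda\lambda_a)\lambda_e$, $\lambda\lambda_a\lambda_e$. A policy $\tau=(\tau_{ij})$ transmits in state $(i,j)$ with probability $\tau_{ij}\in[0,1]$, and $J_e(\tau)=\lim_{T\to\infty}\frac1T\sum_{k=1}^T\operatorname{tr}\mathbb E\big(f^{\eta^e_k}(\bar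 P)\big)$. Let $\Omega$ be the set of nonnegative $\rho$ on $\mathbb N^2\times\{0,1\}$ of total mass $1$ with $\sum_a\rho(s',a)=\sum_{s,a}\rho(s,a)\,\mathbb P(s'\mid s,a)$ for all $s'$, and put $\rho_s(i,a)=\sum_j\rho(i,j,a)$. Let $\omega\in\Omega$ be the stationary state-action distribution under a reference policy $\tau_{ij}=\tau_i$ (assumed to have one), and let $\epsilon_s>0$. **Infinite LP.** Minimize $\sum_{i,j,a}\rho(i,j,a)\operatorname{tr}f^j(\bar P)$ over $\rho\in\Omega$ with $\|\omega_s-\rho_s\|_1\le\epsilon_s$. **Finite LP with horizon $N_t$.** Truncate the chain to $\{0,\dots,N_t\}^2$ by replacing $i+1,j+1$ with $\min(i+1,N_t),\min(j+1,N_t)$, and let $\Omega_{N_t}$ be the set of its occupation measures (defined as $\Omega$, with values in $[0,1]$). Minimize $$\sum_{i\le N_t,\;j<N_t,\;a}\rho_t(i,j,a)\operatorname{tr}f^j(\bar P)+\sum_{i\le N_t}\rho_t(i,N_t,1)\sum_{j\ge N_t}\lambda_e(1-\lambda_e)^{j-N_t}\operatorname{tr}f^j(\bar P)$$ over $\rho_t\in\Omega_{N_t}$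 and $(\epsilon_{i,a})_{0\le i\le N_t,\,a\in\{0,1\}}$ such that $\rho_t(i,j,0)=0$ if $i=N_t$ or $j=N_t$; $|\sum_{j\le N_t}\rho_t(i,j,a)-\omega_s(i,a)|\le\epsilon_{i,a}$ for $i<N_t$; $|\sum_{j\le N_t}\rho_t(N_t,j,a)-\sum_{i\ge N_t}\omega_s(i,a)|\le\epsilon_{N_t,a}$; and $\sum_{i,a}\epsilon_{i,a}\le\epsilon_s$. For an optimal solution $\rho^\star$ of the infinite LP, let $\tau^\star_{ij}=\rho^\star(i,j,1)/\sum_a\rho^\star(i,j,a)$. For an optimal solution $\rho_t^c$ of the finite LP, let $\tau^c_{ij}=\rho_t^c(i,j,1)/\sum_a\rho_t^c(i,j,a)$ for $i,j<N_t$ and $\tau^c_{ij}=1$ otherwise. Wherever a denominator is $0$ the value in $[0,1]$ is arbitrary. **Proposition ($\epsilon$-optimality of the truncated policy).** There are sequences $\epsilon_g(N_t)\to0$ and $\epsilon_\omega(N_t)\to0$ as $N_t\to\infty$ such that the following holds. For all sufficiently large $N_t$ the finite LP has an optimal solution. For every $N_t$ and every $\tau^c$ obtained from an optimal solution of the finite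 LP with horizon $N_t$: 1. The original (untruncated) chain under $\tau^c$ has a unique stationary state-action distribution $\rho$, and $\|\omega_s-\rho_s\|_1\le\epsilon_s+\epsilon_\omega(N_t)$. 2. The limit $J_e(\tau^c)$ exists, is finite and is the same for all initial states. For every optimal solution $\rho^\star$ of the infinite LP and every $\tau^\star$ obtained from it, the limit $J_e(\tau^\star)$ exists and equals the finite optimal value of the infinite LP, for every initial state of positive $\rho^\star$-mass, and $$J_e(\tau^c)\le J_e(\tau^\star)+\epsilon_g(N_t).$$ -/

import Mathlib

open Filter Topology

noncomputable section

namespace Eavesdrop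

/-! ### Error covariances -/

section Covariance

variable {n m : ℕ}

/-- The prediction map `f(X) = A X Aᵀ + Q`. -/
def predict (A Q : Matrix (Fin n) (Fin n) ℝ) (X : Matrix (Fin n) (Fin n) ℝ) :
    Matrix (Fin n) (Fin n) ℝ :=
  A * X * A.transpose + Q

/-- The measurement update of the Kalman filter for `y = C x + v`, `Cov v = R`:
it maps a prior error covariance to the posterior one. -/
def measUpdate (C : Matrix (Fin m) (Fin n) ℝ) (R : Matrix (Fin m) (Fin m) ℝ)
    (X : Matrix (Fin n) (Fin n) ℝ) : Matrix (Fin n) (Fin n) ℝ :=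
  X - X * C.transpose * (C * X * C.transpose + R)⁻¹ * C * X

/-- The posterior error covariance `P_k^s` of the local Kalman filter, `P0 = Cov x_0`. -/
def kalmanCov (A Q : Matrix (Fin n) (Fin n) ℝ) (C : Matrix (Fin m) (Fin n) ℝ)
    (R : Matrix (Fin m) (Fin m) ℝ) (P0 : Matrix (Fin n) (Fin n) ℝ) :
    ℕ → Matrix (Fin n) (Fin n) ℝ
  | 0 => measUpdate C R P0
  | k + 1 => measUpdate C R (predict A Q (kalmanCov A Q C R P0 k))

/-- `P` is the steady-state posterior error covariance of the local Kalman filter. -/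
def IsSteadyState (A Q : Matrix (Fin n) (Fin n) ℝ) (C : Matrix (Fin m) (Fin n) ℝ)
    (R : Matrix (Fin m) (Fin m) ℝ) (P0 P : Matrix (Fin n) (Fin n) ℝ) : Prop :=
  Tendsto (kalmanCov A Q C R P0) atTop (𝓝 P)

/-- The error covariance `f^j(P)` at holding time `j`. -/
def errCov (A Q P : Matrix (Fin n) (Fin n) ℝ) (j : ℕ) : Matrix (Fin n) (Fin n) ℝ :=
  (predict A Q)^[j] P

/-- `|λ_max(A)|`, the largest modulus of a complex eigenvalue of `A`. -/
def maxEig (A : Matrix (Fin n) (Fin n) ℝ) : ℝ :=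
  (spectralRadius ℂ (A.map (algebraMap ℝ ℂ))).toReal

end Covariance

/-! ### The controlled Markov chain of the two holding times -/

/-- Success probabilities: sensor to legitimate estimator (`legit`), its acknowledgement (`ack`),
sensor to adversary (`adv`). -/
structure Channels where
  legit : ℝ
  ack : ℝ
  adv : ℝ

/-- Transition probability from `s = (η^s, η^e)` to `s'` under the action `a` (`1`: transmit).
`nxt` is the update of a holding time when nothing is received: `i ↦ i + 1` for the
original chain, `i ↦ min (i + 1) N` for the truncated one. -/
def kernel (ch : Channels) (nxt : ℕ → ℕ) (s : ℕ × ℕ) (a : Fin 2) (s' : ℕ × ℕ) : ℝ :=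
  if a = 0 then
    (if s' = (nxt s.1, nxt s.2) then 1 else 0)
  else
    (if s' = (nxt s.1, nxt s.2) then (1 - ch.legit * ch.ack) * (1 - ch.adv) else 0)
    + (if s' = (0, nxt s.2) then ch.legit * ch.ack * (1 - ch.adv) else 0)
    + (if s' = (nxt s.1, 0) then (1 - ch.legit * ch.ack) * ch.adv else 0)
    + (if s' = (0, 0) then ch.legit * ch.ack * ch.adv else 0)

/-- Transition probability of the original chain. -/
def trans (ch : Channels) : ℕ × ℕ → Fin 2 → ℕ × ℕ → ℝ :=
  kernel ch (fun i => i + 1)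

/-- Transition probability of the chain truncated at horizon `N`. -/
def truncTrans (ch : Channels) (N : ℕ) (s : Fin (N + 1) × Fin (N + 1)) (a : Fin 2)
    (s' : Fin (N + 1) × Fin (N + 1)) : ℝ :=
  kernel ch (fun i => min (i + 1) N) (s.1, s.2) a (s'.1, s'.2)

/-- Probability of the action `a` when one transmits with probability `t`. -/
def actProb (t : ℝ) (a : Fin 2) : ℝ := if a = 1 then t else 1 - t

/-- The law of `(η_k^s, η_k^e)` under the policy `τ`, with `(η_0^s, η_0^e) = s₀`. -/
def stateProb (ch : Channels) (τ : ℕ × ℕ → ℝ) (s₀ : ℕ × ℕ) : ℕ → ℕ × ℕ → ℝ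
  | 0, s' => if s' = s₀ then 1 else 0
  | k + 1, s' =>
      ∑' s : ℕ × ℕ, stateProb ch τ s₀ k s * ∑ a, actProb (τ s) a * trans ch s a s'

/-- `J` is the average of the expected error covariance at the adversary under the policy `τ`
and the initial state `s₀`: `J = lim_T (1/T) ∑_{k=1}^T tr E(P_k^e)`, `P_k^e = f^{η_k^e}(P)`. -/
def IsAEEC {n : ℕ} (ch : Channels) (A Q P : Matrix (Fin n) (Fin n) ℝ) (τ : ℕ × ℕ → ℝ)
    (s₀ : ℕ × ℕ) (J : ℝ) : Prop :=
  Tendsto (fun T : ℕ => (1 / (T : ℝ)) * ∑ k ∈ Finset.Icc 1 T,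
    (∑' s : ℕ × ℕ, stateProb ch τ s₀ k s • errCov A Q P s.2).trace) atTop (𝓝 J)

/-! ### Occupation measures and the infinite linear program -/

/-- `ρ ∈ Ω`: `ρ` is an occupation measure on state-action pairs. -/
structure IsOccupation (ch : Channels) (ρ : ℕ × ℕ → Fin 2 → ℝ) : Prop where
  nonneg : ∀ s a, 0 ≤ ρ s a
  total : HasSum (fun x : (ℕ × ℕ) × Fin 2 => ρ x.1 x.2) 1
  balance : ∀ s', ∑ a, ρ s' a = ∑' x : (ℕ × ℕ) × Fin 2, ρ x.1 x.2 * trans ch x.1 x.2 s'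

/-- `τ` is a policy with `τ_{ij} = ρ(i,j,1) / ∑_a ρ(i,j,a)`, arbitrary in `[0,1]` where the
denominator is zero. -/
def Induces (ρ : ℕ × ℕ → Fin 2 → ℝ) (τ : ℕ × ℕ → ℝ) : Prop :=
  (∀ s, τ s ∈ Set.Icc (0 : ℝ) 1) ∧ ∀ s, ρ s 1 = τ s * ∑ a, ρ s a

/-- `ρ` is a stationary distribution of the state-action pair under the policy `τ`. -/
def IsStationary (ch : Channels) (τ : ℕ × ℕ → ℝ) (ρ : ℕ × ℕ → Fin 2 → ℝ) : Prop :=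
  IsOccupation ch ρ ∧ Induces ρ τ

/-- The marginal `ρ_s(i,a) = ∑_j ρ(i,j,a)`. -/
def marg (ρ : ℕ × ℕ → Fin 2 → ℝ) (i : ℕ) (a : Fin 2) : ℝ := ∑' j : ℕ, ρ (i, j) a

/-- `‖ω_s - ρ_s‖₁`. -/
def l1Dist (ω ρ : ℕ × ℕ → Fin 2 → ℝ) : ℝ :=
  ∑' x : ℕ × Fin 2, |marg ρ x.1 x.2 - marg ω x.1 x.2|

/-- The objective of the infinite program: `∑ ρ(i,j,a) tr f^j(P)`, possibly infinite. -/
def occCost {n : ℕ} (A Q P : Matrix (Fin n) (Fin n) ℝ) (ρ : ℕ × ℕ → Fin 2 → ℝ) : ENNReal :=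
  ∑' x : (ℕ × ℕ) × Fin 2, ENNReal.ofReal (ρ x.1 x.2 * (errCov A Q P x.1.2).trace)

/-- Feasibility in the infinite program. -/
def Feasible (ch : Channels) (ω : ℕ × ℕ → Fin 2 → ℝ) (εs : ℝ) (ρ : ℕ × ℕ → Fin 2 → ℝ) : Prop :=
  IsOccupation ch ρ ∧ l1Dist ω ρ ≤ εs

/-- `ρ` solves the infinite program. -/
def IsOptimal {n : ℕ} (ch : Channels) (A Q P : Matrix (Fin n) (Fin n) ℝ)
    (ω : ℕ × ℕ → Fin 2 → ℝ) (εs : ℝ) (ρ : ℕ × ℕ → Fin 2 → ℝ) : Prop :=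
  Feasible ch ω εs ρ ∧ ∀ ρ', Feasible ch ω εs ρ' → occCost A Q P ρ ≤ occCost A Q P ρ'

/-! ### The finite linear program -/

/-- `ρ ∈ Ω_N`: occupation measure of the truncated chain. -/
structure IsTruncOccupation (ch : Channels) (N : ℕ)
    (ρ : Fin (N + 1) × Fin (N + 1) → Fin 2 → ℝ) : Prop where
  mem_Icc : ∀ s a, ρ s a ∈ Set.Icc (0 : ℝ) 1
  total : ∑ s, ∑ a, ρ s a = 1
  balance : ∀ s', ∑ a, ρ s' a = ∑ s, ∑ a, ρ s a * truncTrans ch N s a s'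

/-- The objective of the finite program:
`∑_{i ≤ N, j < N, a} ρ(i,j,a) tr f^j(P)
  + ∑_{i ≤ N} ρ(i,N,1) ∑_{j ≥ N} λ_e (1 - λ_e)^{j - N} tr f^j(P)`. -/
def truncCost {n : ℕ} (ch : Channels) (A Q P : Matrix (Fin n) (Fin n) ℝ) (N : ℕ)
    (ρ : Fin (N + 1) × Fin (N + 1) → Fin 2 → ℝ) : ENNReal :=
  (∑ i : Fin (N + 1), ∑ j : Fin N, ∑ a,
      ENNReal.ofReal (ρ (i, j.castSucc) a * (errCov A Q P j).trace))
  + ∑ i : Fin (N + 1), ENNReal.ofReal (ρ (i, Fin.last N) 1) *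
      ∑' k : ℕ, ENNReal.ofReal (ch.adv * (1 - ch.adv) ^ k * (errCov A Q P (N + k)).trace)

/-- Feasibility of `(ρ, ε)` in the finite program. -/
structure TruncFeasible (ch : Channels) (ω : ℕ × ℕ → Fin 2 → ℝ) (εs : ℝ) (N : ℕ)
    (ρ : Fin (N + 1) × Fin (N + 1) → Fin 2 → ℝ) (ε : Fin (N + 1) → Fin 2 → ℝ) : Prop where
  occupation : IsTruncOccupation ch N ρ
  boundary : ∀ i j, i = Fin.last N ∨ j = Fin.last N → ρ (i, j) 0 = 0
  stealth : ∀ (i : Fin N) (a : Fin 2),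
    |∑ j, ρ (i.castSucc, j) a - marg ω i a| ≤ ε i.castSucc a
  stealth_last : ∀ a : Fin 2,
    |∑ j, ρ (Fin.last N, j) a - ∑' k : ℕ, marg ω (N + k) a| ≤ ε (Fin.last N) a
  budget : ∑ i, ∑ a, ε i a ≤ εs

/-- `(ρ, ε)` solves the finite program. -/
def IsTruncOptimal {n : ℕ} (ch : Channels) (A Q P : Matrix (Fin n) (Fin n) ℝ)
    (ω : ℕ × ℕ → Fin 2 → ℝ) (εs : ℝ) (N : ℕ)
    (ρ : Fin (N + 1) × Fin (N + 1) → Fin 2 → ℝ) (ε : Fin (N + 1) → Fin 2 → ℝ) : Prop :=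
  TruncFeasible ch ω εs N ρ ε ∧
    ∀ ρ' ε', TruncFeasible ch ω εs N ρ' ε' → truncCost ch A Q P N ρ ≤ truncCost ch A Q P N ρ'

/-- `τ` is a truncated policy obtained from `ρ`: `τ_{ij} = ρ(i,j,1) / ∑_a ρ(i,j,a)` for `i, j < N`
(arbitrary in `[0,1]` where the denominator is zero) and `τ_{ij} = 1` elsewhere. -/
def TruncInduces (N : ℕ) (ρ : Fin (N + 1) × Fin (N + 1) → Fin 2 → ℝ) (τ : ℕ × ℕ → ℝ) : Prop :=
  (∀ s, τ s ∈ Set.Icc (0 : ℝ) 1) ∧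
  (∀ i j : Fin N, ρ (i.castSucc, j.castSucc) 1 =
    τ (i, j) * ∑ a, ρ (i.castSucc, j.castSucc) a) ∧
  ∀ i j : ℕ, N ≤ i ∨ N ≤ j → τ (i, j) = 1

end Eavesdrop

end

/-! Policies that always transmit once a holding time has reached the horizon are handled exactly by
the truncation. The map `clamp` carries the original chain onto the truncated one, whatever the
action (`tsum_ekernel_clamp`), and such policies depend on the clamped state only. Beyond the
horizon the mass of the column $\eta^e=j$ is multiplied by $1-\lambda_e$ at each step in $j$, so the
mass lumped into the last column determines all columns behind it, and the second sum of the finite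
objective is the true cost of the tail (`truncCost_eq_of_lump`).

A nonzero invariant measure must charge $(0,0)$, since a transmission received by both has positive
probability; an invariant probability is therefore unique, being determined by its excursions from
$(0,0)$ (`invariant_unique`). Applied to the truncated chain, this shows that the stationary measure
of $\tau^c$ lumps to $\rho_t^c$. Hence the optimal value of the finite LP is the stationary cost of
$\tau^c$. The stealth constraints of the two programs differ only behind the horizon, where the
finite one compares sums; the price is at most twice the tail mass of $\omega_s$.

It remains to bound the limsup of the finite values by the infinite value. Let $r$ be feasible with
finite cost. Its excursions from $(0,0)$ are followed until a holding time reaches $N$, and from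
then on one transmits until $(0,0)$ is hit. The flow at the exit is dominated by $r$ outside the
box, and the cost of completing an excursion from column $j$ is bounded by a constant times
$1+\operatorname{tr}f^j(\bar P)$ plus a constant, because $(1-\lambda_e)|\lambda_{\max}(A)|^2<1$
(`exists_costBound`). So the added mass and cost vanish as $N\to\infty$, and normalising gives
admissible approximants (`exists_transmitting_approx`). These may violate stealth slightly; a small
admixture of a strictly stealthy measure, itself an approximant of $\omega$, repairs this
(`eventually_exists_truncFeasible`).

Time averages are identified with stationary costs as follows. If the laws are dominated by one
summable function, every ultrafilter limit of their Cesàro averages is an invariant probability, and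
uniqueness forces convergence (`tendsto_cesaro_of_unique`). From a state $s_0$ charged by an
invariant $R$, the laws are dominated by $R/R(s_0)$; under $\tau^c$, geometric tails of rows and
columns give domination from every initial state. -/

noncomputable section

namespace Eavesdrop

open scoped ENNReal

/-! ### Invariant measures, killed kernels and Green measures on a general state space -/

section Generic

variable {S : Type*}

/-- The image of the measure `m` under the kernel `K`. -/
def push (K : S → S → ℝ≥0∞) (m : S → ℝ≥0∞) : S → ℝ≥0∞ := fun s' => ∑' s, m s * K s s'

/-- The measure `m` is invariant under the kernel `K`. -/
def Invariant (K : S → S → ℝ≥0∞) (m : S → ℝ≥0∞) : Prop := ∀ s', push K m s' = m s'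

open Classical in
/-- The kernel `K` killed outside of `G`. -/
def kill (K : S → S → ℝ≥0∞) (G : S → Prop) : S → S → ℝ≥0∞ :=
  fun s s' => if G s' then K s s' else 0

/-- The Green measure `∑ₙ m Kⁿ`. -/
def green (K : S → S → ℝ≥0∞) (m : S → ℝ≥0∞) : S → ℝ≥0∞ :=
  fun s => ∑' k : ℕ, (push K)^[k] m s

lemma push_mono {K : S → S → ℝ≥0∞} {m m' : S → ℝ≥0∞} (h : ∀ s, m s ≤ m' s) (s : S) :
    push K m s ≤ push K m' s :=
  ENNReal.tsum_le_tsum fun t => by gcongr; exact h t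

lemma push_add (K : S → S → ℝ≥0∞) (m m' : S → ℝ≥0∞) (s : S) :
    push K (fun t => m t + m' t) s = push K m s + push K m' s := by
  simp only [push, add_mul, ENNReal.tsum_add]

lemma push_const_mul (K : S → S → ℝ≥0∞) (c : ℝ≥0∞) (m : S → ℝ≥0∞) (s : S) :
    push K (fun t => c * m t) s = c * push K m s := by
  simp only [push, mul_assoc, ENNReal.tsum_mul_left]

lemma push_tsum (K : S → S → ℝ≥0∞) (m : ℕ → S → ℝ≥0∞) (s : S) :
    push K (fun t => ∑' k, m k t) s = ∑' k, push K (m k) s := by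
  simp only [push, ← ENNReal.tsum_mul_right]
  exact ENNReal.tsum_comm

lemma tsum_push_mul (K : S → S → ℝ≥0∞) (m g : S → ℝ≥0∞) :
    ∑' s, push K m s * g s = ∑' s, m s * ∑' s', K s s' * g s' := by
  simp only [push, ← ENNReal.tsum_mul_right, ← ENNReal.tsum_mul_left, mul_assoc]
  exact ENNReal.tsum_comm

lemma tsum_push {K : S → S → ℝ≥0∞} (hK : ∀ s, ∑' s', K s s' = 1) (m : S → ℝ≥0∞) :
    ∑' s, push K m s = ∑' s, m s := by
  have := tsum_push_mul K m fun _ => 1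
  simpa [hK] using this

open Classical in
lemma push_kill (K : S → S → ℝ≥0∞) (G : S → Prop) (m : S → ℝ≥0∞) (s : S) :
    push (kill K G) m s = if G s then push K m s else 0 := by
  unfold push kill
  split_ifs <;> simp

lemma green_eq (K : S → S → ℝ≥0∞) (m : S → ℝ≥0∞) (s : S) :
    green K m s = m s + push K (green K m) s := by
  unfold green
  rw [push_tsum, tsum_eq_zero_add' ENNReal.summable]
  simp [Function.iterate_succ_apply']

/-- Minimality of the Green measure: by induction, every partial sum of the series stays below a
supersolution of $r = m + rK$. -/
lemma green_le {K : S → S → ℝ≥0∞} {m r : S → ℝ≥0∞} (h : ∀ s, m s + push K r s ≤ r s) (s : S) :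
    green K m s ≤ r s := by
  refine ENNReal.tsum_le_of_sum_range_le fun n => ?_
  induction n generalizing s with
  | zero => simp
  | succ n ih =>
    rw [Finset.sum_range_succ']
    refine le_trans ?_ (h s)
    rw [add_comm]
    simp only [Function.iterate_zero, id_eq]
    gcongr
    simp only [Function.iterate_succ_apply']
    refine le_trans (le_of_eq ?_) (push_mono ih s)
    simp only [push, Finset.sum_mul]
    rw [Summable.tsum_finsetSum]
    exact fun _ _ => ENNReal.summable

/-- A Foster–Lyapunov bound. Each step pays $g$ out of the decrease of the potential $V$, so the
total cost until killing is at most the initial potential; the remaining potential is kept in the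
induction and dropped at the end. -/
lemma tsum_green_mul_le {K : S → S → ℝ≥0∞} {g V : S → ℝ≥0∞}
    (h : ∀ s, g s + ∑' s', K s s' * V s' ≤ V s) (m : S → ℝ≥0∞) :
    ∑' s, green K m s * g s ≤ ∑' s, m s * V s := by
  have key : ∀ n, ∑ k ∈ Finset.range n, (∑' s, (push K)^[k] m s * g s)
      + ∑' s, (push K)^[n] m s * V s ≤ ∑' s, m s * V s := by
    intro n
    induction n with
    | zero => simp
    | succ n ih =>
      refine le_trans ?_ ih
      rw [Finset.sum_range_succ, add_assoc]
      gcongr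
      rw [Function.iterate_succ_apply', tsum_push_mul, ← ENNReal.tsum_add]
      refine ENNReal.tsum_le_tsum fun s => ?_
      rw [← mul_add]
      gcongr
      exact h s
  simp only [green, ← ENNReal.tsum_mul_right]
  rw [ENNReal.tsum_comm]
  exact ENNReal.tsum_le_of_sum_range_le fun n => le_trans le_self_add (key n)

lemma tendsto_tsum_of_dominated [Countable S] {g : ℕ → S → ℝ≥0∞} {g' f : S → ℝ≥0∞}
    (hf : ∑' s, f s ≠ ⊤) (hle : ∀ N s, g N s ≤ f s)
    (h : ∀ s, Tendsto (fun N => g N s) atTop (𝓝 (g' s))) :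
    Tendsto (fun N => ∑' s, g N s) atTop (𝓝 (∑' s, g' s)) := by
  let _ : MeasurableSpace S := ⊤
  have _ : DiscreteMeasurableSpace S := ⟨fun _ => trivial⟩
  simp only [← MeasureTheory.lintegral_count]
  refine MeasureTheory.tendsto_lintegral_of_dominated_convergence f
    (fun n => measurable_of_countable _) (fun n => ?_) ?_ ?_
  · exact Filter.Eventually.of_forall (hle n)
  · rwa [MeasureTheory.lintegral_count]
  · exact Filter.Eventually.of_forall h

/-- A measure below an invariant one that solves the same equations off `o` and has the same
mass at `o` coincides with it, if nonzero invariant measures charge `o`. -/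
lemma eq_of_le_invariant {K : S → S → ℝ≥0∞} (hK : ∀ s, ∑' s', K s s' = 1) {o : S}
    (hcharge : ∀ d, Invariant K d → d o = 0 → ∀ s, d s = 0)
    {r l : S → ℝ≥0∞} (hfin : ∑' s, r s ≠ ⊤) (hr : Invariant K r) (hle : ∀ s, l s ≤ r s)
    (ho : l o = r o) (hl : ∀ s, s ≠ o → push K l s = l s) (s : S) : l s = r s := by
  classical
  have hrt : ∀ s, r s ≠ ⊤ := ENNReal.ne_top_of_tsum_ne_top hfin
  have hlt : ∀ s, l s ≠ ⊤ := fun s => ne_top_of_le_ne_top (hrt s) (hle s)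
  set d : S → ℝ≥0∞ := fun s => r s - l s with hd
  have hrd : r = fun s => l s + d s := by
    funext s; exact (add_tsub_cancel_of_le (hle s)).symm
  have hdo : d o = 0 := by simp [hd, ho]
  have hpd : ∀ s, s ≠ o → push K d s = d s := by
    intro s hs
    have h1 := hr s
    rw [hrd, push_add, hl s hs] at h1
    exact (ENNReal.add_right_inj (hlt s)).1 h1
  have hdfin : ∑' s, d s ≠ ⊤ :=
    ne_top_of_le_ne_top hfin (ENNReal.tsum_le_tsum fun s => tsub_le_self)
  -- The kernel conserves total mass and the equation holds off `o`; since the mass is finite, the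
  -- equation at `o` follows by cancellation.
  have hpdo : push K d o = 0 := by
    have h1 := tsum_push hK d
    have h2 : ∀ f : S → ℝ≥0∞, ∑' s, f s = f o + ∑' s, (if s = o then 0 else f s) :=
      fun f => ENNReal.tsum_eq_add_tsum_ite o
    rw [h2 (push K d), h2 d, hdo, zero_add] at h1
    have h3 : ∀ s, (if s = o then 0 else push K d s) = if s = o then 0 else d s := by
      intro s; split_ifs with h
      · rfl
      · exact hpd s h
    simp only [h3] at h1
    have h4 : ∑' s, (if s = o then 0 else d s) ≠ ⊤ :=
      ne_top_of_le_ne_top hdfin (ENNReal.tsum_le_tsum fun s => by split_ifs <;> simp)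
    exact (ENNReal.add_left_inj h4).1 (h1.trans (zero_add _).symm)
  have hdinv : Invariant K d := by
    intro s
    by_cases hs : s = o
    · rw [hs, hpdo, hdo]
    · exact hpd s hs
  have hd0 := hcharge d hdinv hdo s
  have := congrFun hrd s
  simp only [hd0, add_zero] at this
  exact this.symm

/-- The cycle formula: an invariant measure is the expected occupation of one excursion from `o`,
scaled by its mass at `o`. The right side is the least solution of the equations off `o` with that
mass at `o`, hence lies below `r`, and `eq_of_le_invariant` excludes a gap. -/
lemma invariant_eq_green [DecidableEq S] {K : S → S → ℝ≥0∞} (hK : ∀ s, ∑' s', K s s' = 1) {o : S}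
    (hcharge : ∀ d, Invariant K d → d o = 0 → ∀ s, d s = 0)
    {r : S → ℝ≥0∞} (hfin : ∑' s, r s ≠ ⊤) (hr : Invariant K r) (s : S) :
    r s = r o * green (kill K (· ≠ o)) (Pi.single o 1) s := by
  set l : S → ℝ≥0∞ := fun s => r o * green (kill K (· ≠ o)) (Pi.single o 1) s with hl
  have hstep : ∀ s, l s = r o * (Pi.single o 1 : S → ℝ≥0∞) s + push (kill K (· ≠ o)) l s := by
    intro s
    rw [hl, push_const_mul, ← mul_add, ← green_eq]
  have hlo : l o = r o := by
    rw [hstep, push_kill]; simp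
  refine (eq_of_le_invariant hK hcharge hfin hr (l := l) ?_ hlo ?_ s).symm
  · intro s
    have : l s = green (kill K (· ≠ o)) (fun t => r o * (Pi.single o 1 : S → ℝ≥0∞) t) s := by
      rw [hl]
      simp only [green, ← ENNReal.tsum_mul_left]
      congr 1
      funext k
      induction k generalizing s with
      | zero => rfl
      | succ k ih =>
        rw [Function.iterate_succ_apply', Function.iterate_succ_apply', ← push_const_mul]
        congr 1
        funext t
        exact ih t
    rw [this]
    refine green_le (fun s => ?_) s
    rw [push_kill]
    by_cases hs : s = o
    · subst hs; simp
    · simp [hs, hr s]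
  · intro s hs
    rw [hstep s, push_kill]
    simp [hs]

/-- Both measures are multiples of the same excursion measure, and total mass $1$ fixes the
multiple. -/
lemma invariant_unique {K : S → S → ℝ≥0∞} (hK : ∀ s, ∑' s', K s s' = 1) {o : S}
    (hcharge : ∀ d, Invariant K d → d o = 0 → ∀ s, d s = 0)
    {r r' : S → ℝ≥0∞} (h1 : ∑' s, r s = 1) (hr : Invariant K r)
    (h1' : ∑' s, r' s = 1) (hr' : Invariant K r') : r = r' := by
  classical
  have e := invariant_eq_green hK hcharge (by simp [h1]) hr
  have e' := invariant_eq_green hK hcharge (by simp [h1']) hr'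
  set G := green (kill K (· ≠ o)) (Pi.single o 1)
  have t : r o * ∑' s, G s = 1 := by rw [← ENNReal.tsum_mul_left, ← h1]; exact tsum_congr fun s => (e s).symm
  have t' : r' o * ∑' s, G s = 1 := by
    rw [← ENNReal.tsum_mul_left, ← h1']; exact tsum_congr fun s => (e' s).symm
  have : r o = r' o := (ENNReal.eq_inv_of_mul_eq_one_left t).trans (ENNReal.eq_inv_of_mul_eq_one_left t').symm
  funext s
  rw [e s, e' s, this]

end Generic

/-! ### The controlled chain with kernels in `[0,∞]`, and recurrence through the origin -/

section Chain

/-- Legitimate receipt-and-acknowledgement has a positive probability, the adversary succeeds with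
a probability in `(0,1)`. -/
structure Channels.Proper (ch : Channels) : Prop where
  legit_pos : 0 < ch.legit * ch.ack
  legit_le : ch.legit * ch.ack ≤ 1
  adv_pos : 0 < ch.adv
  adv_lt : ch.adv < 1

/-- The kernel of the controlled chain with values in `[0,∞]`. -/
def ekernel (ch : Channels) (nxt : ℕ → ℕ) (s : ℕ × ℕ) (a : Fin 2) (s' : ℕ × ℕ) : ℝ≥0∞ :=
  ENNReal.ofReal (kernel ch nxt s a s')

/-- The kernel of the chain under the policy `τ`. -/
def polKernel (ch : Channels) (nxt : ℕ → ℕ) (τ : ℕ × ℕ → ℝ) (s s' : ℕ × ℕ) : ℝ≥0∞ :=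
  ∑ a, ENNReal.ofReal (actProb (τ s) a) * ekernel ch nxt s a s'

/-- Probability that a transmission reaches nobody. -/
def Channels.none (ch : Channels) : ℝ≥0∞ := ENNReal.ofReal ((1 - ch.legit * ch.ack) * (1 - ch.adv))
/-- Probability that a transmission reaches only the legitimate estimator. -/
def Channels.onlyLegit (ch : Channels) : ℝ≥0∞ := ENNReal.ofReal (ch.legit * ch.ack * (1 - ch.adv))
/-- Probability that a transmission reaches only the adversary. -/
def Channels.onlyAdv (ch : Channels) : ℝ≥0∞ := ENNReal.ofReal ((1 - ch.legit * ch.ack) * ch.adv)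
/-- Probability that a transmission reaches both receivers. -/
def Channels.both (ch : Channels) : ℝ≥0∞ := ENNReal.ofReal (ch.legit * ch.ack * ch.adv)
/-- Probability that the adversary misses a transmission. -/
def Channels.miss (ch : Channels) : ℝ≥0∞ := ENNReal.ofReal (1 - ch.adv)

variable {ch : Channels} (hch : ch.Proper)

include hch

lemma Channels.Proper.none_add_onlyLegit : ch.none + ch.onlyLegit = ch.miss := by
  obtain ⟨h1, h2, h3, h4⟩ := hch
  rw [Channels.none, Channels.onlyLegit, Channels.miss, ← ENNReal.ofReal_add]
  · congr 1; ring
  · exact mul_nonneg (by linarith) (by linarith)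
  · exact mul_nonneg (by linarith) (by linarith)

lemma Channels.Proper.onlyAdv_add_both : ch.onlyAdv + ch.both = ENNReal.ofReal ch.adv := by
  obtain ⟨h1, h2, h3, h4⟩ := hch
  rw [Channels.onlyAdv, Channels.both, ← ENNReal.ofReal_add]
  · congr 1; ring
  · exact mul_nonneg (by linarith) (by linarith)
  · exact mul_nonneg (by linarith) (by linarith)

lemma Channels.Proper.miss_add_adv : ch.miss + ENNReal.ofReal ch.adv = 1 := by
  obtain ⟨h1, h2, h3, h4⟩ := hch
  rw [Channels.miss, ← ENNReal.ofReal_add (by linarith) (by linarith)]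
  simp

lemma Channels.Proper.sum_eq_one : ch.none + ch.onlyLegit + ch.onlyAdv + ch.both = 1 := by
  rw [add_assoc, hch.none_add_onlyLegit, hch.onlyAdv_add_both, hch.miss_add_adv]

lemma Channels.Proper.both_ne_zero : ch.both ≠ 0 := by
  rw [Channels.both, Ne, ENNReal.ofReal_eq_zero, not_le]
  exact mul_pos hch.legit_pos hch.adv_pos

lemma kernel_nonneg (nxt : ℕ → ℕ) (s : ℕ × ℕ) (a : Fin 2) (s' : ℕ × ℕ) :
    0 ≤ kernel ch nxt s a s' := by
  obtain ⟨h1, h2, h3, h4⟩ := hch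
  have e1 : 0 ≤ (1 - ch.legit * ch.ack) * (1 - ch.adv) := mul_nonneg (by linarith) (by linarith)
  have e2 : 0 ≤ ch.legit * ch.ack * (1 - ch.adv) := mul_nonneg (by linarith) (by linarith)
  have e3 : 0 ≤ (1 - ch.legit * ch.ack) * ch.adv := mul_nonneg (by linarith) (by linarith)
  have e4 : 0 ≤ ch.legit * ch.ack * ch.adv := mul_nonneg (by linarith) (by linarith)
  unfold kernel
  have hi : ∀ (c : Prop) [Decidable c] (x : ℝ), 0 ≤ x → 0 ≤ if c then x else 0 := by
    intro c _ x hx; split_ifs <;> simp [hx]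
  refine ite_nonneg (hi _ _ zero_le_one) ?_
  have := hi (s' = (nxt s.1, nxt s.2)) _ e1
  have := hi (s' = (0, nxt s.2)) _ e2
  have := hi (s' = (nxt s.1, 0)) _ e3
  have := hi (s' = (0, 0)) _ e4
  positivity

omit hch in
lemma ekernel_zero (nxt : ℕ → ℕ) (s s' : ℕ × ℕ) :
    ekernel ch nxt s 0 s' = if s' = (nxt s.1, nxt s.2) then 1 else 0 := by
  unfold ekernel kernel
  rw [if_pos rfl]
  split_ifs <;> simp

lemma ekernel_one (nxt : ℕ → ℕ) (s s' : ℕ × ℕ) :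
    ekernel ch nxt s 1 s' = (if s' = (nxt s.1, nxt s.2) then ch.none else 0)
      + (if s' = (0, nxt s.2) then ch.onlyLegit else 0)
      + (if s' = (nxt s.1, 0) then ch.onlyAdv else 0) + (if s' = (0, 0) then ch.both else 0) := by
  obtain ⟨h1, h2, h3, h4⟩ := hch
  have e1 : 0 ≤ (1 - ch.legit * ch.ack) * (1 - ch.adv) := mul_nonneg (by linarith) (by linarith)
  have e2 : 0 ≤ ch.legit * ch.ack * (1 - ch.adv) := mul_nonneg (by linarith) (by linarith)
  have e3 : 0 ≤ (1 - ch.legit * ch.ack) * ch.adv := mul_nonneg (by linarith) (by linarith)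
  have e4 : 0 ≤ ch.legit * ch.ack * ch.adv := mul_nonneg (by linarith) (by linarith)
  unfold ekernel kernel Channels.none Channels.onlyLegit Channels.onlyAdv Channels.both
  have hi : ∀ (c : Prop) [Decidable c] (x : ℝ), 0 ≤ x → 0 ≤ if c then x else 0 := by
    intro c _ x hx; split_ifs <;> simp [hx]
  have hj : ∀ (c : Prop) [Decidable c] (x : ℝ), ENNReal.ofReal (if c then x else 0)
      = if c then ENNReal.ofReal x else 0 := by
    intro c _ x; split_ifs <;> simp
  have i1 := hi (s' = (nxt s.1, nxt s.2)) _ e1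
  have i2 := hi (s' = (0, nxt s.2)) _ e2
  have i3 := hi (s' = (nxt s.1, 0)) _ e3
  have i4 := hi (s' = (0, 0)) _ e4
  rw [if_neg one_ne_zero, ENNReal.ofReal_add (by positivity) i4,
    ENNReal.ofReal_add (by positivity) i3, ENNReal.ofReal_add i1 i2, hj, hj, hj, hj]

omit hch in
lemma tsum_ekernel_zero (nxt : ℕ → ℕ) (s : ℕ × ℕ) (g : ℕ × ℕ → ℝ≥0∞) :
    ∑' s', ekernel ch nxt s 0 s' * g s' = g (nxt s.1, nxt s.2) := by
  simp only [ekernel_zero, ite_mul, zero_mul, one_mul]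
  exact tsum_ite_eq _ (fun s' => g s')

lemma tsum_ekernel_one (nxt : ℕ → ℕ) (s : ℕ × ℕ) (g : ℕ × ℕ → ℝ≥0∞) :
    ∑' s', ekernel ch nxt s 1 s' * g s' = ch.none * g (nxt s.1, nxt s.2)
      + ch.onlyLegit * g (0, nxt s.2) + ch.onlyAdv * g (nxt s.1, 0) + ch.both * g (0, 0) := by
  simp only [ekernel_one hch, add_mul, ENNReal.tsum_add, ite_mul, zero_mul]
  congr 1
  · congr 1
    · congr 1
      · exact tsum_ite_eq _ (fun s' => _ * g s')
      · exact tsum_ite_eq _ (fun s' => _ * g s')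
    · exact tsum_ite_eq _ (fun s' => _ * g s')
  · exact tsum_ite_eq _ (fun s' => _ * g s')

lemma tsum_ekernel (nxt : ℕ → ℕ) (s : ℕ × ℕ) (a : Fin 2) : ∑' s', ekernel ch nxt s a s' = 1 := by
  fin_cases a
  · simpa using tsum_ekernel_zero (ch := ch) nxt s fun _ => 1
  · simpa [hch.sum_eq_one] using tsum_ekernel_one hch nxt s fun _ => 1

omit hch in
lemma actProb_nonneg {t : ℝ} (ht : t ∈ Set.Icc (0 : ℝ) 1) (a : Fin 2) : 0 ≤ actProb t a := by
  unfold actProb; split_ifs <;> linarith [ht.1, ht.2]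

omit hch in
lemma sum_ofReal_actProb {t : ℝ} (ht : t ∈ Set.Icc (0 : ℝ) 1) :
    ∑ a, ENNReal.ofReal (actProb t a) = 1 := by
  rw [← ENNReal.ofReal_sum_of_nonneg fun a _ => actProb_nonneg ht a]
  simp [actProb]

omit hch in
lemma tsum_polKernel_mul (nxt : ℕ → ℕ) (τ : ℕ × ℕ → ℝ) (s : ℕ × ℕ) (g : ℕ × ℕ → ℝ≥0∞) :
    ∑' s', polKernel ch nxt τ s s' * g s'
      = ∑ a, ENNReal.ofReal (actProb (τ s) a) * ∑' s', ekernel ch nxt s a s' * g s' := by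
  simp only [polKernel, Finset.sum_mul, mul_assoc, ← ENNReal.tsum_mul_left]
  rw [Summable.tsum_finsetSum fun _ _ => ENNReal.summable]

lemma tsum_polKernel (nxt : ℕ → ℕ) {τ : ℕ × ℕ → ℝ} (hτ : ∀ s, τ s ∈ Set.Icc (0 : ℝ) 1)
    (s : ℕ × ℕ) : ∑' s', polKernel ch nxt τ s s' = 1 := by
  have := tsum_polKernel_mul (ch := ch) nxt τ s fun _ => 1
  simpa [tsum_ekernel hch, sum_ofReal_actProb (hτ s)] using this

omit hch in
lemma polKernel_of_eq_one {nxt : ℕ → ℕ} {τ : ℕ × ℕ → ℝ} {s : ℕ × ℕ} (h : τ s = 1) (s' : ℕ × ℕ) :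
    polKernel ch nxt τ s s' = ekernel ch nxt s 1 s' := by
  simp [polKernel, actProb, h]

/-- Nonzero invariant measures charge `(0,0)`. -/
lemma invariant_charges_origin {nxt : ℕ → ℕ} {τ : ℕ × ℕ → ℝ}
    (hnxt : ∀ s, τ s = 1 ∨ ∀ t, nxt t = s.1 → t + 1 = s.1)
    (d : ℕ × ℕ → ℝ≥0∞) (hd : Invariant (polKernel ch nxt τ) d) (h0 : d (0, 0) = 0)
    (s : ℕ × ℕ) : d s = 0 := by
  -- There is no inflow into $(0,0)$, whereas every transmission sends a positive fraction there; so
  -- no mass transmits.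
  have h1 : ∀ s, d s * ENNReal.ofReal (τ s) = 0 := by
    intro s
    have := hd (0, 0)
    rw [h0, push, ENNReal.tsum_eq_zero] at this
    have := this s
    rw [mul_eq_zero] at this
    rcases this with h | h
    · simp [h]
    · rw [polKernel, Fin.sum_univ_two, ekernel_one hch, add_eq_zero] at h
      have := h.2
      rw [mul_eq_zero] at this
      rcases this with h | h
      · simp only [actProb, if_true] at h
        simp [h]
      · simp [hch.both_ne_zero] at h
  have h2 : ∀ s, τ s = 1 → d s = 0 := by
    intro s hs
    simpa [hs] using h1 s
  -- Mass that never transmits moves only by `nxt`. By `hnxt`, a state either transmits, and is then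
  -- empty, or can be entered without transmission only from the preceding row. Row $0$ has no
  -- preceding row, so the rows are emptied one after another. The alternative $\tau=1$ covers the
  -- row $N$ of the truncated chain, which is also entered from itself.
  have h3 : ∀ i j, d (i, j) = 0 := by
    intro i
    induction i with
    | zero =>
      intro j
      rcases hnxt (0, j) with h | h
      · exact h2 _ h
      · rw [← hd, push, ENNReal.tsum_eq_zero]
        intro s
        by_cases hs : d s = 0
        · simp [hs]
        have : ENNReal.ofReal (τ s) = 0 := (mul_eq_zero.1 (h1 s)).resolve_left hs
        have h4 : ¬ ((0, j) : ℕ × ℕ) = (nxt s.1, nxt s.2) := by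
          intro e
          have := h s.1 (congrArg Prod.fst e).symm
          simp at this
        simp only [polKernel, Fin.sum_univ_two, ekernel_zero, if_neg h4]
        simp [actProb, this]
    | succ i ih =>
      intro j
      rcases hnxt (i + 1, j) with h | h
      · exact h2 _ h
      · rw [← hd, push, ENNReal.tsum_eq_zero]
        intro s
        by_cases hs : d s = 0
        · simp [hs]
        have : ENNReal.ofReal (τ s) = 0 := (mul_eq_zero.1 (h1 s)).resolve_left hs
        have h4 : ¬ ((i + 1, j) : ℕ × ℕ) = (nxt s.1, nxt s.2) := by
          intro e
          have h5 := h s.1 (congrArg Prod.fst e).symm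
          have h6 : s.1 = i := by simpa using h5
          exact hs (by rw [← ih s.2, ← h6])
        simp only [polKernel, Fin.sum_univ_two, ekernel_zero, if_neg h4]
        simp [actProb, this]
  exact h3 s.1 s.2

end Chain

/-! ### Convergence of Cesàro averages of dominated laws -/

section Ergodic

variable {S : Type*}

/-- The Cesàro average of `μ 1, …, μ T`. -/
def cesaro (μ : ℕ → S → ℝ) (T : ℕ) (s : S) : ℝ := (1 / (T : ℝ)) * ∑ k ∈ Finset.Icc 1 T, μ k s

variable {μ : ℕ → S → ℝ} {b : S → ℝ}

lemma cesaro_nonneg (h0 : ∀ k s, 0 ≤ μ k s) (T : ℕ) (s : S) : 0 ≤ cesaro μ T s :=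
  mul_nonneg (by positivity) (Finset.sum_nonneg fun k _ => h0 k s)

lemma cesaro_le (h0 : ∀ k s, 0 ≤ μ k s) (hb : ∀ k s, μ k s ≤ b s) (T : ℕ) (s : S) :
    cesaro μ T s ≤ b s := by
  have hbs : 0 ≤ b s := (h0 0 s).trans (hb 0 s)
  unfold cesaro
  rcases Nat.eq_zero_or_pos T with rfl | hT
  · simpa using hbs
  · have hT' : (0 : ℝ) < T := by exact_mod_cast hT
    rw [one_div, inv_mul_le_iff₀ hT']
    calc ∑ k ∈ Finset.Icc 1 T, μ k s ≤ ∑ _k ∈ Finset.Icc 1 T, b s :=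
          Finset.sum_le_sum fun k _ => hb k s
      _ = T * b s := by simp

lemma tsum_cesaro_mul {f : S → ℝ} (h : ∀ k, Summable fun s => μ k s * f s) (T : ℕ) :
    ∑' s, cesaro μ T s * f s = (1 / (T : ℝ)) * ∑ k ∈ Finset.Icc 1 T, ∑' s, μ k s * f s := by
  rw [← Summable.tsum_finsetSum fun k _ => h k, ← tsum_mul_left]
  refine tsum_congr fun s => ?_
  rw [cesaro, mul_assoc, Finset.sum_mul]

/-- Convergence of averages of an observable, from pointwise convergence and domination. -/
lemma tendsto_average_observable {π f : S → ℝ} (h0 : ∀ k s, 0 ≤ μ k s) (hb : ∀ k s, μ k s ≤ b s)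
    (hf : ∀ s, 0 ≤ f s) (hbf : Summable fun s => b s * f s)
    (hlim : ∀ s, Tendsto (fun T => cesaro μ T s) atTop (𝓝 (π s))) :
    Tendsto (fun T : ℕ => (1 / (T : ℝ)) * ∑ k ∈ Finset.Icc 1 T, ∑' s, μ k s * f s) atTop
      (𝓝 (∑' s, π s * f s)) := by
  have hs : ∀ k, Summable fun s => μ k s * f s := fun k =>
    hbf.of_nonneg_of_le (fun s => mul_nonneg (h0 k s) (hf s))
      fun s => mul_le_mul_of_nonneg_right (hb k s) (hf s)
  simp only [← tsum_cesaro_mul hs]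
  refine tendsto_tsum_of_dominated_convergence hbf (fun s => (hlim s).mul_const _) ?_
  refine Filter.Eventually.of_forall fun T s => ?_
  rw [Real.norm_of_nonneg (mul_nonneg (cesaro_nonneg h0 T s) (hf s))]
  exact mul_le_mul_of_nonneg_right (cesaro_le h0 hb T s) (hf s)

/-- Along an ultrafilter, the Cesàro averages of dominated laws of a Markov chain converge to an
invariant probability. -/
lemma exists_cesaro_limit {K : S → S → ℝ} (hK0 : ∀ s s', 0 ≤ K s s') (hK1 : ∀ s s', K s s' ≤ 1)
    (h0 : ∀ k s, 0 ≤ μ k s) (hb : ∀ k s, μ k s ≤ b s) (hbs : Summable b)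
    (h1 : ∀ k, HasSum (μ k) 1) (hstep : ∀ k s', μ (k + 1) s' = ∑' s, μ k s * K s s')
    (U : Ultrafilter ℕ) (hU : (U : Filter ℕ) ≤ atTop) :
    ∃ π : S → ℝ, (∀ s, Tendsto (fun T => cesaro μ T s) U (𝓝 (π s))) ∧ (∀ s, 0 ≤ π s) ∧
      HasSum π 1 ∧ ∀ s', π s' = ∑' s, π s * K s s' := by
  have hex : ∀ s, ∃ x ∈ Set.Icc 0 (b s), Tendsto (fun T => cesaro μ T s) U (𝓝 x) := by
    intro s
    have := (isCompact_Icc (a := (0 : ℝ)) (b := b s)).ultrafilter_le_nhds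
      (U.map fun T => cesaro μ T s) (by
        rw [le_principal_iff]
        change ∀ᶠ T : ℕ in (U : Filter ℕ), cesaro μ T s ∈ Set.Icc 0 (b s)
        exact Filter.Eventually.of_forall fun T => ⟨cesaro_nonneg h0 T s, cesaro_le h0 hb T s⟩)
    obtain ⟨x, hx, hle⟩ := this
    exact ⟨x, hx, hle⟩
  choose π hπ hlim using hex
  have hπs : Summable π := hbs.of_nonneg_of_le (fun s => (hπ s).1) fun s => (hπ s).2
  -- The summable bound prevents mass from escaping to infinity, so sums against bounded observables
  -- pass to the limit. With $f=1$ this gives total mass $1$, with $f=K(\cdot,s')$ invariance.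
  have hdom : ∀ f : S → ℝ, (∀ s, 0 ≤ f s) → (∀ s, f s ≤ 1) →
      Tendsto (fun T => ∑' s, cesaro μ T s * f s) U (𝓝 (∑' s, π s * f s)) := by
    intro f hf0 hf1
    refine tendsto_tsum_of_dominated_convergence hbs (fun s => (hlim s).mul_const _) ?_
    refine Filter.Eventually.of_forall fun T s => ?_
    rw [Real.norm_of_nonneg (mul_nonneg (cesaro_nonneg h0 T s) (hf0 s))]
    calc cesaro μ T s * f s ≤ cesaro μ T s * 1 :=
          mul_le_mul_of_nonneg_left (hf1 s) (cesaro_nonneg h0 T s)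
      _ ≤ b s := by rw [mul_one]; exact cesaro_le h0 hb T s
  have hsum : ∀ (f : S → ℝ), (∀ s, 0 ≤ f s) → (∀ s, f s ≤ 1) → ∀ k,
      Summable fun s => μ k s * f s := by
    intro f hf0 hf1 k
    exact (h1 k).summable.of_nonneg_of_le (fun s => mul_nonneg (h0 k s) (hf0 s))
      fun s => mul_le_of_le_one_right (h0 k s) (hf1 s)
  refine ⟨π, hlim, fun s => (hπ s).1, ?_, fun s' => ?_⟩
  · have h := hdom (fun _ => 1) (fun _ => zero_le_one) fun _ => le_rfl
    have h2 : (fun T => ∑' s, cesaro μ T s * (fun _ => (1 : ℝ)) s) =ᶠ[(U : Filter ℕ)] fun _ => 1 := by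
      filter_upwards [hU (eventually_ge_atTop 1)] with T hT
      rw [tsum_cesaro_mul (hsum (fun _ => 1) (fun _ => zero_le_one) fun _ => le_rfl)]
      have : (T : ℝ) ≠ 0 := by positivity
      simp [(h1 _).tsum_eq, this]
    have h3 := tendsto_nhds_unique h (tendsto_const_nhds.congr' h2.symm)
    simp only [mul_one] at h3
    rw [← h3]
    exact hπs.hasSum
  · have h := hdom (fun s => K s s') (fun s => hK0 s s') fun s => hK1 s s'
    -- Shifting the averaging window by one step changes only its two end terms, which are
    -- negligible after division by $T$.
    have h2 : ∀ T, ∑' s, cesaro μ T s * K s s'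
        = cesaro μ T s' + (1 / (T : ℝ)) * (μ (T + 1) s' - μ 1 s') := by
      intro T
      rw [tsum_cesaro_mul (hsum _ (fun s => hK0 s s') fun s => hK1 s s'), cesaro, ← mul_add]
      congr 1
      simp only [← hstep]
      induction T with
      | zero => simp
      | succ T ih =>
        rw [Finset.sum_Icc_succ_top (by omega), Finset.sum_Icc_succ_top (by omega), ih]
        ring
    have h3 : Tendsto (fun T : ℕ => (1 / (T : ℝ)) * (μ (T + 1) s' - μ 1 s')) U (𝓝 0) := by
      have h4 : Tendsto (fun T : ℕ => (1 / (T : ℝ)) * (2 * b s')) atTop (𝓝 0) := by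
        simpa using tendsto_one_div_atTop_nhds_zero_nat.mul_const (2 * b s')
      refine (squeeze_zero_norm (fun T => ?_) h4).mono_left hU
      rw [norm_mul, Real.norm_of_nonneg (by positivity)]
      refine mul_le_mul_of_nonneg_left ?_ (by positivity)
      rw [Real.norm_eq_abs, abs_le]
      have := h0 (T + 1) s'
      have := hb (T + 1) s'
      have := h0 1 s'
      have := hb 1 s'
      constructor <;> linarith
    simp only [h2] at h
    have h5 := (hlim s').add h3
    rw [add_zero] at h5
    exact tendsto_nhds_unique h5 h

/-- All ultrafilter limits are invariant probabilities, hence equal to the only one; no aperiodicity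
is needed for averages. -/
lemma tendsto_cesaro_of_unique {K : S → S → ℝ} (hK0 : ∀ s s', 0 ≤ K s s')
    (hK1 : ∀ s s', K s s' ≤ 1)
    (h0 : ∀ k s, 0 ≤ μ k s) (hb : ∀ k s, μ k s ≤ b s) (hbs : Summable b)
    (h1 : ∀ k, HasSum (μ k) 1) (hstep : ∀ k s', μ (k + 1) s' = ∑' s, μ k s * K s s')
    {π : S → ℝ} (hπ : ∀ π' : S → ℝ, (∀ s, 0 ≤ π' s) → HasSum π' 1 →
      (∀ s', π' s' = ∑' s, π' s * K s s') → π' = π) (s : S) :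
    Tendsto (fun T => cesaro μ T s) atTop (𝓝 (π s)) := by
  rw [tendsto_iff_ultrafilter]
  intro U hU
  obtain ⟨π', hlim, hnn, hsum, hinv⟩ := exists_cesaro_limit hK0 hK1 h0 hb hbs h1 hstep U hU
  rw [← hπ π' hnn hsum hinv]
  exact hlim s

end Ergodic

/-! ### Occupation measures in `[0,∞]`, their policies and uniqueness -/

section Occupation

lemma tsum_stateAction {S : Type*} (f : S → Fin 2 → ℝ≥0∞) :
    ∑' x : S × Fin 2, f x.1 x.2 = ∑' s, ∑ a, f s a := by
  rw [ENNReal.tsum_prod']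
  exact tsum_congr fun s => tsum_fintype _

/-- Occupation measures with values in `[0,∞]`, for the chain with update `nxt`. -/
structure EOcc (ch : Channels) (nxt : ℕ → ℕ) (r : ℕ × ℕ → Fin 2 → ℝ≥0∞) : Prop where
  total : ∑' s, ∑ a, r s a = 1
  balance : ∀ s', ∑ a, r s' a = ∑' s, ∑ a, r s a * ekernel ch nxt s a s'

lemma ekernel_ne_top {ch : Channels} {nxt : ℕ → ℕ} (s : ℕ × ℕ) (a : Fin 2) (s' : ℕ × ℕ) :
    ekernel ch nxt s a s' ≠ ⊤ := ENNReal.ofReal_ne_top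

/-- The state marginal. -/
def stateMass (r : ℕ × ℕ → Fin 2 → ℝ≥0∞) (s : ℕ × ℕ) : ℝ≥0∞ := ∑ a, r s a

/-- `τ` is a policy of the state-action measure `r`. -/
def Disintegrates (r : ℕ × ℕ → Fin 2 → ℝ≥0∞) (τ : ℕ × ℕ → ℝ) : Prop :=
  ∀ s a, r s a = ENNReal.ofReal (actProb (τ s) a) * stateMass r s

variable {ch : Channels} {nxt : ℕ → ℕ}

lemma EOcc.stateMass_ne_top {r : ℕ × ℕ → Fin 2 → ℝ≥0∞} (hr : EOcc ch nxt r) (s : ℕ × ℕ) :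
    stateMass r s ≠ ⊤ :=
  ENNReal.ne_top_of_tsum_ne_top (f := stateMass r) (by
    change ∑' s, ∑ a, r s a ≠ ⊤
    rw [hr.total]; exact ENNReal.one_ne_top) s

lemma le_stateMass (r : ℕ × ℕ → Fin 2 → ℝ≥0∞) (s : ℕ × ℕ) (a : Fin 2) : r s a ≤ stateMass r s :=
  Finset.single_le_sum (f := r s) (fun _ _ => zero_le) (Finset.mem_univ a)

lemma EOcc.ne_top {r : ℕ × ℕ → Fin 2 → ℝ≥0∞} (hr : EOcc ch nxt r) (s : ℕ × ℕ) (a : Fin 2) :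
    r s a ≠ ⊤ := ne_top_of_le_ne_top (hr.stateMass_ne_top s) (le_stateMass r s a)

lemma EOcc.tsum_mul {r : ℕ × ℕ → Fin 2 → ℝ≥0∞} (hr : EOcc ch nxt r) (g : ℕ × ℕ → ℝ≥0∞) :
    ∑' s, stateMass r s * g s = ∑' s, ∑ a, r s a * ∑' s', ekernel ch nxt s a s' * g s' := by
  simp only [stateMass, hr.balance, ← ENNReal.tsum_mul_right, Finset.sum_mul,
    ← ENNReal.tsum_mul_left]
  rw [ENNReal.tsum_comm]
  refine tsum_congr fun s => ?_
  rw [Summable.tsum_finsetSum fun _ _ => ENNReal.summable]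
  simp only [mul_assoc]

lemma Disintegrates.invariant {r : ℕ × ℕ → Fin 2 → ℝ≥0∞} (hr : EOcc ch nxt r) {τ : ℕ × ℕ → ℝ}
    (hτ : Disintegrates r τ) : Invariant (polKernel ch nxt τ) (stateMass r) := by
  intro s'
  rw [stateMass, hr.balance, push]
  refine tsum_congr fun s => ?_
  rw [polKernel, Finset.mul_sum]
  refine Finset.sum_congr rfl fun a _ => ?_
  rw [hτ s a]; ring

lemma EOcc.of_invariant {τ : ℕ × ℕ → ℝ} (hτ : ∀ s, τ s ∈ Set.Icc (0 : ℝ) 1)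
    {R : ℕ × ℕ → ℝ≥0∞} (h1 : ∑' s, R s = 1) (hR : Invariant (polKernel ch nxt τ) R) :
    EOcc ch nxt fun s a => ENNReal.ofReal (actProb (τ s) a) * R s := by
  have h : ∀ s, ∑ a, ENNReal.ofReal (actProb (τ s) a) * R s = R s := fun s => by
    rw [← Finset.sum_mul, sum_ofReal_actProb (hτ s), one_mul]
  refine ⟨by simp only [h, h1], fun s' => ?_⟩
  rw [h, ← hR s', push]
  refine tsum_congr fun s => ?_
  rw [polKernel, Finset.mul_sum]
  refine Finset.sum_congr rfl fun a _ => ?_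
  ring

lemma stateMass_actProb {τ : ℕ × ℕ → ℝ} (hτ : ∀ s, τ s ∈ Set.Icc (0 : ℝ) 1) (R : ℕ × ℕ → ℝ≥0∞) :
    stateMass (fun s a => ENNReal.ofReal (actProb (τ s) a) * R s) = R := by
  funext s
  rw [stateMass, ← Finset.sum_mul, sum_ofReal_actProb (hτ s), one_mul]

/-- The policy determines the action given the state, so uniqueness reduces to that of the invariant
probability on states. Keeping `nxt` general allows the use for both the original and the truncated
chain. -/
lemma EOcc.unique (hch : ch.Proper) {τ : ℕ × ℕ → ℝ} (hτ : ∀ s, τ s ∈ Set.Icc (0 : ℝ) 1)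
    (hnxt : ∀ s, τ s = 1 ∨ ∀ t, nxt t = s.1 → t + 1 = s.1)
    {r r' : ℕ × ℕ → Fin 2 → ℝ≥0∞} (hr : EOcc ch nxt r) (hr' : EOcc ch nxt r')
    (h : Disintegrates r τ) (h' : Disintegrates r' τ) : r = r' := by
  have : stateMass r = stateMass r' := invariant_unique (tsum_polKernel hch nxt hτ) (invariant_charges_origin hch hnxt)
    hr.total (h.invariant hr) hr'.total (h'.invariant hr')
  funext s a
  rw [h s a, h' s a, this]

lemma ofReal_actProb_mul {t : ℝ} (ht : t ∈ Set.Icc (0 : ℝ) 1) {x : Fin 2 → ℝ} (hx : ∀ a, 0 ≤ x a)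
    (h : x 1 = t * ∑ a, x a) (a : Fin 2) :
    ENNReal.ofReal (x a) = ENNReal.ofReal (actProb t a) * ∑ b, ENNReal.ofReal (x b) := by
  rw [← ENNReal.ofReal_sum_of_nonneg fun b _ => hx b, ← ENNReal.ofReal_mul (actProb_nonneg ht a)]
  congr 1
  rw [Fin.sum_univ_two] at h ⊢
  fin_cases a
  · simp [actProb]; linarith
  · simpa [actProb] using h

lemma Induces.disintegrates {ρ : ℕ × ℕ → Fin 2 → ℝ} (hρ : ∀ s a, 0 ≤ ρ s a) {τ : ℕ × ℕ → ℝ}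
    (h : Induces ρ τ) : Disintegrates (fun s a => ENNReal.ofReal (ρ s a)) τ :=
  fun s a => ofReal_actProb_mul (h.1 s) (hρ s) (h.2 s) a

lemma Disintegrates.induces {r : ℕ × ℕ → Fin 2 → ℝ≥0∞} {τ : ℕ × ℕ → ℝ}
    (hτ : ∀ s, τ s ∈ Set.Icc (0 : ℝ) 1) (hr : ∀ s a, r s a ≠ ⊤) (h : Disintegrates r τ) :
    Induces (fun s a => (r s a).toReal) τ := by
  refine ⟨hτ, fun s => ?_⟩
  dsimp only
  rw [← ENNReal.toReal_sum fun a _ => hr s a, h s 1, ENNReal.toReal_mul,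
    ENNReal.toReal_ofReal (actProb_nonneg (hτ s) 1)]
  simp [actProb, stateMass]

lemma exists_disintegrates {r : ℕ × ℕ → Fin 2 → ℝ≥0∞} (hr : ∀ s a, r s a ≠ ⊤) :
    ∃ τ : ℕ × ℕ → ℝ, (∀ s, τ s ∈ Set.Icc (0 : ℝ) 1) ∧ Disintegrates r τ := by
  have key : ∀ s, ∃ t ∈ Set.Icc (0 : ℝ) 1, (r s 1).toReal = t * ∑ a, (r s a).toReal := by
    intro s
    rw [Fin.sum_univ_two]
    have h0 := ENNReal.toReal_nonneg (a := r s 0)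
    have h1 := ENNReal.toReal_nonneg (a := r s 1)
    rcases eq_or_lt_of_le (add_nonneg h0 h1) with h | h
    · exact ⟨0, ⟨le_rfl, zero_le_one⟩, by linarith⟩
    · exact ⟨(r s 1).toReal / ((r s 0).toReal + (r s 1).toReal),
        ⟨div_nonneg h1 h.le, (div_le_one h).2 (by linarith)⟩, by field_simp⟩
  choose τ hτ h using key
  refine ⟨τ, hτ, fun s a => ?_⟩
  have := ofReal_actProb_mul (hτ s) (fun a => ENNReal.toReal_nonneg) (h s) a
  simpa [ENNReal.ofReal_toReal (hr s _), stateMass] using this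

lemma IsOccupation.eocc (hch : ch.Proper) {ρ : ℕ × ℕ → Fin 2 → ℝ} (h : IsOccupation ch ρ) :
    EOcc ch (· + 1) fun s a => ENNReal.ofReal (ρ s a) := by
  have hs := h.total.summable
  constructor
  · rw [← tsum_stateAction fun s a => ENNReal.ofReal (ρ s a),
      ← ENNReal.ofReal_tsum_of_nonneg (fun x : (ℕ × ℕ) × Fin 2 => h.nonneg x.1 x.2) hs,
      h.total.tsum_eq, ENNReal.ofReal_one]
  · intro s'
    rw [← ENNReal.ofReal_sum_of_nonneg fun a _ => h.nonneg s' a, h.balance]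
    have hk1 : ∀ s a, kernel ch (· + 1) s a s' ≤ 1 := by
      intro s a
      have h1 : ekernel ch (· + 1) s a s' ≤ 1 := by
        rw [← tsum_ekernel hch (· + 1) s a]; exact ENNReal.le_tsum s'
      exact ENNReal.ofReal_le_one.1 h1
    unfold trans
    rw [ENNReal.ofReal_tsum_of_nonneg (fun x : (ℕ × ℕ) × Fin 2 =>
      mul_nonneg (h.nonneg x.1 x.2) (kernel_nonneg hch _ _ _ _)),
      ← tsum_stateAction fun s a => ENNReal.ofReal (ρ s a) * ekernel ch (· + 1) s a s']
    · exact tsum_congr fun x => ENNReal.ofReal_mul (h.nonneg _ _)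
    · exact hs.of_nonneg_of_le
        (fun x => mul_nonneg (h.nonneg x.1 x.2) (kernel_nonneg hch _ _ _ _))
        fun x => mul_le_of_le_one_right (h.nonneg x.1 x.2) (hk1 _ _)

lemma EOcc.isOccupation (hch : ch.Proper) {r : ℕ × ℕ → Fin 2 → ℝ≥0∞} (h : EOcc ch (· + 1) r) :
    IsOccupation ch fun s a => (r s a).toReal := by
  have h1 : ∑' x : (ℕ × ℕ) × Fin 2, r x.1 x.2 = 1 := by
    rw [tsum_stateAction, h.total]
  refine ⟨fun s a => ENNReal.toReal_nonneg, ?_, fun s' => ?_⟩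
  · have h2 : Summable fun x : (ℕ × ℕ) × Fin 2 => (r x.1 x.2).toReal :=
      ENNReal.summable_toReal (by simp [h1])
    convert h2.hasSum using 1
    rw [← ENNReal.tsum_toReal_eq fun x => h.ne_top _ _, h1, ENNReal.toReal_one]
  · rw [← ENNReal.toReal_sum fun a _ => h.ne_top s' a, h.balance]
    rw [← tsum_stateAction fun s a => r s a * ekernel ch (· + 1) s a s', ENNReal.tsum_toReal_eq
      fun x : (ℕ × ℕ) × Fin 2 => ENNReal.mul_ne_top (h.ne_top x.1 x.2) (ekernel_ne_top _ _ _)]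
    refine tsum_congr fun x => ?_
    rw [ENNReal.toReal_mul, ekernel, ENNReal.toReal_ofReal (kernel_nonneg hch _ _ _ _)]
    rfl

lemma ofReal_toReal_occ {r : ℕ × ℕ → Fin 2 → ℝ≥0∞} (h : ∀ s a, r s a ≠ ⊤) :
    (fun s a => ENNReal.ofReal (r s a).toReal) = r := by
  funext s a
  rw [ENNReal.ofReal_toReal (h s a)]

lemma toReal_ofReal_occ {ρ : ℕ × ℕ → Fin 2 → ℝ} (h : ∀ s a, 0 ≤ ρ s a) :
    (fun s a => (ENNReal.ofReal (ρ s a)).toReal) = ρ := by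
  funext s a
  rw [ENNReal.toReal_ofReal (h s a)]

end Occupation

/-! ### Lumping onto the truncated state space, and exactness of the finite objective -/

section Lump

/-- Truncation of a pair of holding times at `N`. -/
def clamp (N : ℕ) (s : ℕ × ℕ) : ℕ × ℕ := (min s.1 N, min s.2 N)

/-- The update of the holding times in the truncated chain. -/
def truncNext (N : ℕ) (i : ℕ) : ℕ := min (i + 1) N

/-- The image of a state-action measure under truncation of the states. -/
def lump (N : ℕ) (r : ℕ × ℕ → Fin 2 → ℝ≥0∞) (s' : ℕ × ℕ) (a : Fin 2) : ℝ≥0∞ :=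
  ∑' s, if s' = clamp N s then r s a else 0

/-- The state-action measure on `ℕ × ℕ` given by a measure on the truncated state space. -/
def extend (N : ℕ) (ρ : Fin (N + 1) × Fin (N + 1) → Fin 2 → ℝ) (s : ℕ × ℕ) (a : Fin 2) : ℝ≥0∞ :=
  if h : s.1 < N + 1 ∧ s.2 < N + 1 then ENNReal.ofReal (ρ (⟨s.1, h.1⟩, ⟨s.2, h.2⟩) a) else 0

/-- The restriction of a state-action measure to the truncated state space. -/
def restrict (N : ℕ) (r : ℕ × ℕ → Fin 2 → ℝ≥0∞) (x : Fin (N + 1) × Fin (N + 1)) (a : Fin 2) : ℝ :=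
  (r (x.1, x.2) a).toReal

variable {ch : Channels} {N : ℕ} {r : ℕ × ℕ → Fin 2 → ℝ≥0∞}

lemma tsum_lump_mul (N : ℕ) (r : ℕ × ℕ → Fin 2 → ℝ≥0∞) (a : Fin 2) (g : ℕ × ℕ → ℝ≥0∞) :
    ∑' s, lump N r s a * g s = ∑' s, r s a * g (clamp N s) := by
  simp only [lump, ← ENNReal.tsum_mul_right, ite_mul, zero_mul]
  rw [ENNReal.tsum_comm]
  refine tsum_congr fun s => ?_
  exact tsum_ite_eq (clamp N s) (fun s' => r s a * g s')

lemma tsum_stateMass_lump_mul (N : ℕ) (r : ℕ × ℕ → Fin 2 → ℝ≥0∞) (g : ℕ × ℕ → ℝ≥0∞) :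
    ∑' s, stateMass (lump N r) s * g s = ∑' s, stateMass r s * g (clamp N s) := by
  simp only [stateMass, Finset.sum_mul]
  rw [Summable.tsum_finsetSum fun _ _ => ENNReal.summable,
    Summable.tsum_finsetSum fun _ _ => ENNReal.summable]
  exact Finset.sum_congr rfl fun a _ => tsum_lump_mul N r a g

lemma truncNext_min (N i : ℕ) : truncNext N (min i N) = min (i + 1) N := by
  unfold truncNext; omega

/-- Lumpability: clamping commutes with both moves of a holding time, since $0$ is fixed and
$\min(\min(i,N)+1,N)=\min(i+1,N)$. The law of the clamped successor thus depends on the clamped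
state only. -/
lemma tsum_ekernel_clamp (hch : ch.Proper) (N : ℕ) (s : ℕ × ℕ) (a : Fin 2) (s' : ℕ × ℕ) :
    ∑' t, ekernel ch (· + 1) s a t * (if s' = clamp N t then 1 else 0)
      = ekernel ch (truncNext N) (clamp N s) a s' := by
  have e1 : clamp N (s.1 + 1, s.2 + 1) = (truncNext N (clamp N s).1, truncNext N (clamp N s).2) := by
    simp only [clamp, truncNext_min]
  have e2 : clamp N (0, s.2 + 1) = (0, truncNext N (clamp N s).2) := by
    simp only [clamp, truncNext_min, Nat.zero_min]
  have e3 : clamp N (s.1 + 1, 0) = (truncNext N (clamp N s).1, 0) := by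
    simp only [clamp, truncNext_min, Nat.zero_min]
  have e4 : clamp N (0, 0) = (0, 0) := by simp only [clamp, Nat.zero_min]
  fin_cases a
  · simp only [Fin.zero_eta]
    rw [tsum_ekernel_zero, ekernel_zero, e1]
  · simp only [Fin.mk_one]
    rw [tsum_ekernel_one hch, ekernel_one hch, e1, e2, e3, e4]
    simp only [mul_ite, mul_one, mul_zero]

lemma EOcc.lump (hch : ch.Proper) (N : ℕ) (hr : EOcc ch (· + 1) r) :
    EOcc ch (truncNext N) (lump N r) := by
  constructor
  · have := tsum_stateMass_lump_mul N r fun _ => 1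
    simp only [mul_one] at this
    exact this.trans hr.total
  · intro s'
    have h1 := tsum_stateMass_lump_mul N r fun s => if s = s' then 1 else 0
    have h2 : ∑' s, stateMass (Eavesdrop.lump N r) s * (if s = s' then 1 else 0)
        = stateMass (Eavesdrop.lump N r) s' := by
      simp only [mul_ite, mul_one, mul_zero]
      exact tsum_ite_eq s' (fun s => stateMass (Eavesdrop.lump N r) s)
    have h3 := hr.tsum_mul fun s => if s' = clamp N s then 1 else 0
    simp only [tsum_ekernel_clamp hch] at h3
    change stateMass (Eavesdrop.lump N r) s' = _
    rw [← h2, h1]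
    simp only [eq_comm (b := s')]
    rw [h3, Summable.tsum_finsetSum fun _ _ => ENNReal.summable,
      Summable.tsum_finsetSum fun _ _ => ENNReal.summable]
    exact Finset.sum_congr rfl fun a _ => (tsum_lump_mul N r a
      fun s => ekernel ch (truncNext N) s a s').symm

lemma tsum_box {f : ℕ × ℕ → ℝ≥0∞} (hf : ∀ s, ¬ (s.1 < N + 1 ∧ s.2 < N + 1) → f s = 0) :
    ∑' s, f s = ∑ x : Fin (N + 1) × Fin (N + 1), f (x.1, x.2) := by
  have hinj : Function.Injective fun x : Fin (N + 1) × Fin (N + 1) => ((x.1 : ℕ), (x.2 : ℕ)) := by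
    intro x y h
    simp only [Prod.mk.injEq] at h
    exact Prod.ext (Fin.ext h.1) (Fin.ext h.2)
  rw [← tsum_fintype (L := SummationFilter.unconditional _) fun x : Fin (N + 1) × Fin (N + 1) => f (x.1, x.2)]
  refine (hinj.tsum_eq (f := f) fun s hs => ?_).symm
  by_contra hc
  refine hs (hf s fun h => hc ⟨(⟨s.1, h.1⟩, ⟨s.2, h.2⟩), rfl⟩)

lemma ekernel_trunc_eq_zero (hch : ch.Proper) {s' : ℕ × ℕ} (h : ¬ (s'.1 < N + 1 ∧ s'.2 < N + 1))
    (s : ℕ × ℕ) (a : Fin 2) : ekernel ch (truncNext N) s a s' = 0 := by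
  have h1 : s' ≠ (truncNext N s.1, truncNext N s.2) := by
    rintro rfl; simp only [truncNext] at h; omega
  have h2 : s' ≠ (0, truncNext N s.2) := by
    rintro rfl; simp only [truncNext] at h; omega
  have h3 : s' ≠ (truncNext N s.1, 0) := by
    rintro rfl; simp only [truncNext] at h; omega
  have h4 : s' ≠ (0, 0) := by
    rintro rfl; simp at h
  fin_cases a
  · simp only [Fin.zero_eta, ekernel_zero, if_neg h1]
  · simp only [Fin.mk_one, ekernel_one hch, if_neg h1, if_neg h2, if_neg h3, if_neg h4, add_zero]

lemma EOcc.eq_zero_of_trunc (hch : ch.Proper) (hr : EOcc ch (truncNext N) r) {s : ℕ × ℕ}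
    (h : ¬ (s.1 < N + 1 ∧ s.2 < N + 1)) (a : Fin 2) : r s a = 0 := by
  have := hr.balance s
  simp only [ekernel_trunc_eq_zero hch h, mul_zero, Finset.sum_const_zero, tsum_zero] at this
  exact (Finset.sum_eq_zero_iff.1 this) a (Finset.mem_univ a)

lemma extend_coe (ρ : Fin (N + 1) × Fin (N + 1) → Fin 2 → ℝ) (x : Fin (N + 1) × Fin (N + 1))
    (a : Fin 2) : extend N ρ (x.1, x.2) a = ENNReal.ofReal (ρ x a) := by
  rw [extend, dif_pos ⟨x.1.2, x.2.2⟩]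

lemma extend_eq_zero (ρ : Fin (N + 1) × Fin (N + 1) → Fin 2 → ℝ) {s : ℕ × ℕ}
    (h : ¬ (s.1 < N + 1 ∧ s.2 < N + 1)) (a : Fin 2) : extend N ρ s a = 0 := by
  rw [extend, dif_neg h]

lemma extend_restrict (hch : ch.Proper) (hr : EOcc ch (truncNext N) r) :
    extend N (restrict N r) = r := by
  funext s a
  by_cases h : s.1 < N + 1 ∧ s.2 < N + 1
  · rw [extend, dif_pos h]
    exact ENNReal.ofReal_toReal (hr.ne_top _ _)
  · rw [extend_eq_zero _ h, hr.eq_zero_of_trunc hch h]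

lemma IsTruncOccupation.eocc (hch : ch.Proper) {ρ : Fin (N + 1) × Fin (N + 1) → Fin 2 → ℝ}
    (h : IsTruncOccupation ch N ρ) : EOcc ch (truncNext N) (extend N ρ) := by
  have h0 : ∀ x a, 0 ≤ ρ x a := fun x a => (h.mem_Icc x a).1
  constructor
  · rw [tsum_box (N := N) fun s hs => by simp [extend_eq_zero ρ hs]]
    simp only [extend_coe]
    simp only [← ENNReal.ofReal_sum_of_nonneg fun a _ => h0 _ a]
    rw [← ENNReal.ofReal_sum_of_nonneg fun x _ => Finset.sum_nonneg fun a _ => h0 x a, h.total,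
      ENNReal.ofReal_one]
  · intro s'
    rw [tsum_box (N := N) fun s hs => by simp [extend_eq_zero ρ hs]]
    simp only [extend_coe]
    by_cases hs' : s'.1 < N + 1 ∧ s'.2 < N + 1
    · obtain ⟨x', rfl⟩ : ∃ x' : Fin (N + 1) × Fin (N + 1), s' = ((x'.1 : ℕ), (x'.2 : ℕ)) :=
        ⟨(⟨s'.1, hs'.1⟩, ⟨s'.2, hs'.2⟩), rfl⟩
      simp only [extend_coe]
      rw [← ENNReal.ofReal_sum_of_nonneg fun a _ => h0 _ a, h.balance]
      have hk : ∀ x a, 0 ≤ ρ x a * truncTrans ch N x a x' := fun x a =>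
        mul_nonneg (h0 x a) (kernel_nonneg hch _ _ _ _)
      rw [ENNReal.ofReal_sum_of_nonneg fun x _ => Finset.sum_nonneg fun a _ => hk x a]
      refine Finset.sum_congr rfl fun x _ => ?_
      rw [ENNReal.ofReal_sum_of_nonneg fun a _ => hk x a]
      exact Finset.sum_congr rfl fun a _ => ENNReal.ofReal_mul (h0 x a)
    · simp [extend_eq_zero ρ hs', ekernel_trunc_eq_zero hch hs']

lemma EOcc.isTruncOccupation (hch : ch.Proper) (hr : EOcc ch (truncNext N) r) :
    IsTruncOccupation ch N (restrict N r) := by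
  have ht := hr.total
  rw [tsum_box (N := N) fun s hs => by simp [hr.eq_zero_of_trunc hch hs]] at ht
  refine ⟨fun x a => ⟨ENNReal.toReal_nonneg, ?_⟩, ?_, fun x' => ?_⟩
  · have h1 : r (x.1, x.2) a ≤ 1 := by
      refine (le_stateMass r _ a).trans ?_
      rw [← hr.total]
      exact ENNReal.le_tsum (f := fun s => ∑ a, r s a) _
    simpa [restrict] using ENNReal.toReal_mono ENNReal.one_ne_top h1
  · have := congrArg ENNReal.toReal ht
    rw [ENNReal.toReal_one, ENNReal.toReal_sum fun x _ => hr.stateMass_ne_top (x.1, x.2)] at this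
    rw [← this]
    refine Finset.sum_congr rfl fun x _ => ?_
    rw [ENNReal.toReal_sum fun a _ => hr.ne_top _ _]
    rfl
  · have hb := hr.balance (x'.1, x'.2)
    rw [tsum_box (N := N) fun s hs => by simp [hr.eq_zero_of_trunc hch hs]] at hb
    have := congrArg ENNReal.toReal hb
    have hm : ∀ s a, r s a * ekernel ch (truncNext N) s a (x'.1, x'.2) ≠ ⊤ := fun s a =>
      ENNReal.mul_ne_top (hr.ne_top _ _) (ekernel_ne_top _ _ _)
    rw [ENNReal.toReal_sum fun a _ => hr.ne_top _ _,
      ENNReal.toReal_sum fun x _ => ENNReal.sum_ne_top.2 fun a _ => hm _ a] at this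
    refine this.trans (Finset.sum_congr rfl fun x _ => ?_)
    rw [ENNReal.toReal_sum fun a _ => hm _ a]
    refine Finset.sum_congr rfl fun a _ => ?_
    rw [ENNReal.toReal_mul, ekernel, ENNReal.toReal_ofReal (kernel_nonneg hch _ _ _ _)]
    rfl

/-- No listening on the boundary of the truncated state space. -/
def BoundaryTransmits (N : ℕ) (r : ℕ × ℕ → Fin 2 → ℝ≥0∞) : Prop :=
  ∀ s : ℕ × ℕ, N ≤ s.1 ∨ N ≤ s.2 → r s 0 = 0

/-- The marginal of the holding time at the adversary. -/
def colMass (r : ℕ × ℕ → Fin 2 → ℝ≥0∞) (j : ℕ) : ℝ≥0∞ := ∑' i, stateMass r (i, j)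

lemma tsum_stateMass_mul_snd (r : ℕ × ℕ → Fin 2 → ℝ≥0∞) (C : ℕ → ℝ≥0∞) :
    ∑' s, stateMass r s * C s.2 = ∑' j, colMass r j * C j := by
  rw [ENNReal.tsum_prod', ENNReal.tsum_comm]
  refine tsum_congr fun j => ?_
  dsimp only
  rw [ENNReal.tsum_mul_right]
  rfl

lemma colMass_eq (r : ℕ × ℕ → Fin 2 → ℝ≥0∞) (j : ℕ) :
    colMass r j = ∑' s, stateMass r s * (if s.2 = j then 1 else 0) := by
  rw [tsum_stateMass_mul_snd r fun j' => if j' = j then 1 else 0]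
  simp only [mul_ite, mul_one, mul_zero]
  exact (tsum_ite_eq j (fun j' => colMass r j')).symm

lemma tsum_colMass_lump_mul (N : ℕ) (r : ℕ × ℕ → Fin 2 → ℝ≥0∞) (C : ℕ → ℝ≥0∞) :
    ∑' j, colMass (lump N r) j * C j = ∑' j, colMass r j * C (min j N) := by
  rw [← tsum_stateMass_mul_snd, ← tsum_stateMass_mul_snd r fun j => C (min j N),
    tsum_stateMass_lump_mul]
  rfl

lemma tsum_nat_split (N : ℕ) (f : ℕ → ℝ≥0∞) :
    ∑' j, f j = ∑ j ∈ Finset.range N, f j + ∑' k, f (N + k) := by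
  rw [← Summable.sum_add_tsum_nat_add' (f := f) (k := N) ENNReal.summable]
  simp only [add_comm N]

lemma colMass_lump_of_lt (r : ℕ × ℕ → Fin 2 → ℝ≥0∞) {j : ℕ} (hj : j < N) :
    colMass (lump N r) j = colMass r j := by
  have h := tsum_colMass_lump_mul N r fun j' => if j' = j then 1 else 0
  have h2 : ∀ j', (min j' N = j) = (j' = j) := by intro j'; apply propext; omega
  simp only [h2, mul_ite, mul_one, mul_zero] at h
  rwa [tsum_ite_eq j (fun j' => colMass (lump N r) j'), tsum_ite_eq j (fun j' => colMass r j')] at h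

lemma colMass_lump_self (r : ℕ × ℕ → Fin 2 → ℝ≥0∞) :
    colMass (lump N r) N = ∑' k, colMass r (N + k) := by
  have h := tsum_colMass_lump_mul N r fun j' => if j' = N then 1 else 0
  simp only [mul_ite, mul_one, mul_zero] at h
  rw [tsum_ite_eq N (fun j' => colMass (lump N r) j'), tsum_nat_split N,
    Finset.sum_eq_zero, zero_add] at h
  · simpa using h
  · intro j hj
    have := Finset.mem_range.1 hj
    rw [if_neg]; omega

/-- Column $j+1$ is entered only from column $j$; where everybody transmits, this requires exactly
that the adversary misses, whether or not the legitimate estimator receives. -/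
lemma colMass_succ (hch : ch.Proper) (hr : EOcc ch (· + 1) r) {j : ℕ}
    (h : ∀ i, r (i, j) 0 = 0) : colMass r (j + 1) = ch.miss * colMass r j := by
  rw [colMass_eq, hr.tsum_mul, colMass_eq, ← ENNReal.tsum_mul_left]
  refine tsum_congr fun s => ?_
  rw [Fin.sum_univ_two, tsum_ekernel_zero, tsum_ekernel_one hch, stateMass, Fin.sum_univ_two]
  by_cases hs : s.2 = j
  · have : r s 0 = 0 := by rw [← h s.1, ← hs]
    simp [hs, this, hch.none_add_onlyLegit, mul_comm]
  · simp [hs]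

lemma colMass_add (hch : ch.Proper) (hr : EOcc ch (· + 1) r) (h : BoundaryTransmits N r) (k : ℕ) :
    colMass r (N + k) = ch.miss ^ k * colMass r N := by
  induction k with
  | zero => simp
  | succ k ih =>
    rw [← add_assoc, colMass_succ hch hr fun i => h (i, N + k) (Or.inr (by simp)), ih, pow_succ]
    ring

lemma adv_mul_tsum_miss (hch : ch.Proper) : ENNReal.ofReal ch.adv * ∑' k, ch.miss ^ k = 1 := by
  have h1 : 1 - ch.miss = ENNReal.ofReal ch.adv := by
    rw [← hch.miss_add_adv]
    exact ENNReal.add_sub_cancel_left ENNReal.ofReal_ne_top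
  rw [ENNReal.tsum_geometric, h1, ENNReal.mul_inv_cancel _ ENNReal.ofReal_ne_top]
  rw [Ne, ENNReal.ofReal_eq_zero, not_le]; exact hch.adv_pos

/-- The columns from $N$ on form a geometric sequence of ratio $1-\lambda_e$, whose sum is the
lumped mass. This explains the factor $\lambda_e$ in the finite objective. -/
lemma adv_mul_colMass_lump (hch : ch.Proper) (hr : EOcc ch (· + 1) r)
    (h : BoundaryTransmits N r) :
    ENNReal.ofReal ch.adv * colMass (lump N r) N = colMass r N := by
  rw [colMass_lump_self]
  simp only [colMass_add hch hr h]
  rw [ENNReal.tsum_mul_right, ← mul_assoc, adv_mul_tsum_miss hch, one_mul]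

variable {n : ℕ}

/-- The trace of the error covariance at holding time `j`. -/
def ecost (A Q P : Matrix (Fin n) (Fin n) ℝ) (j : ℕ) : ℝ≥0∞ :=
  ENNReal.ofReal (errCov A Q P j).trace

lemma colMass_extend (ρ : Fin (N + 1) × Fin (N + 1) → Fin 2 → ℝ) (j : Fin (N + 1)) :
    colMass (extend N ρ) j = ∑ i, ∑ a, ENNReal.ofReal (ρ (i, j) a) := by
  rw [colMass, tsum_eq_sum (s := Finset.range (N + 1)) (fun i hi => ?_), Finset.sum_range]
  · refine Finset.sum_congr rfl fun i _ => Finset.sum_congr rfl fun a _ => ?_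
    exact extend_coe ρ (i, j) a
  · refine Finset.sum_eq_zero fun a _ => extend_eq_zero ρ ?_ a
    rw [Finset.mem_range] at hi
    exact fun h => hi h.1

/-- Since nobody listens in the last column, its transmitting mass is its whole mass, and the
objective depends on the column masses alone. -/
lemma truncCost_eq (hch : ch.Proper) (A Q P : Matrix (Fin n) (Fin n) ℝ)
    {ρ : Fin (N + 1) × Fin (N + 1) → Fin 2 → ℝ} (h0 : ∀ x a, 0 ≤ ρ x a)
    (hb : ∀ i, ρ (i, Fin.last N) 0 = 0) :
    truncCost ch A Q P N ρ = ∑ j ∈ Finset.range N, colMass (extend N ρ) j * ecost A Q P j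
      + colMass (extend N ρ) N *
        ∑' k, ENNReal.ofReal ch.adv * ch.miss ^ k * ecost A Q P (N + k) := by
  obtain ⟨-, -, h3, h4⟩ := hch
  unfold truncCost
  congr 1
  · rw [Finset.sum_comm, Finset.sum_range]
    refine Finset.sum_congr rfl fun j _ => ?_
    have := colMass_extend ρ j.castSucc
    rw [Fin.val_castSucc] at this
    rw [this, Finset.sum_mul]
    refine Finset.sum_congr rfl fun i _ => ?_
    rw [Finset.sum_mul]
    exact Finset.sum_congr rfl fun a _ => ENNReal.ofReal_mul (h0 _ _)
  · rw [← Finset.sum_mul]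
    refine congrArg₂ (· * ·) ?_ ?_
    · have := colMass_extend ρ (Fin.last N)
      rw [Fin.val_last] at this
      rw [this]
      simp [hb]
    · refine tsum_congr fun k => ?_
      rw [ENNReal.ofReal_mul (by have := pow_nonneg (by linarith : 0 ≤ 1 - ch.adv) k; positivity),
        ENNReal.ofReal_mul h3.le, ENNReal.ofReal_pow (by linarith)]
      rfl

/-- The finite program computes the cost of occupation measures which transmit beyond the
horizon. -/
lemma truncCost_eq_of_lump (hch : ch.Proper) (A Q P : Matrix (Fin n) (Fin n) ℝ)
    {ρ : Fin (N + 1) × Fin (N + 1) → Fin 2 → ℝ} (h0 : ∀ x a, 0 ≤ ρ x a)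
    (hb : ∀ i, ρ (i, Fin.last N) 0 = 0) (hr : EOcc ch (· + 1) r) (h : BoundaryTransmits N r)
    (hl : extend N ρ = lump N r) :
    truncCost ch A Q P N ρ = ∑' s, stateMass r s * ecost A Q P s.2 := by
  rw [truncCost_eq hch A Q P h0 hb, hl, tsum_stateMass_mul_snd,
    tsum_nat_split N fun j => colMass r j * ecost A Q P j]
  refine congrArg₂ (fun x y : ℝ≥0∞ => x + y) ?_ ?_
  · refine Finset.sum_congr rfl fun j hj => ?_
    rw [colMass_lump_of_lt r (Finset.mem_range.1 hj)]
  · rw [← ENNReal.tsum_mul_left]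
    refine tsum_congr fun k => ?_
    rw [colMass_add hch hr h, ← adv_mul_colMass_lump hch hr h]
    ring

lemma BoundaryTransmits.lump (h : BoundaryTransmits N r) : BoundaryTransmits N (lump N r) := by
  intro s hs
  rw [Eavesdrop.lump, ENNReal.tsum_eq_zero]
  intro t
  split_ifs with e
  · refine h t ?_
    rw [e] at hs
    simp only [clamp] at hs
    omega
  · rfl

end Lump

/-! ### Excursions from the origin, cut at the exit from a box and completed by transmitting -/

section Excursion

variable (ch : Channels) (τ : ℕ × ℕ → ℝ) (R : ℕ × ℕ → ℝ≥0∞)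

/-- The mass of the part of the excursions from `(0,0)` before a holding time reaches `N`. -/
def exc (N : ℕ) : ℕ × ℕ → ℝ≥0∞ :=
  green (kill (polKernel ch (· + 1) τ) fun s => s ≠ (0, 0) ∧ s.1 < N ∧ s.2 < N)
    (Pi.single (0, 0) (R (0, 0)))

open Classical in
/-- The flow of excursions at the moment when a holding time reaches `N`. -/
def exitFlow (N : ℕ) (s : ℕ × ℕ) : ℝ≥0∞ :=
  if s ≠ (0, 0) ∧ ¬ (s.1 < N ∧ s.2 < N) then push (polKernel ch (· + 1) τ) (exc ch τ R N) s else 0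

/-- The mass of the rest of the excursions, if one always transmits after the exit. -/
def excTail (N : ℕ) : ℕ × ℕ → ℝ≥0∞ :=
  green (kill (polKernel ch (· + 1) fun _ => 1) (· ≠ (0, 0))) (exitFlow ch τ R N)

/-- The state-action mass of the modified excursions. -/
def excMass (N : ℕ) (s : ℕ × ℕ) (a : Fin 2) : ℝ≥0∞ :=
  exc ch τ R N s * ENNReal.ofReal (actProb (τ s) a) + excTail ch τ R N s * (if a = 1 then 1 else 0)

variable {ch τ R}

lemma exc_eq (N : ℕ) (s : ℕ × ℕ) : exc ch τ R N s = (Pi.single (0, 0) (R (0, 0)) : _ → ℝ≥0∞) s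
    + push (kill (polKernel ch (· + 1) τ) fun s => s ≠ (0, 0) ∧ s.1 < N ∧ s.2 < N)
      (exc ch τ R N) s := green_eq _ _ _

lemma exc_origin (N : ℕ) : exc ch τ R N (0, 0) = R (0, 0) := by
  rw [exc_eq, push_kill]; simp

lemma exc_interior {N : ℕ} {s : ℕ × ℕ} (hs : s ≠ (0, 0)) (h : s.1 < N ∧ s.2 < N) :
    push (polKernel ch (· + 1) τ) (exc ch τ R N) s = exc ch τ R N s := by
  conv_rhs => rw [exc_eq, push_kill]
  rw [if_pos ⟨hs, h⟩, Pi.single_eq_of_ne hs, zero_add]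

lemma exc_boundary {N : ℕ} {s : ℕ × ℕ} (hs : s ≠ (0, 0)) (h : ¬ (s.1 < N ∧ s.2 < N)) :
    exc ch τ R N s = 0 := by
  rw [exc_eq, push_kill, if_neg fun h' => h h'.2, Pi.single_eq_of_ne hs, zero_add]

/-- An invariant measure is a supersolution of the killed equation with the same source at the
origin. -/
lemma exc_le (hR : Invariant (polKernel ch (· + 1) τ) R) (N : ℕ) (s : ℕ × ℕ) :
    exc ch τ R N s ≤ R s := by
  refine green_le (fun s => ?_) s
  rw [push_kill]
  by_cases hs : s = (0, 0)
  · subst hs; simp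
  · rw [Pi.single_eq_of_ne hs, zero_add]
    split_ifs
    · exact (hR s).le
    · exact zero_le

/-- A larger box kills less, so its Green measure is a supersolution for the smaller one. -/
lemma exc_mono (s : ℕ × ℕ) : Monotone fun N => exc ch τ R N s := by
  refine monotone_nat_of_le_succ fun N => green_le (fun s => ?_) s
  rw [exc_eq (N + 1), push_kill, push_kill]
  gcongr
  split_ifs with h1 h2 h2
  · exact le_rfl
  · exact absurd ⟨h1.1, by omega, by omega⟩ h2
  · exact zero_le
  · exact le_rfl

/-- The monotone limit lies below `R`, agrees with it at the origin, and solves the equations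
elsewhere, because each state is eventually interior. It is therefore `R` by `eq_of_le_invariant`:
no part of an invariant probability is missed by finite excursions. -/
lemma tendsto_exc (hch : ch.Proper) (hτ : ∀ s, τ s ∈ Set.Icc (0 : ℝ) 1)
    (hR : Invariant (polKernel ch (· + 1) τ) R) (hfin : ∑' s, R s ≠ ⊤) (s : ℕ × ℕ) :
    Tendsto (fun N => exc ch τ R N s) atTop (𝓝 (R s)) := by
  set l : ℕ × ℕ → ℝ≥0∞ := fun s => ⨆ N, exc ch τ R N s with hl
  have hlim : ∀ s, Tendsto (fun N => exc ch τ R N s) atTop (𝓝 (l s)) := fun s =>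
    tendsto_atTop_iSup (exc_mono s)
  have hK := tsum_polKernel hch (· + 1) hτ
  have : l s = R s := by
    refine eq_of_le_invariant hK (o := (0, 0)) (invariant_charges_origin hch fun s => Or.inr
      fun t h => h) hfin hR (fun s => iSup_le fun N => exc_le hR N s) ?_ (fun s hs => ?_) s
    · simp [exc_origin]
    · refine tendsto_nhds_unique ?_ (hlim s)
      have h1 : Tendsto (fun N => push (polKernel ch (· + 1) τ) (exc ch τ R N) s) atTop
          (𝓝 (push (polKernel ch (· + 1) τ) l s)) := by
        refine tendsto_tsum_of_dominated (f := fun t => R t * polKernel ch (· + 1) τ t s) ?_ ?_ ?_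
        · have := hR s
          rw [push] at this
          rw [this]
          exact ENNReal.ne_top_of_tsum_ne_top hfin s
        · intro N t
          gcongr
          exact exc_le hR N t
        · intro t
          refine ENNReal.Tendsto.mul_const (hlim t) (Or.inr ?_)
          refine ne_top_of_le_ne_top ENNReal.one_ne_top ?_
          rw [← hK t]
          exact ENNReal.le_tsum s
      refine h1.congr' ?_
      filter_upwards [eventually_gt_atTop (max s.1 s.2)] with N hN
      exact exc_interior hs ⟨by omega, by omega⟩
  rw [← this]
  exact hlim s

lemma exitFlow_le (hR : Invariant (polKernel ch (· + 1) τ) R) (N : ℕ) (s : ℕ × ℕ) :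
    exitFlow ch τ R N s ≤ if s.1 < N ∧ s.2 < N then 0 else R s := by
  unfold exitFlow
  split_ifs with h1 h2 h2
  · exact absurd h2 h1.2
  · rw [← hR s]
    exact push_mono (exc_le hR N) s
  · exact le_rfl
  · exact zero_le

lemma excTail_eq (N : ℕ) (s : ℕ × ℕ) : excTail ch τ R N s = exitFlow ch τ R N s
    + push (kill (polKernel ch (· + 1) fun _ => 1) (· ≠ (0, 0))) (excTail ch τ R N) s :=
  green_eq _ _ _

/-- The discounted sum `∑ₖ (1 - λ_e)ᵏ C_{j+k}`. -/
def discounted (ch : Channels) (C : ℕ → ℝ≥0∞) (j : ℕ) : ℝ≥0∞ := ∑' k, ch.miss ^ k * C (j + k)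

lemma discounted_eq (C : ℕ → ℝ≥0∞) (j : ℕ) :
    discounted ch C j = C j + ch.miss * discounted ch C (j + 1) := by
  unfold discounted
  rw [tsum_eq_zero_add' ENNReal.summable, ← ENNReal.tsum_mul_left]
  simp only [pow_zero, one_mul, add_zero, pow_succ]
  congr 1
  refine tsum_congr fun k => ?_
  rw [show j + (k + 1) = j + 1 + k by ring]
  ring

/-- The cost of always transmitting until `(0,0)` is reached. -/
lemma tsum_excTail_mul_le (hch : ch.Proper) (C : ℕ → ℝ≥0∞) (N : ℕ) :
    ∑' s, excTail ch τ R N s * C s.2 ≤ ∑' s, exitFlow ch τ R N s *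
      (discounted ch C s.2 + ch.onlyAdv * discounted ch C 0 / ch.both) := by
  -- The potential is the discounted cost of the present run of column indices plus a constant `D`
  -- for later runs. The choice of `D` balances the chance of ending the excursion against that of
  -- restarting from column $0$ without ending it: $\lambda\lambda_a\lambda_e
  -- D=(1-\lambda\lambda_a)\lambda_e\sum_k(1-\lambda_e)^kC_k$.
  set D := ch.onlyAdv * discounted ch C 0 / ch.both with hD
  have hbD : ch.both * D = ch.onlyAdv * discounted ch C 0 :=
    ENNReal.mul_div_cancel hch.both_ne_zero ENNReal.ofReal_ne_top
  refine tsum_green_mul_le (V := fun s : ℕ × ℕ => discounted ch C s.2 + D) (fun s => ?_) _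
  have h1 : ∀ s', kill (polKernel ch (· + 1) fun _ => 1) (· ≠ (0, 0)) s s' *
      (discounted ch C s'.2 + D) = ekernel ch (· + 1) s 1 s' *
        (if s' = (0, 0) then 0 else discounted ch C s'.2 + D) := by
    intro s'
    rw [kill, polKernel_of_eq_one rfl]
    by_cases h : s' = (0, 0) <;> simp [h]
  simp only [h1]
  rw [tsum_ekernel_one hch]
  simp only [Prod.mk.injEq, Nat.add_eq_zero_iff, one_ne_zero, and_false, and_true, if_false,
    if_true, mul_zero, add_zero]
  calc C s.2 + (ch.none * (discounted ch C (s.2 + 1) + D)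
        + ch.onlyLegit * (discounted ch C (s.2 + 1) + D) + ch.onlyAdv * (discounted ch C 0 + D))
      = (C s.2 + (ch.none + ch.onlyLegit) * discounted ch C (s.2 + 1))
        + (ch.none + ch.onlyLegit + ch.onlyAdv) * D + ch.onlyAdv * discounted ch C 0 := by ring
    _ = discounted ch C s.2 + (ch.none + ch.onlyLegit + ch.onlyAdv + ch.both) * D := by
        rw [← hbD, hch.none_add_onlyLegit, ← discounted_eq]; ring
    _ ≤ discounted ch C s.2 + D := by rw [hch.sum_eq_one, one_mul]

lemma excMass_stateMass (hτ : ∀ s, τ s ∈ Set.Icc (0 : ℝ) 1) (N : ℕ) (s : ℕ × ℕ) :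
    stateMass (excMass ch τ R N) s = exc ch τ R N s + excTail ch τ R N s := by
  simp only [stateMass, excMass, Finset.sum_add_distrib, ← Finset.mul_sum,
    sum_ofReal_actProb (hτ s)]
  simp

lemma tsum_excMass_ekernel (N : ℕ) (s' : ℕ × ℕ) :
    ∑' s, ∑ a, excMass ch τ R N s a * ekernel ch (· + 1) s a s'
      = push (polKernel ch (· + 1) τ) (exc ch τ R N) s'
        + push (polKernel ch (· + 1) fun _ => 1) (excTail ch τ R N) s' := by
  rw [push, push, ← ENNReal.tsum_add]
  refine tsum_congr fun s => ?_
  simp only [polKernel, excMass, Fin.sum_univ_two, actProb]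
  simp
  ring

/-- Away from the origin, interior states are balanced by the cut excursions and boundary states by
the exit flow. At the origin balance follows from conservation of the total mass, which is why
finiteness is required. -/
lemma excMass_balance (hch : ch.Proper) (hτ : ∀ s, τ s ∈ Set.Icc (0 : ℝ) 1) (N : ℕ)
    (hfin : ∑' s, stateMass (excMass ch τ R N) s ≠ ⊤) (s' : ℕ × ℕ) :
    stateMass (excMass ch τ R N) s' = ∑' s, ∑ a, excMass ch τ R N s a * ekernel ch (· + 1) s a s' := by
  rw [tsum_excMass_ekernel]
  have hne : ∀ s, s ≠ (0, 0) → stateMass (excMass ch τ R N) s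
      = push (polKernel ch (· + 1) τ) (exc ch τ R N) s
        + push (polKernel ch (· + 1) fun _ => 1) (excTail ch τ R N) s := by
    intro s hs
    rw [excMass_stateMass hτ, excTail_eq N s, push_kill, if_pos hs]
    by_cases h : s.1 < N ∧ s.2 < N
    · rw [exc_interior hs h, exitFlow, if_neg fun h' => h'.2 h, zero_add]
    · rw [exc_boundary hs h, exitFlow, if_pos ⟨hs, h⟩, zero_add]
  by_cases hs : s' = (0, 0)
  · subst hs
    have h1 : ∑' s, stateMass (excMass ch τ R N) s
        = ∑' s, (push (polKernel ch (· + 1) τ) (exc ch τ R N) s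
          + push (polKernel ch (· + 1) fun _ => 1) (excTail ch τ R N) s) := by
      rw [ENNReal.tsum_add, tsum_push (tsum_polKernel hch _ hτ),
        tsum_push (tsum_polKernel hch _ fun _ => ⟨zero_le_one, le_rfl⟩), ← ENNReal.tsum_add]
      exact tsum_congr fun s => excMass_stateMass hτ N s
    have h2 : ∀ f : ℕ × ℕ → ℝ≥0∞, ∑' s, f s = f (0, 0) + ∑' s, (if s = (0, 0) then 0 else f s) :=
      fun f => by convert ENNReal.tsum_eq_add_tsum_ite (0, 0)
    have h3 : ∀ s, (if s = (0, 0) then 0 else push (polKernel ch (· + 1) τ) (exc ch τ R N) s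
          + push (polKernel ch (· + 1) fun _ => 1) (excTail ch τ R N) s)
        = if s = (0, 0) then 0 else stateMass (excMass ch τ R N) s := by
      intro s; split_ifs with h
      · rfl
      · exact (hne s h).symm
    rw [h2 (stateMass (excMass ch τ R N))] at h1 hfin
    rw [h2 fun s => push (polKernel ch (· + 1) τ) (exc ch τ R N) s
      + push (polKernel ch (· + 1) fun _ => 1) (excTail ch τ R N) s] at h1
    simp only [h3] at h1
    exact (ENNReal.add_left_inj (ENNReal.add_ne_top.1 hfin).2).1 h1
  · exact hne s' hs

/-- The costs are controlled by the discounted sum. -/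
structure CostBound (ch : Channels) (C : ℕ → ℝ≥0∞) (B : ℝ≥0∞) : Prop where
  ne_top : ∀ j, C j ≠ ⊤
  bound_ne_top : B ≠ ⊤
  le : ∀ j, discounted ch C j ≤ B * (1 + C j)

/-- The constant cost turns every statement on costs into one on masses. -/
lemma CostBound.one (hch : ch.Proper) :
    CostBound ch (fun _ => 1) (ENNReal.ofReal ch.adv)⁻¹ := by
  have h0 : ENNReal.ofReal ch.adv ≠ 0 := by
    rw [Ne, ENNReal.ofReal_eq_zero, not_le]; exact hch.adv_pos
  refine ⟨fun _ => ENNReal.one_ne_top, ENNReal.inv_ne_top.2 h0, fun j => ?_⟩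
  have : discounted ch (fun _ => 1) j = (ENNReal.ofReal ch.adv)⁻¹ := by
    rw [discounted]
    simp only [mul_one]
    exact (ENNReal.eq_inv_of_mul_eq_one_left ((mul_comm _ _).trans (adv_mul_tsum_miss hch)))
  rw [this, mul_add, mul_one]
  exact le_self_add

lemma tendsto_tsum_boundary {f : ℕ × ℕ → ℝ≥0∞} (hf : ∑' s, f s ≠ ⊤) :
    Tendsto (fun N => ∑' s : ℕ × ℕ, if s.1 < N ∧ s.2 < N then 0 else f s) atTop (𝓝 0) := by
  have := tendsto_tsum_of_dominated (g := fun N (s : ℕ × ℕ) => if s.1 < N ∧ s.2 < N then 0 else f s)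
    (g' := fun _ => 0) hf (fun N s => by split_ifs <;> simp) (fun s => ?_)
  · simpa using this
  · refine tendsto_const_nhds.congr' ?_
    filter_upwards [eventually_gt_atTop (max s.1 s.2)] with N hN
    rw [if_pos ⟨by omega, by omega⟩]

/-- The exit flow is at most `R` outside the box, and the potential of a completion at most
$B(1+C)+D$. The product with `R` is summable, so its sum outside the growing box vanishes. -/
lemma tendsto_excTail_cost (hch : ch.Proper) (hR : Invariant (polKernel ch (· + 1) τ) R)
    (hfin : ∑' s, R s ≠ ⊤) {C : ℕ → ℝ≥0∞} {B : ℝ≥0∞} (hC : CostBound ch C B)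
    (hcost : ∑' s, R s * C s.2 ≠ ⊤) :
    Tendsto (fun N => ∑' s, excTail ch τ R N s * C s.2) atTop (𝓝 0) := by
  set D := ch.onlyAdv * discounted ch C 0 / ch.both with hD
  have hDt : D ≠ ⊤ := by
    refine ENNReal.div_ne_top (ENNReal.mul_ne_top ENNReal.ofReal_ne_top ?_) hch.both_ne_zero
    refine ne_top_of_le_ne_top ?_ (hC.le 0)
    exact ENNReal.mul_ne_top hC.bound_ne_top
      (ENNReal.add_ne_top.2 ⟨ENNReal.one_ne_top, hC.ne_top 0⟩)
  have hsum : ∑' s, R s * (B * (1 + C s.2) + D) ≠ ⊤ := by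
    have : ∀ s : ℕ × ℕ, R s * (B * (1 + C s.2) + D) = (B + D) * R s + B * (R s * C s.2) := by
      intro s; ring
    simp only [this]
    rw [ENNReal.tsum_add, ENNReal.tsum_mul_left, ENNReal.tsum_mul_left]
    exact ENNReal.add_ne_top.2 ⟨ENNReal.mul_ne_top (ENNReal.add_ne_top.2 ⟨hC.bound_ne_top, hDt⟩) hfin,
      ENNReal.mul_ne_top hC.bound_ne_top hcost⟩
  refine tendsto_of_tendsto_of_tendsto_of_le_of_le tendsto_const_nhds
    (tendsto_tsum_boundary hsum) (fun _ => zero_le) fun N => ?_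
  refine (tsum_excTail_mul_le hch C N).trans (ENNReal.tsum_le_tsum fun s => ?_)
  refine (mul_le_mul' (exitFlow_le hR N s) (add_le_add_left (hC.le s.2) D)).trans ?_
  split_ifs <;> simp

end Excursion

/-! ### Approximation by policies that transmit beyond the horizon -/

section Approximation

variable {ch : Channels} {r : ℕ × ℕ → Fin 2 → ℝ≥0∞}

lemma EOcc.stateMass_origin_ne_zero (hch : ch.Proper) (hr : EOcc ch (· + 1) r) :
    stateMass r (0, 0) ≠ 0 := by
  obtain ⟨τ, -, hτ⟩ := exists_disintegrates hr.ne_top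
  intro h0
  have h1 := invariant_charges_origin hch (fun s => Or.inr fun t h => h) _ (hτ.invariant hr) h0
  have h2 : ∑' s, stateMass r s = 1 := hr.total
  simp [h1] at h2

/-- Every occupation measure is a limit of occupation measures of policies which transmit
whenever a holding time exceeds `N`, with convergence of the cost. -/
lemma exists_transmitting_approx (hch : ch.Proper) (hr : EOcc ch (· + 1) r) :
    ∃ r' : ℕ → ℕ × ℕ → Fin 2 → ℝ≥0∞,
      (∀ N, 1 ≤ N → EOcc ch (· + 1) (r' N) ∧ BoundaryTransmits N (r' N)) ∧
      Tendsto (fun N => ∑' s, ∑ a, (r s a - r' N s a)) atTop (𝓝 0) ∧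
      ∀ C B, CostBound ch C B → ∑' s, stateMass r s * C s.2 ≠ ⊤ →
        ∃ u : ℕ → ℝ≥0∞, Tendsto u atTop (𝓝 (∑' s, stateMass r s * C s.2)) ∧
          ∀ N, ∑' s, stateMass (r' N) s * C s.2 ≤ u N := by
  obtain ⟨τ, hτ, hτr⟩ := exists_disintegrates hr.ne_top
  set R := stateMass r with hRdef
  have hR : Invariant (polKernel ch (· + 1) τ) R := hτr.invariant hr
  have hR1 : ∑' s, R s = 1 := hr.total
  have hRfin : ∑' s, R s ≠ ⊤ := by simp [hR1]
  -- The modified excursions balance but do not have total mass $1$; `Z N` is the normalisation and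
  -- tends to $1$.
  set Z : ℕ → ℝ≥0∞ := fun N => ∑' s, stateMass (excMass ch τ R N) s with hZ
  have hZeq : ∀ N, Z N = ∑' s, exc ch τ R N s + ∑' s, excTail ch τ R N s := by
    intro N
    rw [← ENNReal.tsum_add]
    exact tsum_congr fun s => excMass_stateMass hτ N s
  have htail : Tendsto (fun N => ∑' s, excTail ch τ R N s) atTop (𝓝 0) := by
    have := tendsto_excTail_cost hch hR hRfin (CostBound.one hch) (by simpa using hRfin)
    simpa using this
  have hZlim : Tendsto Z atTop (𝓝 1) := by
    have h1 : Tendsto (fun N => ∑' s, exc ch τ R N s) atTop (𝓝 (∑' s, R s)) :=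
      tendsto_tsum_of_dominated hRfin (exc_le hR) (tendsto_exc hch hτ hR hRfin)
    have := h1.add htail
    rw [hR1, add_zero] at this
    exact this.congr fun N => (hZeq N).symm
  have hZ0 : ∀ N, Z N ≠ 0 := by
    intro N h
    have h1 := (ENNReal.tsum_eq_zero.1 h) (0, 0)
    rw [excMass_stateMass hτ, exc_origin, add_eq_zero] at h1
    exact hr.stateMass_origin_ne_zero hch h1.1
  have hZt : ∀ N, Z N ≠ ⊤ := by
    intro N
    rw [hZeq]
    refine ENNReal.add_ne_top.2 ⟨ne_top_of_le_ne_top hRfin (ENNReal.tsum_le_tsum (exc_le hR N)), ?_⟩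
    have h1 := tsum_excTail_mul_le (τ := τ) (R := R) hch (fun _ => 1) N
    have hb := CostBound.one hch
    simp only [mul_one] at h1
    have hd : ∀ j, discounted ch (fun _ => 1) j ≤ (ENNReal.ofReal ch.adv)⁻¹ * (1 + 1) := hb.le
    have hdt : (ENNReal.ofReal ch.adv)⁻¹ * (1 + 1) ≠ ⊤ :=
      ENNReal.mul_ne_top hb.bound_ne_top (by simp)
    refine ne_top_of_le_ne_top ?_ (h1.trans (ENNReal.tsum_le_tsum fun s =>
      mul_le_mul' (show exitFlow ch τ R N s ≤ R s from (exitFlow_le hR N s).trans ?_) (add_le_add_left (hd s.2) _)))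
    · rw [ENNReal.tsum_mul_right, hR1, one_mul]
      exact ENNReal.add_ne_top.2 ⟨hdt, ENNReal.div_ne_top (ENNReal.mul_ne_top ENNReal.ofReal_ne_top
        (ne_top_of_le_ne_top hdt (hd 0))) hch.both_ne_zero⟩
    · split_ifs
      · exact zero_le
      · exact le_rfl
  have hZinv : Tendsto (fun N => (Z N)⁻¹) atTop (𝓝 1) := by
    have := tendsto_inv_iff.2 hZlim
    simpa using this
  have hsm : ∀ N s, stateMass (fun s a => (Z N)⁻¹ * excMass ch τ R N s a) s
      = (Z N)⁻¹ * stateMass (excMass ch τ R N) s := by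
    intro N s
    rw [stateMass, stateMass, Finset.mul_sum]
  refine ⟨fun N s a => (Z N)⁻¹ * excMass ch τ R N s a, fun N hN => ⟨⟨?_, fun s' => ?_⟩, ?_⟩, ?_, ?_⟩
  · change ∑' s, stateMass (fun s a => (Z N)⁻¹ * excMass ch τ R N s a) s = 1
    simp only [hsm]
    rw [ENNReal.tsum_mul_left]
    exact ENNReal.inv_mul_cancel (hZ0 N) (hZt N)
  · change stateMass (fun s a => (Z N)⁻¹ * excMass ch τ R N s a) s' = _
    rw [hsm, excMass_balance hch hτ N (hZt N), ← ENNReal.tsum_mul_left]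
    refine tsum_congr fun s => ?_
    rw [Finset.mul_sum]
    exact Finset.sum_congr rfl fun a _ => (mul_assoc _ _ _).symm
  · intro s hs
    have h1 : s ≠ (0, 0) := by rintro rfl; simp only [or_self] at hs; omega
    simp [excMass, exc_boundary h1 (N := N) (by omega)]
  · have h1 := tendsto_tsum_of_dominated (g := fun N s => ∑ a, (r s a -
      (Z N)⁻¹ * excMass ch τ R N s a)) (g' := fun _ => 0) (f := R) hRfin
      (fun N s => Finset.sum_le_sum fun a _ => tsub_le_self) (fun s => ?_)
    · simpa using h1
    · have h2 : ∀ a, Tendsto (fun N => r s a - (Z N)⁻¹ * excMass ch τ R N s a) atTop (𝓝 0) := by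
        intro a
        -- Only the deficit of the approximant counts, so the tail of the excursions may be
        -- discarded; what remains converges to $r(s,a)$ through the policy `τ`.
        have h3 : Tendsto (fun N => r s a
            - (Z N)⁻¹ * (exc ch τ R N s * ENNReal.ofReal (actProb (τ s) a))) atTop (𝓝 0) := by
          have h4 : Tendsto (fun N => (Z N)⁻¹ * (exc ch τ R N s * ENNReal.ofReal (actProb (τ s) a)))
              atTop (𝓝 (1 * (R s * ENNReal.ofReal (actProb (τ s) a)))) :=
            ENNReal.Tendsto.mul hZinv (Or.inl one_ne_zero)
              (ENNReal.Tendsto.mul_const (tendsto_exc hch hτ hR hRfin s)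
                (Or.inr ENNReal.ofReal_ne_top)) (Or.inr ENNReal.one_ne_top)
          rw [one_mul, mul_comm, ← hτr s a] at h4
          have h5 := ENNReal.Tendsto.sub (tendsto_const_nhds (x := r s a)) h4
            (Or.inl (hr.ne_top s a))
          rwa [tsub_self] at h5
        refine tendsto_of_tendsto_of_tendsto_of_le_of_le tendsto_const_nhds h3 (fun _ => zero_le)
          fun N => ?_
        dsimp only
        gcongr
        exact le_self_add
      have := tendsto_finsetSum (Finset.univ : Finset (Fin 2)) fun a _ => h2 a
      simpa using this
  · intro C B hC hcost
    -- The cut part costs no more than `R` itself, and the completion has vanishing cost.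
    refine ⟨fun N => (Z N)⁻¹ * (∑' s, R s * C s.2 + ∑' s, excTail ch τ R N s * C s.2), ?_,
      fun N => ?_⟩
    · have h1 := (tendsto_const_nhds (x := ∑' s, R s * C s.2)).add
        (tendsto_excTail_cost hch hR hRfin hC hcost)
      rw [add_zero] at h1
      have h2 := ENNReal.Tendsto.mul hZinv (Or.inl one_ne_zero) h1 (Or.inr ENNReal.one_ne_top)
      rwa [one_mul] at h2
    · simp only [hsm, mul_assoc]
      rw [ENNReal.tsum_mul_left]
      gcongr
      rw [← ENNReal.tsum_add]
      refine ENNReal.tsum_le_tsum fun s => ?_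
      rw [excMass_stateMass hτ, add_mul]
      gcongr
      exact exc_le hR N s

end Approximation

/-! ### Positivity and growth of the error covariances -/

section CovarianceBounds

open Matrix

variable {n m : ℕ}

/-- The squared Frobenius norm. -/
def frobSq {α β : Type*} [Fintype α] [Fintype β] (M : Matrix α β ℝ) : ℝ := ∑ i, ∑ j, M i j ^ 2

lemma frobSq_nonneg {α β : Type*} [Fintype α] [Fintype β] (M : Matrix α β ℝ) : 0 ≤ frobSq M :=
  Finset.sum_nonneg fun _ _ => Finset.sum_nonneg fun _ _ => sq_nonneg _

lemma frobSq_mul_le {α β γ : Type*} [Fintype α] [Fintype β] [Fintype γ] (M : Matrix α β ℝ)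
    (N : Matrix β γ ℝ) : frobSq (M * N) ≤ frobSq M * frobSq N := by
  calc frobSq (M * N) ≤ ∑ i, ∑ j, (∑ k, M i k ^ 2) * ∑ k, N k j ^ 2 := by
        refine Finset.sum_le_sum fun i _ => Finset.sum_le_sum fun j _ => ?_
        rw [Matrix.mul_apply]
        exact Finset.sum_mul_sq_le_sq_mul_sq _ _ _
    _ = frobSq M * frobSq N := by
        rw [frobSq, frobSq, Finset.sum_mul, Finset.sum_comm (f := fun k j => N k j ^ 2)]
        exact Finset.sum_congr rfl fun i _ => (Finset.mul_sum _ _ _).symm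

lemma trace_mul_transpose_self {α β : Type*} [Fintype α] [Fintype β] (M : Matrix α β ℝ) :
    (M * Mᵀ).trace = frobSq M := by
  simp only [Matrix.trace, Matrix.diag, Matrix.mul_apply, Matrix.transpose_apply, frobSq, sq]

lemma exists_mul_transpose {X : Matrix (Fin n) (Fin n) ℝ} (hX : X.PosSemidef) :
    ∃ (k : ℕ) (Y : Matrix (Fin n) (Fin k) ℝ), X = Y * Yᵀ := by
  obtain ⟨k, v, hv⟩ := Matrix.posSemidef_iff_eq_sum_vecMulVec.1 hX
  refine ⟨k, Matrix.of fun a i => v i a, ?_⟩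
  rw [hv]
  ext a b
  simp [Matrix.sum_apply, Matrix.vecMulVec_apply, Matrix.mul_apply]

lemma trace_conj_le {X : Matrix (Fin n) (Fin n) ℝ} (hX : X.PosSemidef)
    (B : Matrix (Fin n) (Fin n) ℝ) : (B * X * Bᵀ).trace ≤ frobSq B * X.trace := by
  obtain ⟨k, Y, rfl⟩ := exists_mul_transpose hX
  rw [trace_mul_transpose_self, ← Matrix.mul_assoc, Matrix.mul_assoc (B * Y),
    ← Matrix.transpose_mul, trace_mul_transpose_self]
  exact frobSq_mul_le B Y

lemma abs_apply_le_trace {X : Matrix (Fin n) (Fin n) ℝ} (hX : X.PosSemidef) (a b : Fin n) :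
    |X a b| ≤ X.trace := by
  obtain ⟨k, Y, rfl⟩ := exists_mul_transpose hX
  have hrow : ∀ c, ∑ i, Y c i ^ 2 ≤ frobSq Y := fun c =>
    Finset.single_le_sum (f := fun c => ∑ i, Y c i ^ 2)
      (fun _ _ => Finset.sum_nonneg fun _ _ => sq_nonneg _) (Finset.mem_univ c)
  rw [trace_mul_transpose_self, Matrix.mul_apply]
  refine (Finset.abs_sum_le_sum_abs _ _).trans ?_
  have : ∑ i, |Y a i * Yᵀ i b| ≤ ∑ i, (Y a i ^ 2 + Y b i ^ 2) / 2 := by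
    refine Finset.sum_le_sum fun i _ => ?_
    rw [Matrix.transpose_apply, abs_mul]
    nlinarith [sq_nonneg (|Y a i| - |Y b i|), sq_abs (Y a i), sq_abs (Y b i)]
  refine this.trans ?_
  rw [← Finset.sum_div, Finset.sum_add_distrib]
  linarith [hrow a, hrow b]

lemma posSemidef_conj {X : Matrix (Fin n) (Fin n) ℝ} (hX : X.PosSemidef)
    (B : Matrix (Fin m) (Fin n) ℝ) : (B * X * Bᵀ).PosSemidef := by
  have := hX.mul_mul_conjTranspose_same B
  rwa [Matrix.conjTranspose_eq_transpose_of_trivial] at this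

lemma posSemidef_predict {A Q X : Matrix (Fin n) (Fin n) ℝ} (hQ : Q.PosSemidef)
    (hX : X.PosSemidef) : (predict A Q X).PosSemidef := (posSemidef_conj hX A).add hQ

lemma posSemidef_errCov {A Q X : Matrix (Fin n) (Fin n) ℝ} (hQ : Q.PosSemidef)
    (hX : X.PosSemidef) (j : ℕ) : (errCov A Q X j).PosSemidef := by
  induction j with
  | zero => exact hX
  | succ j ih =>
    rw [errCov, Function.iterate_succ_apply']
    exact posSemidef_predict hQ ih

/-- The update is the Schur complement of $CXC^\top+R$ in the block matrix
$\begin{pmatrix}1\\C\end{pmatrix}X\begin{pmatrix}1\\C\end{pmatrix}^\top+\operatorname{diag}(0,R)$,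
which is visibly positive semidefinite. -/
lemma posSemidef_measUpdate (C : Matrix (Fin m) (Fin n) ℝ) {R : Matrix (Fin m) (Fin m) ℝ}
    (hR : R.PosDef) {X : Matrix (Fin n) (Fin n) ℝ} (hX : X.PosSemidef) :
    (measUpdate C R X).PosSemidef := by
  have hXt : Xᵀ = X := by
    rw [← Matrix.conjTranspose_eq_transpose_of_trivial]; exact hX.1
  set D := C * X * Cᵀ + R with hD
  have hDpos : D.PosDef := Matrix.PosDef.posSemidef_add (posSemidef_conj hX C) hR
  have : Invertible D := hDpos.isUnit.invertible
  have h := (Matrix.PosDef.fromBlocks₂₂ X (X * Cᵀ) hDpos).1 ?_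
  · convert! h using 1
    rw [measUpdate, Matrix.conjTranspose_eq_transpose_of_trivial, Matrix.transpose_mul,
      Matrix.transpose_transpose, hXt, ← Matrix.mul_assoc]
  · set B : Matrix (Fin n ⊕ Fin m) (Fin n) ℝ := Matrix.fromRows 1 C with hB
    have h1 : (B * X * Bᴴ).PosSemidef := hX.mul_mul_conjTranspose_same B
    have h2 : (Matrix.fromBlocks 0 0 0 R : Matrix (Fin n ⊕ Fin m) (Fin n ⊕ Fin m) ℝ).PosSemidef := by
      have h3 := hR.posSemidef.mul_mul_conjTranspose_same
        (Matrix.fromRows 0 1 : Matrix (Fin n ⊕ Fin m) (Fin m) ℝ)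
      convert! h3 using 1
      rw [Matrix.conjTranspose_eq_transpose_of_trivial, Matrix.transpose_fromRows,
        Matrix.fromRows_mul, Matrix.fromRows_mul_fromCols]
      simp
    convert! h1.add h2 using 1
    rw [hB, Matrix.conjTranspose_eq_transpose_of_trivial, Matrix.conjTranspose_eq_transpose_of_trivial, Matrix.transpose_fromRows,
      Matrix.fromRows_mul, Matrix.fromRows_mul_fromCols, Matrix.fromBlocks_add]
    simp [hXt, hD]

lemma posSemidef_of_tendsto {X : ℕ → Matrix (Fin n) (Fin n) ℝ} {Y : Matrix (Fin n) (Fin n) ℝ}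
    (hX : ∀ k, (X k).PosSemidef) (h : Tendsto X atTop (𝓝 Y)) : Y.PosSemidef := by
  rw [Matrix.posSemidef_iff_dotProduct_mulVec]
  have hc : Continuous fun M : Matrix (Fin n) (Fin n) ℝ => Mᴴ := continuous_id.matrix_conjTranspose
  constructor
  · refine tendsto_nhds_unique ((hc.tendsto Y).comp h) ?_
    exact h.congr fun k => (hX k).1.symm
  · intro x
    have hc2 : Continuous fun M : Matrix (Fin n) (Fin n) ℝ => star x ⬝ᵥ (M *ᵥ x) := by fun_prop
    exact ge_of_tendsto' ((hc2.tendsto Y).comp h) fun k =>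
      (Matrix.posSemidef_iff_dotProduct_mulVec.1 (hX k)).2 x

lemma posSemidef_steadyState {A Q P0 P : Matrix (Fin n) (Fin n) ℝ} {C : Matrix (Fin m) (Fin n) ℝ}
    {R : Matrix (Fin m) (Fin m) ℝ} (hQ : Q.PosSemidef) (hR : R.PosDef) (hP0 : P0.PosSemidef)
    (hP : IsSteadyState A Q C R P0 P) : P.PosSemidef := by
  refine posSemidef_of_tendsto (fun k => ?_) hP
  induction k with
  | zero => exact posSemidef_measUpdate C hR hP0
  | succ k ih => exact posSemidef_measUpdate C hR (posSemidef_predict hQ ih)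

lemma errCov_eq (A Q X : Matrix (Fin n) (Fin n) ℝ) (k : ℕ) :
    errCov A Q X k = A ^ k * X * (A ^ k)ᵀ + ∑ l ∈ Finset.range k, A ^ l * Q * (A ^ l)ᵀ := by
  induction k with
  | zero => simp [errCov]
  | succ k ih =>
    rw [errCov, Function.iterate_succ_apply', ← errCov, ih, predict, Finset.sum_range_succ']
    simp only [mul_add, add_mul, Finset.mul_sum, Finset.sum_mul, pow_succ', Matrix.transpose_mul,
      Matrix.mul_assoc, pow_zero, Matrix.transpose_one, Matrix.mul_one, Matrix.one_mul, add_assoc]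

section Gelfand

attribute [local instance] Matrix.frobeniusNormedRing Matrix.frobeniusNormedAlgebra

lemma norm_map_sq (M : Matrix (Fin n) (Fin n) ℝ) :
    ‖M.map (algebraMap ℝ ℂ)‖ ^ 2 = frobSq M := by
  rw [Matrix.frobenius_norm_def, ← Real.sqrt_eq_rpow, Real.sq_sqrt]
  · simp [frobSq]
  · positivity

/-- Powers of `A` grow at most at the rate of the spectral radius. -/
lemma exists_frobSq_pow_le (A : Matrix (Fin n) (Fin n) ℝ) {t : ℝ} (ht : maxEig A ^ 2 < t) :
    ∃ K, 0 ≤ K ∧ ∀ k, frobSq (A ^ k) ≤ K * t ^ k := by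
  have ht0 : 0 < t := lt_of_le_of_lt (sq_nonneg _) ht
  set M := A.map (algebraMap ℝ ℂ) with hM
  have hpow : ∀ k, (A ^ k).map (algebraMap ℝ ℂ) = M ^ k := fun k => by
    rw [hM]; exact Matrix.map_pow A (algebraMap ℝ ℂ) k
  have hlim := spectrum.pow_norm_pow_one_div_tendsto_nhds_spectralRadius M
  have hfin : spectralRadius ℂ M ≠ ⊤ := by
    refine ne_top_of_le_ne_top ?_ (spectrum.spectralRadius_le_pow_nnnorm_pow_one_div ℂ M 0)
    exact ENNReal.mul_ne_top (ENNReal.rpow_ne_top_of_nonneg (by norm_num) ENNReal.coe_ne_top)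
      (ENNReal.rpow_ne_top_of_nonneg (by norm_num) ENNReal.coe_ne_top)
  have hlt : spectralRadius ℂ M < ENNReal.ofReal (Real.sqrt t) := by
    rw [← ENNReal.ofReal_toReal hfin]
    refine (ENNReal.ofReal_lt_ofReal_iff (Real.sqrt_pos.2 ht0)).2 ?_
    exact Real.lt_sqrt_of_sq_lt ht
  have hev : ∀ᶠ k : ℕ in atTop, frobSq (A ^ k) ≤ t ^ k := by
    filter_upwards [hlim.eventually_lt_const hlt, eventually_ge_atTop 1] with k hk hk1
    rw [ENNReal.ofReal_lt_ofReal_iff (Real.sqrt_pos.2 ht0)] at hk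
    have hk0 : (k : ℝ) ≠ 0 := by positivity
    have h1 : ‖M ^ k‖ ≤ Real.sqrt t ^ k := by
      have h2 : (‖M ^ k‖ ^ (1 / k : ℝ)) ^ k = ‖M ^ k‖ := by
        rw [← Real.rpow_natCast, ← Real.rpow_mul (norm_nonneg _), one_div_mul_cancel hk0,
          Real.rpow_one]
      rw [← h2]
      exact pow_le_pow_left₀ (Real.rpow_nonneg (norm_nonneg _) _) hk.le k
    rw [← norm_map_sq, hpow]
    calc ‖M ^ k‖ ^ 2 ≤ (Real.sqrt t ^ k) ^ 2 := pow_le_pow_left₀ (norm_nonneg _) h1 2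
      _ = t ^ k := by rw [← pow_mul, mul_comm, pow_mul, Real.sq_sqrt ht0.le]
  -- As $t^k$ never vanishes, a big-O bound along $\mathbb N$ extends to every $k$ after enlarging
  -- the constant.
  have hO : (fun k => frobSq (A ^ k)) =O[atTop] fun k : ℕ => t ^ k := by
    refine Asymptotics.IsBigO.of_bound 1 ?_
    filter_upwards [hev] with k hk
    rw [Real.norm_of_nonneg (frobSq_nonneg _), Real.norm_of_nonneg (by positivity), one_mul]
    exact hk
  obtain ⟨K, hK, h⟩ := Asymptotics.bound_of_isBigO_nat_atTop hO
  refine ⟨K, hK.le, fun k => ?_⟩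
  have := h (x := k) (by positivity)
  rwa [Real.norm_of_nonneg (frobSq_nonneg _), Real.norm_of_nonneg (by positivity)] at this

end Gelfand

/-- Applying `errCov_eq` from the covariance at $j$ leaves one conjugated term and $k$ noise terms.
Each conjugation costs a factor at most the squared Frobenius norm, and $t\ge1$ allows $t^l\le t^k$
for $l<k$. -/
lemma trace_errCov_add_le {A Q P : Matrix (Fin n) (Fin n) ℝ} (hQ : Q.PosSemidef)
    (hP : P.PosSemidef) {K t : ℝ} (hK : 0 ≤ K) (ht : 1 ≤ t)
    (h : ∀ k, frobSq (A ^ k) ≤ K * t ^ k) (j k : ℕ) :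
    (errCov A Q P (j + k)).trace
      ≤ K * t ^ k * (errCov A Q P j).trace + k * (K * t ^ k * Q.trace) := by
  have e : errCov A Q P (j + k) = errCov A Q (errCov A Q P j) k := by
    unfold errCov
    rw [add_comm, Function.iterate_add_apply]
  have hj := posSemidef_errCov (A := A) hQ hP j
  rw [e, errCov_eq, Matrix.trace_add, Matrix.trace_sum]
  refine add_le_add ?_ ?_
  · exact (trace_conj_le hj _).trans (mul_le_mul_of_nonneg_right (h k) hj.trace_nonneg)
  · calc ∑ l ∈ Finset.range k, (A ^ l * Q * (A ^ l)ᵀ).trace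
        ≤ ∑ _l ∈ Finset.range k, K * t ^ k * Q.trace := by
          refine Finset.sum_le_sum fun l hl => (trace_conj_le hQ _).trans ?_
          refine mul_le_mul_of_nonneg_right ((h l).trans ?_) hQ.trace_nonneg
          exact mul_le_mul_of_nonneg_left (pow_le_pow_right₀ ht (Finset.mem_range.1 hl).le) hK
      _ = k * (K * t ^ k * Q.trace) := by simp

/-- After weighting by $(1-\lambda_e)^k$, the two terms are dominated by $\sum_k y^k$ and $\sum_k
k\,y^k$ with $y=(1-\lambda_e)t<1$; the constant `B` is the sum of both series. -/
lemma costBound_of_le {ch : Channels} (hq : ch.adv < 1) {c : ℕ → ℝ} (hc : ∀ j, 0 ≤ c j)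
    {K t L : ℝ} (hK : 0 ≤ K) (ht : 0 ≤ t) (hL : 0 ≤ L) (hyt : (1 - ch.adv) * t < 1)
    (h : ∀ j k : ℕ, c (j + k) ≤ K * t ^ k * c j + k * (K * t ^ k * L)) :
    ∃ B, CostBound ch (fun j => ENNReal.ofReal (c j)) B := by
  have hy0 : 0 ≤ 1 - ch.adv := by linarith
  have hyt0 : 0 ≤ (1 - ch.adv) * t := mul_nonneg hy0 ht
  let f : ℕ → ℝ := fun k => K * ((1 - ch.adv) * t) ^ k
  let g : ℕ → ℝ := fun k => K * L * ((k : ℝ) ^ 1 * ((1 - ch.adv) * t) ^ k)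
  have hs1 : Summable f := (summable_geometric_of_lt_one hyt0 hyt).mul_left K
  have hn : ‖(1 - ch.adv) * t‖ < 1 := by rwa [Real.norm_of_nonneg hyt0]
  have hs0 := summable_pow_mul_geometric_of_norm_lt_one 1 hn
  have hs2 : Summable g := hs0.mul_left (K * L)
  have hf0 : ∀ k, 0 ≤ f k := fun k => mul_nonneg hK (pow_nonneg hyt0 k)
  have hg0 : ∀ k, 0 ≤ g k := fun k =>
    mul_nonneg (mul_nonneg hK hL) (mul_nonneg (pow_nonneg (Nat.cast_nonneg k) 1) (pow_nonneg hyt0 k))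
  have hle : ∀ j k, (1 - ch.adv) ^ k * c (j + k) ≤ f k * c j + g k := by
    intro j k
    refine (mul_le_mul_of_nonneg_left (h j k) (pow_nonneg hy0 k)).trans (le_of_eq ?_)
    simp only [f, g, mul_pow]; ring
  clear_value f g
  have hterm : ∀ j k, ch.miss ^ k * ENNReal.ofReal (c (j + k))
      ≤ ENNReal.ofReal (f k) * ENNReal.ofReal (c j) + ENNReal.ofReal (g k) := by
    intro j k
    rw [Channels.miss, ← ENNReal.ofReal_pow hy0, ← ENNReal.ofReal_mul (pow_nonneg hy0 k),
      ← ENNReal.ofReal_mul (hf0 k), ← ENNReal.ofReal_add (mul_nonneg (hf0 k) (hc j)) (hg0 k)]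
    exact ENNReal.ofReal_le_ofReal (hle j k)
  refine ⟨∑' k, ENNReal.ofReal (f k) + ∑' k, ENNReal.ofReal (g k), fun j => ENNReal.ofReal_ne_top,
    ENNReal.add_ne_top.2 ⟨hs1.tsum_ofReal_ne_top, hs2.tsum_ofReal_ne_top⟩, fun j => ?_⟩
  refine (ENNReal.tsum_le_tsum (hterm j)).trans ?_
  rw [ENNReal.tsum_add, ENNReal.tsum_mul_right, mul_add, mul_one, add_comm]
  exact add_le_add le_add_self (mul_le_mul' le_self_add le_rfl)

lemma exists_costBound {ch : Channels} (hch : ch.Proper) {A Q P : Matrix (Fin n) (Fin n) ℝ}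
    (hQ : Q.PosSemidef) (hP : P.PosSemidef) (hA : (1 - ch.adv) * maxEig A ^ 2 < 1) :
    ∃ B, CostBound ch (ecost A Q P) B := by
  have hy0 : 0 < 1 - ch.adv := by linarith [hch.adv_lt]
  -- The rate `t` must exceed the squared spectral radius for the bound on powers, must be at least
  -- $1$ for the noise terms, and must keep $(1-\lambda_e)t<1$. The spectral hypothesis and
  -- $\lambda_e>0$ leave room for it.
  obtain ⟨t, ht, hty⟩ : ∃ t, max 1 (maxEig A ^ 2) < t ∧ t < 1 / (1 - ch.adv) := by
    refine exists_between (max_lt ?_ ?_)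
    · rw [lt_div_iff₀ hy0]; linarith [hch.adv_pos]
    · rw [lt_div_iff₀ hy0, mul_comm]; exact hA
  have ht1 : 1 ≤ t := (le_max_left _ _).trans ht.le
  obtain ⟨K, hK, hKb⟩ := exists_frobSq_pow_le A ((le_max_right _ _).trans_lt ht)
  exact costBound_of_le hch.adv_lt (fun j => (posSemidef_errCov hQ hP j).trace_nonneg) hK
    (by linarith) hQ.trace_nonneg (by rwa [lt_div_iff₀ hy0, mul_comm] at hty)
    (trace_errCov_add_le hQ hP hK ht1 hKb)

end CovarianceBounds

/-! ### Laws of the chain, geometric tails and the average cost -/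

section Averages

variable {ch : Channels} {τ : ℕ × ℕ → ℝ}

/-- The law of the state at time `k`, with values in `[0,∞]`. -/
def elaw (ch : Channels) (τ : ℕ × ℕ → ℝ) (s₀ : ℕ × ℕ) (k : ℕ) : ℕ × ℕ → ℝ≥0∞ :=
  (push (polKernel ch (· + 1) τ))^[k] (Pi.single s₀ 1)

lemma elaw_succ (s₀ : ℕ × ℕ) (k : ℕ) :
    elaw ch τ s₀ (k + 1) = push (polKernel ch (· + 1) τ) (elaw ch τ s₀ k) :=
  Function.iterate_succ_apply' _ _ _

lemma tsum_elaw (hch : ch.Proper) (hτ : ∀ s, τ s ∈ Set.Icc (0 : ℝ) 1) (s₀ : ℕ × ℕ) (k : ℕ) :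
    ∑' s, elaw ch τ s₀ k s = 1 := by
  induction k with
  | zero => exact tsum_pi_single s₀ (1 : ℝ≥0∞)
  | succ k ih => rw [elaw_succ, tsum_push (tsum_polKernel hch _ hτ), ih]

lemma elaw_ne_top (hch : ch.Proper) (hτ : ∀ s, τ s ∈ Set.Icc (0 : ℝ) 1) (s₀ : ℕ × ℕ) (k : ℕ)
    (s : ℕ × ℕ) : elaw ch τ s₀ k s ≠ ⊤ :=
  ENNReal.ne_top_of_tsum_ne_top (by rw [tsum_elaw hch hτ]; exact ENNReal.one_ne_top) s

lemma polKernel_ne_top (nxt : ℕ → ℕ) (s s' : ℕ × ℕ) : polKernel ch nxt τ s s' ≠ ⊤ :=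
  ENNReal.sum_ne_top.2 fun _ _ => ENNReal.mul_ne_top ENNReal.ofReal_ne_top ENNReal.ofReal_ne_top

lemma polKernel_le_one (hch : ch.Proper) (hτ : ∀ s, τ s ∈ Set.Icc (0 : ℝ) 1) (nxt : ℕ → ℕ)
    (s s' : ℕ × ℕ) : polKernel ch nxt τ s s' ≤ 1 := by
  rw [← tsum_polKernel hch nxt hτ s]
  exact ENNReal.le_tsum s'

lemma toReal_polKernel (hch : ch.Proper) (hτ : ∀ s, τ s ∈ Set.Icc (0 : ℝ) 1) (s s' : ℕ × ℕ) :
    (polKernel ch (· + 1) τ s s').toReal = ∑ a, actProb (τ s) a * trans ch s a s' := by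
  rw [polKernel, ENNReal.toReal_sum fun _ _ =>
    ENNReal.mul_ne_top ENNReal.ofReal_ne_top (ekernel_ne_top _ _ _)]
  refine Finset.sum_congr rfl fun a _ => ?_
  rw [ENNReal.toReal_mul, ekernel, ENNReal.toReal_ofReal (actProb_nonneg (hτ s) a),
    ENNReal.toReal_ofReal (kernel_nonneg hch _ _ _ _)]
  rfl

lemma toReal_push {K : ℕ × ℕ → ℕ × ℕ → ℝ≥0∞} {m : ℕ × ℕ → ℝ≥0∞} (hK : ∀ s s', K s s' ≠ ⊤)
    (hm : ∀ s, m s ≠ ⊤) (s' : ℕ × ℕ) :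
    (push K m s').toReal = ∑' s, (m s).toReal * (K s s').toReal := by
  rw [push, ENNReal.tsum_toReal_eq fun s => ENNReal.mul_ne_top (hm s) (hK s s')]
  simp only [ENNReal.toReal_mul]

lemma stateProb_eq (hch : ch.Proper) (hτ : ∀ s, τ s ∈ Set.Icc (0 : ℝ) 1) (s₀ : ℕ × ℕ) (k : ℕ)
    (s : ℕ × ℕ) : stateProb ch τ s₀ k s = (elaw ch τ s₀ k s).toReal := by
  induction k generalizing s with
  | zero =>
    rw [stateProb, elaw, Function.iterate_zero, id_eq, Pi.single_apply]
    split_ifs <;> simp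
  | succ k ih =>
    rw [stateProb, elaw_succ, toReal_push (polKernel_ne_top _) (elaw_ne_top hch hτ s₀ k)]
    simp only [ih, toReal_polKernel hch hτ]

lemma hasSum_toReal_one {S : Type*} {m : S → ℝ≥0∞} (h : ∑' s, m s = 1) :
    HasSum (fun s => (m s).toReal) 1 := by
  have h1 := (ENNReal.summable_toReal (f := m) (by simp [h])).hasSum
  rwa [← ENNReal.tsum_toReal_eq (ENNReal.ne_top_of_tsum_ne_top (by simp [h])), h,
    ENNReal.toReal_one] at h1

lemma hasSum_stateProb (hch : ch.Proper) (hτ : ∀ s, τ s ∈ Set.Icc (0 : ℝ) 1) (s₀ : ℕ × ℕ)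
    (k : ℕ) : HasSum (stateProb ch τ s₀ k) 1 := by
  have := hasSum_toReal_one (tsum_elaw hch hτ s₀ k)
  rwa [← funext (stateProb_eq hch hτ s₀ k)] at this

lemma stateProb_nonneg (hch : ch.Proper) (hτ : ∀ s, τ s ∈ Set.Icc (0 : ℝ) 1) (s₀ : ℕ × ℕ)
    (k : ℕ) (s : ℕ × ℕ) : 0 ≤ stateProb ch τ s₀ k s := by
  rw [stateProb_eq hch hτ]; exact ENNReal.toReal_nonneg

lemma stateProb_step (hch : ch.Proper) (hτ : ∀ s, τ s ∈ Set.Icc (0 : ℝ) 1) (s₀ : ℕ × ℕ)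
    (k : ℕ) (s' : ℕ × ℕ) : stateProb ch τ s₀ (k + 1) s'
      = ∑' s, stateProb ch τ s₀ k s * (polKernel ch (· + 1) τ s s').toReal := by
  rw [stateProb]
  simp only [toReal_polKernel hch hτ]

lemma toReal_polKernel_le_one (hch : ch.Proper) (hτ : ∀ s, τ s ∈ Set.Icc (0 : ℝ) 1)
    (s s' : ℕ × ℕ) : (polKernel ch (· + 1) τ s s').toReal ≤ 1 := by
  simpa using ENNReal.toReal_mono ENNReal.one_ne_top (polKernel_le_one hch hτ (· + 1) s s')

lemma ofReal_invariant (hch : ch.Proper) (hτ : ∀ s, τ s ∈ Set.Icc (0 : ℝ) 1) {π : ℕ × ℕ → ℝ}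
    (h0 : ∀ s, 0 ≤ π s) (h1 : HasSum π 1)
    (h : ∀ s', π s' = ∑' s, π s * (polKernel ch (· + 1) τ s s').toReal) :
    ∑' s, ENNReal.ofReal (π s) = 1 ∧
      Invariant (polKernel ch (· + 1) τ) fun s => ENNReal.ofReal (π s) := by
  refine ⟨?_, fun s' => ?_⟩
  · rw [← ENNReal.ofReal_tsum_of_nonneg h0 h1.summable, h1.tsum_eq, ENNReal.ofReal_one]
  · dsimp only
    rw [h s', ENNReal.ofReal_tsum_of_nonneg fun s => mul_nonneg (h0 s) ENNReal.toReal_nonneg]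
    · refine tsum_congr fun s => ?_
      rw [ENNReal.ofReal_mul (h0 s), ENNReal.ofReal_toReal (polKernel_ne_top _ _ _)]
    · exact h1.summable.of_nonneg_of_le (fun s => mul_nonneg (h0 s) ENNReal.toReal_nonneg)
        fun s => mul_le_of_le_one_right (h0 s) (toReal_polKernel_le_one hch hτ s s')

/-- Pointwise convergence of the averaged laws, under domination. -/
lemma tendsto_cesaro_stateProb (hch : ch.Proper) (hτ : ∀ s, τ s ∈ Set.Icc (0 : ℝ) 1)
    {R : ℕ × ℕ → ℝ≥0∞} (hR1 : ∑' s, R s = 1) (hR : Invariant (polKernel ch (· + 1) τ) R)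
    {s₀ : ℕ × ℕ} {b : ℕ × ℕ → ℝ} (hb : ∀ k s, stateProb ch τ s₀ k s ≤ b s) (hbs : Summable b)
    (s : ℕ × ℕ) :
    Tendsto (fun T => cesaro (stateProb ch τ s₀) T s) atTop (𝓝 (R s).toReal) := by
  refine tendsto_cesaro_of_unique (K := fun s s' => (polKernel ch (· + 1) τ s s').toReal)
    (π := fun s => (R s).toReal)
    (fun _ _ => ENNReal.toReal_nonneg) (toReal_polKernel_le_one hch hτ)
    (stateProb_nonneg hch hτ s₀) hb hbs (hasSum_stateProb hch hτ s₀) (stateProb_step hch hτ s₀)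
    (fun π h0 h1 h => ?_) s
  obtain ⟨e1, e2⟩ := ofReal_invariant hch hτ h0 h1 h
  have := invariant_unique (tsum_polKernel hch _ hτ)
    (invariant_charges_origin hch fun s => Or.inr fun t h => h) e1 e2 hR1 hR
  funext s
  rw [← congrFun this s, ENNReal.toReal_ofReal (h0 s)]

lemma exists_invariant_of_dominated (hch : ch.Proper) (hτ : ∀ s, τ s ∈ Set.Icc (0 : ℝ) 1)
    {s₀ : ℕ × ℕ} {b : ℕ × ℕ → ℝ} (hb : ∀ k s, stateProb ch τ s₀ k s ≤ b s) (hbs : Summable b) :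
    ∃ R : ℕ × ℕ → ℝ≥0∞, ∑' s, R s = 1 ∧ Invariant (polKernel ch (· + 1) τ) R := by
  obtain ⟨π, -, h0, h1, h⟩ := exists_cesaro_limit
    (K := fun s s' => (polKernel ch (· + 1) τ s s').toReal)
    (fun _ _ => ENNReal.toReal_nonneg) (toReal_polKernel_le_one hch hτ)
    (stateProb_nonneg hch hτ s₀) hb hbs (hasSum_stateProb hch hτ s₀) (stateProb_step hch hτ s₀)
    (Ultrafilter.of atTop) (Ultrafilter.of_le _)
  exact ⟨_, ofReal_invariant hch hτ h0 h1 h⟩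

variable {n : ℕ} {A Q P : Matrix (Fin n) (Fin n) ℝ}

lemma ecost_ne_top (j : ℕ) : ecost A Q P j ≠ ⊤ := ENNReal.ofReal_ne_top

/-- Entries of a positive semidefinite matrix are bounded by its trace, so the matrix series
converges as soon as the series of traces does, and the trace can be exchanged with the sum. -/
lemma trace_tsum_smul_errCov (hQ : Q.PosSemidef) (hP : P.PosSemidef) {μ : ℕ × ℕ → ℝ}
    (h0 : ∀ s, 0 ≤ μ s) (hs : Summable fun s => μ s * (errCov A Q P s.2).trace) :
    (∑' s, μ s • errCov A Q P s.2).trace = ∑' s, μ s * (errCov A Q P s.2).trace := by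
  have hsum : Summable fun s : ℕ × ℕ => μ s • errCov A Q P s.2 := by
    refine Pi.summable.2 fun a => Pi.summable.2 fun b => ?_
    refine Summable.of_norm_bounded hs fun s => ?_
    change ‖μ s * errCov A Q P s.2 a b‖ ≤ _
    rw [norm_mul, Real.norm_of_nonneg (h0 s)]
    exact mul_le_mul_of_nonneg_left (abs_apply_le_trace (posSemidef_errCov hQ hP _) a b) (h0 s)
  have hc : Continuous (Matrix.traceAddMonoidHom (Fin n) ℝ) :=
    (continuous_id.matrix_trace : Continuous fun M : Matrix (Fin n) (Fin n) ℝ => M.trace)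
  have := hsum.map_tsum (Matrix.traceAddMonoidHom (Fin n) ℝ) hc
  simpa using this

lemma summable_of_ecost (hQ : Q.PosSemidef) (hP : P.PosSemidef) {m : ℕ × ℕ → ℝ≥0∞}
    (h : ∑' s, m s * ecost A Q P s.2 ≠ ⊤) :
    Summable fun s : ℕ × ℕ => (m s).toReal * (errCov A Q P s.2).trace := by
  refine (ENNReal.summable_toReal h).congr fun s => ?_
  rw [ENNReal.toReal_mul, ecost, ENNReal.toReal_ofReal (posSemidef_errCov hQ hP _).trace_nonneg]

lemma toReal_tsum_ecost (hQ : Q.PosSemidef) (hP : P.PosSemidef) {m : ℕ × ℕ → ℝ≥0∞}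
    (hm : ∀ s, m s ≠ ⊤) : (∑' s, m s * ecost A Q P s.2).toReal
      = ∑' s : ℕ × ℕ, (m s).toReal * (errCov A Q P s.2).trace := by
  rw [ENNReal.tsum_toReal_eq fun s => ENNReal.mul_ne_top (hm s) (ecost_ne_top _)]
  refine tsum_congr fun s => ?_
  rw [ENNReal.toReal_mul, ecost, ENNReal.toReal_ofReal (posSemidef_errCov hQ hP _).trace_nonneg]

lemma isAEEC_of_tendsto (hch : ch.Proper) (hτ : ∀ s, τ s ∈ Set.Icc (0 : ℝ) 1)
    (hQ : Q.PosSemidef) (hP : P.PosSemidef) {s₀ : ℕ × ℕ} {J : ℝ}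
    (hfin : ∀ k, ∑' s, elaw ch τ s₀ k s * ecost A Q P s.2 ≠ ⊤)
    (h : Tendsto (fun T : ℕ => (1 / (T : ℝ)) * ∑ k ∈ Finset.Icc 1 T,
      ∑' s, stateProb ch τ s₀ k s * (errCov A Q P s.2).trace) atTop (𝓝 J)) :
    IsAEEC ch A Q P τ s₀ J := by
  refine h.congr fun T => ?_
  congr 1
  refine Finset.sum_congr rfl fun k _ => ?_
  rw [trace_tsum_smul_errCov hQ hP (stateProb_nonneg hch hτ s₀ k)]
  simp only [stateProb_eq hch hτ]
  exact summable_of_ecost hQ hP (hfin k)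

/-- The average cost, from an initial state charged by the invariant probability. -/
lemma isAEEC_of_charged (hch : ch.Proper) (hτ : ∀ s, τ s ∈ Set.Icc (0 : ℝ) 1)
    (hQ : Q.PosSemidef) (hP : P.PosSemidef) {R : ℕ × ℕ → ℝ≥0∞} (hR1 : ∑' s, R s = 1)
    (hR : Invariant (polKernel ch (· + 1) τ) R) (hcost : ∑' s, R s * ecost A Q P s.2 ≠ ⊤)
    {s₀ : ℕ × ℕ} (hs₀ : R s₀ ≠ 0) :
    IsAEEC ch A Q P τ s₀ (∑' s, R s * ecost A Q P s.2).toReal := by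
  have hRt : ∀ s, R s ≠ ⊤ := ENNReal.ne_top_of_tsum_ne_top (by simp [hR1])
  -- The point mass at $s_0$ lies below $R/R(s_0)$, and this bound is preserved by each step because
  -- `R` is invariant.
  have hdom : ∀ k s, elaw ch τ s₀ k s ≤ (R s₀)⁻¹ * R s := by
    intro k
    induction k with
    | zero =>
      intro s
      by_cases hs : s = s₀
      · subst hs
        simp [elaw, ENNReal.inv_mul_cancel hs₀ (hRt s)]
      · simp [elaw, hs]
    | succ k ih =>
      intro s
      rw [elaw_succ, ← hR s, ← push_const_mul]
      exact push_mono ih s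
  have hinv : (R s₀)⁻¹ ≠ ⊤ := ENNReal.inv_ne_top.2 hs₀
  have hbt : ∀ s, (R s₀)⁻¹ * R s ≠ ⊤ := fun s => ENNReal.mul_ne_top hinv (hRt s)
  have hb : ∀ k s, stateProb ch τ s₀ k s ≤ ((R s₀)⁻¹ * R s).toReal := fun k s => by
    rw [stateProb_eq hch hτ]
    exact ENNReal.toReal_mono (hbt s) (hdom k s)
  have hbs : Summable fun s => ((R s₀)⁻¹ * R s).toReal := ENNReal.summable_toReal (by
    rw [ENNReal.tsum_mul_left, hR1, mul_one]; exact hinv)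
  have hbc : ∑' s, (R s₀)⁻¹ * R s * ecost A Q P s.2 ≠ ⊤ := by
    simp only [mul_assoc]
    rw [ENNReal.tsum_mul_left]
    exact ENNReal.mul_ne_top hinv hcost
  refine isAEEC_of_tendsto hch hτ hQ hP (fun k => ne_top_of_le_ne_top hbc
    (ENNReal.tsum_le_tsum fun s => mul_le_mul' (hdom k s) le_rfl)) ?_
  rw [toReal_tsum_ecost hQ hP hRt]
  exact tendsto_average_observable (stateProb_nonneg hch hτ s₀) hb
    (fun s => (posSemidef_errCov hQ hP _).trace_nonneg) (summable_of_ecost hQ hP hbc)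
    (tendsto_cesaro_stateProb hch hτ hR1 hR hb hbs)

/-- Mass at level $M+l$ was at level $M$ exactly $l$ steps earlier and lost a factor `y` at each, or
else time $0$ came before, when the levels above $M$ were empty. -/
lemma geometric_decay {E : ℕ → ℕ → ℝ≥0∞} {y : ℝ≥0∞} {M : ℕ} (h1 : ∀ k j, E k j ≤ 1)
    (h0 : ∀ j, M < j → E 0 j = 0) (h : ∀ k j, M ≤ j → E (k + 1) (j + 1) ≤ y * E k j) (k j : ℕ) :
    E k j ≤ y ^ (j - M) := by
  have key : ∀ l k, E k (M + l) ≤ y ^ l := by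
    intro l
    induction l with
    | zero => intro k; simpa using h1 k M
    | succ l ih =>
      intro k
      cases k with
      | zero => rw [h0 _ (by omega)]; exact zero_le
      | succ k =>
        refine (h k (M + l) (by omega)).trans ?_
        rw [pow_succ, mul_comm]
        gcongr
        exact ih k
  rcases le_total j M with hj | hj
  · rw [Nat.sub_eq_zero_of_le hj, pow_zero]; exact h1 k j
  · obtain ⟨l, rfl⟩ := Nat.exists_eq_add_of_le hj
    simpa using key l k

lemma tsum_mul_snd (m : ℕ × ℕ → ℝ≥0∞) (C : ℕ → ℝ≥0∞) :
    ∑' s, m s * C s.2 = ∑' j, (∑' i, m (i, j)) * C j := by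
  rw [ENNReal.tsum_prod', ENNReal.tsum_comm]
  refine tsum_congr fun j => ?_
  dsimp only
  rw [ENNReal.tsum_mul_right]

lemma col_eq (m : ℕ × ℕ → ℝ≥0∞) (j : ℕ) :
    ∑' i, m (i, j) = ∑' s : ℕ × ℕ, m s * (if s.2 = j then 1 else 0) := by
  rw [tsum_mul_snd m fun j' => if j' = j then 1 else 0]
  simp only [mul_ite, mul_one, mul_zero]
  exact (tsum_ite_eq j (fun j' => ∑' i, m (i, j'))).symm

lemma row_eq (m : ℕ × ℕ → ℝ≥0∞) (i : ℕ) :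
    ∑' j, m (i, j) = ∑' s : ℕ × ℕ, m s * (if s.1 = i then 1 else 0) := by
  rw [ENNReal.tsum_prod']
  simp only [mul_ite, mul_one, mul_zero]
  refine ((tsum_eq_single i fun i' hi' => ?_).trans ?_).symm
  · simp [hi']
  · simp

/-- One-step estimate serving rows and columns alike: `g` tests the next level and `f` the present
one, on which transmission is certain. -/
lemma polKernel_row_col (hch : ch.Proper) (m : ℕ × ℕ → ℝ≥0∞) (g : ℕ × ℕ → ℝ≥0∞)
    {f : ℕ × ℕ → ℝ≥0∞} {y : ℝ≥0∞}
    (h1 : ∀ s, f s = 0 → g (s.1 + 1, s.2 + 1) = 0 ∧ g (0, s.2 + 1) = 0 ∧ g (s.1 + 1, 0) = 0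
      ∧ g (0, 0) = 0)
    (h2 : ∀ s, f s ≠ 0 → τ s = 1 ∧ ch.none * g (s.1 + 1, s.2 + 1) + ch.onlyLegit * g (0, s.2 + 1)
      + ch.onlyAdv * g (s.1 + 1, 0) + ch.both * g (0, 0) ≤ y * f s) :
    ∑' s, push (polKernel ch (· + 1) τ) m s * g s ≤ y * ∑' s, m s * f s := by
  rw [tsum_push_mul, ← ENNReal.tsum_mul_left]
  refine ENNReal.tsum_le_tsum fun s => ?_
  rw [tsum_polKernel_mul, Fin.sum_univ_two, tsum_ekernel_zero, tsum_ekernel_one hch]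
  by_cases hf : f s = 0
  · obtain ⟨e1, e2, e3, e4⟩ := h1 s hf
    simp [hf, e1, e2, e3, e4]
  · obtain ⟨e1, e2⟩ := h2 s hf
    rw [e1]
    simp only [actProb, zero_ne_one, if_false, if_true, sub_self, ENNReal.ofReal_zero, zero_mul,
      ENNReal.ofReal_one, one_mul, zero_add]
    refine (mul_le_mul' le_rfl e2).trans (le_of_eq ?_)
    ring

section Boundary

variable {N : ℕ} (hch : ch.Proper) (hτ : ∀ s, τ s ∈ Set.Icc (0 : ℝ) 1)
  (hbd : ∀ s : ℕ × ℕ, N ≤ s.1 ∨ N ≤ s.2 → τ s = 1) (s₀ : ℕ × ℕ)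

include hch hτ hbd

lemma col_elaw_le (k j : ℕ) :
    ∑' i, elaw ch τ s₀ k (i, j) ≤ ch.miss ^ (j - max N s₀.2) := by
  refine geometric_decay (E := fun k j => ∑' i, elaw ch τ s₀ k (i, j)) (fun k j => ?_)
    (fun j hj => ?_) (fun k j hj => ?_) k j
  · rw [col_eq]
    refine le_of_le_of_eq (ENNReal.tsum_le_tsum fun s => ?_) (tsum_elaw hch hτ s₀ k)
    split_ifs <;> simp
  · refine ENNReal.tsum_eq_zero.2 fun i => ?_
    have : (i, j) ≠ s₀ := by rintro rfl; simp at hj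
    simp [elaw, this]
  · rw [col_eq, col_eq, elaw_succ]
    refine polKernel_row_col hch _ _ (fun s hs => ?_) fun s hs => ?_
    · have : s.2 ≠ j := fun h => by simp [h] at hs
      simp [this]
    · have : s.2 = j := by by_contra h; simp [h] at hs
      refine ⟨hbd s (Or.inr (by omega)), ?_⟩
      simp [this, hch.none_add_onlyLegit]

lemma row_elaw_le (k i : ℕ) :
    ∑' j, elaw ch τ s₀ k (i, j) ≤ (ch.none + ch.onlyAdv) ^ (i - max N s₀.1) := by
  refine geometric_decay (E := fun k i => ∑' j, elaw ch τ s₀ k (i, j)) (fun k i => ?_)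
    (fun i hi => ?_) (fun k i hi => ?_) k i
  · rw [row_eq]
    refine le_of_le_of_eq (ENNReal.tsum_le_tsum fun s => ?_) (tsum_elaw hch hτ s₀ k)
    split_ifs <;> simp
  · refine ENNReal.tsum_eq_zero.2 fun j => ?_
    have : (i, j) ≠ s₀ := by rintro rfl; simp at hi
    simp [elaw, this]
  · rw [row_eq, row_eq, elaw_succ]
    refine polKernel_row_col hch _ _ (fun s hs => ?_) fun s hs => ?_
    · have : s.1 ≠ i := fun h => by simp [h] at hs
      simp [this]
    · have : s.1 = i := by by_contra h; simp [h] at hs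
      refine ⟨hbd s (Or.inl (by omega)), ?_⟩
      simp [this]

omit hτ hbd in
lemma Channels.Proper.none_add_onlyAdv :
    ch.none + ch.onlyAdv = ENNReal.ofReal (1 - ch.legit * ch.ack) := by
  obtain ⟨h1, h2, h3, h4⟩ := hch
  rw [Channels.none, Channels.onlyAdv, ← ENNReal.ofReal_add]
  · congr 1; ring
  · exact mul_nonneg (by linarith) (by linarith)
  · exact mul_nonneg (by linarith) (by linarith)

omit hch hτ hbd in
lemma summable_pow_tsub {z : ℝ} (h0 : 0 ≤ z) (h1 : z < 1) (M : ℕ) :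
    Summable fun i : ℕ => z ^ (i - M) := by
  rw [← summable_nat_add_iff M]
  simpa using summable_geometric_of_lt_one h0 h1

omit hch hτ hbd in
lemma summable_mul_prod {f g : ℕ → ℝ} (hf : Summable f) (hg : Summable g) (hf0 : ∀ i, 0 ≤ f i)
    (hg0 : ∀ j, 0 ≤ g j) : Summable fun s : ℕ × ℕ => f s.1 * g s.2 :=
  hf.mul_of_nonneg hg hf0 hg0

/-- Row and column tails bound the law of a state by $x^{i}$ and by $y^{j}$ up to shifts, neither of
which is summable over pairs. Their geometric mean is a product of two geometric sequences and is
summable. -/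
lemma exists_dominating :
    ∃ b : ℕ × ℕ → ℝ, (∀ k s, stateProb ch τ s₀ k s ≤ b s) ∧ Summable b := by
  set x := 1 - ch.legit * ch.ack with hx
  set y := 1 - ch.adv with hy
  have hx0 : 0 ≤ x := by linarith [hch.legit_le]
  have hx1 : x < 1 := by linarith [hch.legit_pos]
  have hy0 : 0 ≤ y := by linarith [hch.adv_lt]
  have hy1 : y < 1 := by linarith [hch.adv_pos]
  refine ⟨fun s => Real.sqrt x ^ (s.1 - max N s₀.1) * Real.sqrt y ^ (s.2 - max N s₀.2),
    fun k s => ?_, ?_⟩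
  · have e1 : stateProb ch τ s₀ k s ≤ x ^ (s.1 - max N s₀.1) := by
      rw [stateProb_eq hch hτ]
      refine ENNReal.toReal_le_of_le_ofReal (by positivity) ?_
      rw [ENNReal.ofReal_pow hx0, hx, ← hch.none_add_onlyAdv]
      exact (ENNReal.le_tsum s.2).trans (row_elaw_le hch hτ hbd s₀ k s.1)
    have e2 : stateProb ch τ s₀ k s ≤ y ^ (s.2 - max N s₀.2) := by
      rw [stateProb_eq hch hτ]
      refine ENNReal.toReal_le_of_le_ofReal (by positivity) ?_
      rw [ENNReal.ofReal_pow hy0, hy]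
      exact (ENNReal.le_tsum (f := fun i => elaw ch τ s₀ k (i, s.2)) s.1).trans
        (col_elaw_le hch hτ hbd s₀ k s.2)
    refine abs_le_of_sq_le_sq' ?_ (by positivity) |>.2
    rw [mul_pow, ← pow_mul, ← pow_mul, mul_comm _ 2, mul_comm _ 2, pow_mul, pow_mul,
      Real.sq_sqrt hx0, Real.sq_sqrt hy0, sq]
    exact mul_le_mul e1 e2 (stateProb_nonneg hch hτ _ _ _) (by positivity)
  · have hsx : Real.sqrt x < 1 := by rw [Real.sqrt_lt' one_pos]; simpa using hx1
    have hsy : Real.sqrt y < 1 := by rw [Real.sqrt_lt' one_pos]; simpa using hy1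
    have h1 := summable_pow_tsub (Real.sqrt_nonneg _) hsx (max N s₀.1)
    have h2 := summable_pow_tsub (Real.sqrt_nonneg _) hsy (max N s₀.2)
    have p1 : ∀ i, 0 ≤ Real.sqrt x ^ (i - max N s₀.1) := fun i => pow_nonneg (Real.sqrt_nonneg _) _
    have p2 : ∀ j, 0 ≤ Real.sqrt y ^ (j - max N s₀.2) := fun j => pow_nonneg (Real.sqrt_nonneg _) _
    have h3 := summable_mul_prod h1 h2 p1 p2
    simpa only using h3

lemma exists_invariant_of_boundary :
    ∃ R : ℕ × ℕ → ℝ≥0∞, ∑' s, R s = 1 ∧ Invariant (polKernel ch (· + 1) τ) R := by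
  obtain ⟨b, hb, hbs⟩ := exists_dominating hch hτ hbd (0, 0)
  exact exists_invariant_of_dominated hch hτ hb hbs

/-- The average cost of a policy that transmits beyond the horizon, from any initial state. -/
lemma isAEEC_of_boundary (hQ : Q.PosSemidef) (hP : P.PosSemidef) {B : ℝ≥0∞}
    (hB : CostBound ch (ecost A Q P) B) {R : ℕ × ℕ → ℝ≥0∞} (hR1 : ∑' s, R s = 1)
    (hR : Invariant (polKernel ch (· + 1) τ) R) :
    IsAEEC ch A Q P τ s₀ (∑' s, R s * ecost A Q P s.2).toReal := by
  have hRt : ∀ s, R s ≠ ⊤ := ENNReal.ne_top_of_tsum_ne_top (by simp [hR1])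
  set M := max N s₀.2 with hM
  -- The dominating function on pairs decays only like $(1-\lambda_e)^{j/2}$, which need not beat
  -- the growth of the cost. Since the cost depends on $j$ alone, domination is applied to the
  -- column masses, which decay at the full rate.
  have hgeo : ∑' j, ch.miss ^ (j - M) * ecost A Q P j ≠ ⊤ := by
    rw [tsum_nat_split M]
    refine ENNReal.add_ne_top.2 ⟨ENNReal.sum_ne_top.2 fun j _ => ENNReal.mul_ne_top
      (ENNReal.pow_ne_top ENNReal.ofReal_ne_top) ENNReal.ofReal_ne_top, ?_⟩
    simp only [add_tsub_cancel_left]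
    exact ne_top_of_le_ne_top (ENNReal.mul_ne_top hB.bound_ne_top
      (ENNReal.add_ne_top.2 ⟨ENNReal.one_ne_top, hB.ne_top M⟩)) (hB.le M)
  have hcol := col_elaw_le hch hτ hbd s₀
  have hcolt : ∀ k j, ∑' i, elaw ch τ s₀ k (i, j) ≠ ⊤ := fun k j =>
    ne_top_of_le_ne_top (ENNReal.pow_ne_top ENNReal.ofReal_ne_top) (hcol k j)
  have hRcolt : ∀ j, ∑' i, R (i, j) ≠ ⊤ := fun j => by
    rw [col_eq]
    refine ne_top_of_le_ne_top (b := ∑' s, R s) (by simp [hR1]) (ENNReal.tsum_le_tsum fun s => ?_)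
    split_ifs <;> simp
  obtain ⟨b, hb, hbs⟩ := exists_dominating hch hτ hbd s₀
  have hc0 : ∀ j, 0 ≤ (errCov A Q P j).trace := fun j => (posSemidef_errCov hQ hP j).trace_nonneg
  have htoReal : ∀ (m : ℕ × ℕ → ℝ≥0∞), (∀ s, m s ≠ ⊤) → (∀ j, ∑' i, m (i, j) ≠ ⊤) →
      ∑' s : ℕ × ℕ, (m s).toReal * (errCov A Q P s.2).trace
        = ∑' j, (∑' i, m (i, j)).toReal * (errCov A Q P j).trace := by
    intro m hm hmc
    rw [← toReal_tsum_ecost hQ hP hm, tsum_mul_snd m (ecost A Q P), ENNReal.tsum_toReal_eq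
      fun j => ENNReal.mul_ne_top (hmc j) (ecost_ne_top j)]
    refine tsum_congr fun j => ?_
    rw [ENNReal.toReal_mul, ecost, ENNReal.toReal_ofReal (hc0 j)]
  have hind : ∀ (m : ℕ × ℕ → ℝ≥0∞), (∀ s, m s ≠ ⊤) → ∀ j,
      ∑' s : ℕ × ℕ, (m s).toReal * (if s.2 = j then 1 else 0) = (∑' i, m (i, j)).toReal := by
    intro m hm j
    rw [col_eq, ENNReal.tsum_toReal_eq fun s => ENNReal.mul_ne_top (hm s) (by split_ifs <;> simp)]
    refine tsum_congr fun s => ?_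
    rw [ENNReal.toReal_mul]
    split_ifs <;> simp
  refine isAEEC_of_tendsto hch hτ hQ hP (fun k => ?_) ?_
  · rw [tsum_mul_snd (elaw ch τ s₀ k) (ecost A Q P)]
    exact ne_top_of_le_ne_top hgeo (ENNReal.tsum_le_tsum fun j => mul_le_mul' (hcol k j) le_rfl)
  · rw [toReal_tsum_ecost hQ hP hRt, htoReal R hRt hRcolt]
    simp only [stateProb_eq hch hτ, htoReal _ (elaw_ne_top hch hτ s₀ _) (hcolt _)]
    refine tendsto_average_observable (b := fun j => (ch.miss ^ (j - M)).toReal)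
      (fun _ _ => ENNReal.toReal_nonneg)
      (fun k j => ENNReal.toReal_mono (ENNReal.pow_ne_top ENNReal.ofReal_ne_top) (hcol k j))
      hc0 ?_ fun j => ?_
    · refine (ENNReal.summable_toReal hgeo).congr fun j => ?_
      rw [ENNReal.toReal_mul, ecost, ENNReal.toReal_ofReal (hc0 j)]
    -- Convergence of the averaged column masses: the indicator of a column is bounded, so the
    -- summable bound on pairs suffices here.
    · have h1 := tendsto_average_observable (f := fun s : ℕ × ℕ => if s.2 = j then (1 : ℝ) else 0)
        (stateProb_nonneg hch hτ s₀) hb (fun s => by split_ifs <;> simp)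
        (hbs.of_nonneg_of_le (fun s => mul_nonneg
          ((stateProb_nonneg hch hτ s₀ 0 s).trans (hb 0 s)) (by split_ifs <;> simp))
          fun s => mul_le_of_le_one_right ((stateProb_nonneg hch hτ s₀ 0 s).trans (hb 0 s))
            (by split_ifs <;> simp)) (tendsto_cesaro_stateProb hch hτ hR1 hR hb hbs)
      simp only [stateProb_eq hch hτ, hind _ (elaw_ne_top hch hτ s₀ _), hind R hRt] at h1
      exact h1

end Boundary

end Averages

/-! ### The stealth constraint under truncation, perturbation and mixing -/

section Stealth

/-- The marginal of the holding time at the legitimate estimator and the action. -/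
def rowMass (r : ℕ × ℕ → Fin 2 → ℝ≥0∞) (i : ℕ) (a : Fin 2) : ℝ≥0∞ := ∑' j, r (i, j) a

/-- The real-valued state-action measure. -/
def realOcc (r : ℕ × ℕ → Fin 2 → ℝ≥0∞) (s : ℕ × ℕ) (a : Fin 2) : ℝ := (r s a).toReal

variable {ch : Channels} {nxt : ℕ → ℕ} {N : ℕ} {r r' : ℕ × ℕ → Fin 2 → ℝ≥0∞}

lemma rowMass_eq (r : ℕ × ℕ → Fin 2 → ℝ≥0∞) (i : ℕ) (a : Fin 2) :
    rowMass r i a = ∑' s : ℕ × ℕ, r s a * (if s.1 = i then 1 else 0) := row_eq (fun s => r s a) i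

lemma EOcc.tsum_rowMass (hr : EOcc ch nxt r) : ∑' i, ∑ a, rowMass r i a = 1 := by
  rw [← hr.total, ENNReal.tsum_prod']
  refine tsum_congr fun i => ?_
  rw [Summable.tsum_finsetSum fun _ _ => ENNReal.summable]
  rfl

lemma EOcc.rowMass_ne_top (hr : EOcc ch nxt r) (i : ℕ) (a : Fin 2) : rowMass r i a ≠ ⊤ := by
  refine ne_top_of_le_ne_top ?_ (Finset.single_le_sum (f := rowMass r i) (fun _ _ => zero_le)
    (Finset.mem_univ a))
  exact ENNReal.ne_top_of_tsum_ne_top (f := fun i => ∑ a, rowMass r i a)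
    (by rw [hr.tsum_rowMass]; exact ENNReal.one_ne_top) i

lemma EOcc.marg_eq (hr : EOcc ch nxt r) (i : ℕ) (a : Fin 2) :
    marg (realOcc r) i a = (rowMass r i a).toReal :=
  (ENNReal.tsum_toReal_eq fun _ => hr.ne_top _ _).symm

lemma EOcc.hasSum_marg (hr : EOcc ch nxt r) :
    HasSum (fun x : ℕ × Fin 2 => marg (realOcc r) x.1 x.2) 1 := by
  have h1 : ∑' x : ℕ × Fin 2, rowMass r x.1 x.2 = 1 := by
    rw [tsum_stateAction, hr.tsum_rowMass]
  have := hasSum_toReal_one h1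
  simpa only [hr.marg_eq] using this

lemma marg_nonneg (r : ℕ × ℕ → Fin 2 → ℝ≥0∞) (i : ℕ) (a : Fin 2) : 0 ≤ marg (realOcc r) i a :=
  tsum_nonneg fun _ => ENNReal.toReal_nonneg

lemma summable_abs_sub {ι : Type*} {f g : ι → ℝ} (hf : Summable f) (hg : Summable g) :
    Summable fun x => |f x - g x| := (hf.sub hg).abs

lemma tsum_prod_fin_two {f : ℕ × Fin 2 → ℝ} (hf : Summable f) :
    ∑' x, f x = ∑ a, ∑' i, f (i, a) := by
  rw [← (Equiv.prodComm (Fin 2) ℕ).tsum_eq f]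
  have h : Summable fun x : Fin 2 × ℕ => f (Equiv.prodComm (Fin 2) ℕ x) :=
    (Equiv.prodComm (Fin 2) ℕ).summable_iff.2 hf
  rw [h.tsum_prod, tsum_fintype]
  rfl

lemma tsum_split_real {f : ℕ → ℝ} (hf : Summable f) (N : ℕ) :
    ∑' i, f i = ∑ i : Fin N, f i + ∑' k, f (N + k) := by
  rw [← hf.sum_add_tsum_nat_add N, Finset.sum_range]
  simp only [add_comm N]

lemma summable_slice {f : ℕ × Fin 2 → ℝ} (hf : Summable f) (a : Fin 2) :
    Summable fun i => f (i, a) :=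
  hf.comp_injective (i := fun i : ℕ => (i, a)) fun _ _ h => congrArg Prod.fst h

lemma summable_shift {f : ℕ → ℝ} (hf : Summable f) (N : ℕ) : Summable fun k => f (N + k) :=
  hf.comp_injective (add_right_injective N)

lemma l1Dist_split {ω ρ : ℕ × ℕ → Fin 2 → ℝ}
    (hω : Summable fun x : ℕ × Fin 2 => marg ω x.1 x.2)
    (hρ : Summable fun x : ℕ × Fin 2 => marg ρ x.1 x.2) (N : ℕ) :
    l1Dist ω ρ = ∑ a, (∑ i : Fin N, |marg ρ i a - marg ω i a|
      + ∑' k, |marg ρ (N + k) a - marg ω (N + k) a|) := by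
  have hs := summable_abs_sub hρ hω
  rw [l1Dist, tsum_prod_fin_two hs]
  exact Finset.sum_congr rfl fun a _ => tsum_split_real (summable_slice hs a) N

lemma rowMass_lump_of_lt (r : ℕ × ℕ → Fin 2 → ℝ≥0∞) {i : ℕ} (hi : i < N) (a : Fin 2) :
    rowMass (lump N r) i a = rowMass r i a := by
  rw [rowMass_eq, tsum_lump_mul N r a fun s => if s.1 = i then 1 else 0, rowMass_eq]
  refine tsum_congr fun s => ?_
  have : ((clamp N s).1 = i) = (s.1 = i) := by
    apply propext; simp only [clamp]; omega
  simp only [this]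

lemma tsum_mul_fst (m : ℕ × ℕ → ℝ≥0∞) (C : ℕ → ℝ≥0∞) :
    ∑' s, m s * C s.1 = ∑' i, (∑' j, m (i, j)) * C i := by
  rw [ENNReal.tsum_prod']
  refine tsum_congr fun j => ?_
  dsimp only
  rw [ENNReal.tsum_mul_right]

lemma rowMass_lump_self (r : ℕ × ℕ → Fin 2 → ℝ≥0∞) (a : Fin 2) :
    rowMass (lump N r) N a = ∑' k, rowMass r (N + k) a := by
  rw [rowMass_eq, tsum_lump_mul N r a fun s => if s.1 = N then 1 else 0]
  have := tsum_mul_fst (fun s => r s a) fun i => if min i N = N then 1 else 0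
  refine this.trans ?_
  rw [tsum_nat_split N, Finset.sum_eq_zero, zero_add]
  · refine tsum_congr fun k => ?_
    rw [if_pos (by omega), mul_one]; rfl
  · intro j hj
    have := Finset.mem_range.1 hj
    rw [if_neg (by omega), mul_zero]

lemma sum_restrict (hch : ch.Proper) (hr : EOcc ch (truncNext N) r) (i : Fin (N + 1))
    (a : Fin 2) : ∑ j, restrict N r (i, j) a = (rowMass r i a).toReal := by
  rw [rowMass, tsum_eq_sum (s := Finset.range (N + 1)) (fun j hj => ?_), Finset.sum_range,
    ENNReal.toReal_sum fun j _ => hr.ne_top _ _]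
  · rfl
  · refine hr.eq_zero_of_trunc hch ?_ a
    rw [Finset.mem_range] at hj
    exact fun h => hj h.2

lemma sum_restrict_lump_castSucc (hch : ch.Proper) (hr : EOcc ch (· + 1) r) (i : Fin N)
    (a : Fin 2) : ∑ j, restrict N (lump N r) (i.castSucc, j) a = marg (realOcc r) i a := by
  rw [sum_restrict hch (hr.lump hch N), Fin.val_castSucc, rowMass_lump_of_lt r i.2, hr.marg_eq]

lemma sum_restrict_lump_last (hch : ch.Proper) (hr : EOcc ch (· + 1) r) (a : Fin 2) :
    ∑ j, restrict N (lump N r) (Fin.last N, j) a = ∑' k, marg (realOcc r) (N + k) a := by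
  rw [sum_restrict hch (hr.lump hch N), Fin.val_last, rowMass_lump_self,
    ENNReal.tsum_toReal_eq fun k => hr.rowMass_ne_top _ _]
  simp only [hr.marg_eq]

/-- Feasibility in the finite program of the truncation of a measure that is feasible in the
infinite one. -/
lemma exists_truncFeasible (hch : ch.Proper) {ω : ℕ × ℕ → Fin 2 → ℝ}
    (hω : Summable fun x : ℕ × Fin 2 => marg ω x.1 x.2) {εs : ℝ} (hr : EOcc ch (· + 1) r)
    (hb : BoundaryTransmits N r) (h : l1Dist ω (realOcc r) ≤ εs) :
    ∃ ε, TruncFeasible ch ω εs N (restrict N (lump N r)) ε := by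
  -- `T` is the truncated reference marginal; the slacks are chosen as the actual deviations from
  -- it.
  set T : Fin (N + 1) → Fin 2 → ℝ :=
    Fin.lastCases (fun a => ∑' k, marg ω (N + k) a) fun i a => marg ω i a with hT
  have hTl : ∀ a, T (Fin.last N) a = ∑' k, marg ω (N + k) a := fun a => by
    simp only [hT, Fin.lastCases_last]
  have hTc : ∀ (i : Fin N) a, T i.castSucc a = marg ω i a := fun i a => by
    simp only [hT, Fin.lastCases_castSucc]
  refine ⟨fun i a => |∑ j, restrict N (lump N r) (i, j) a - T i a|,
    (hr.lump hch N).isTruncOccupation hch, fun i j hij => ?_, fun i a => ?_, fun a => ?_, ?_⟩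
  · have : lump N r (i, j) 0 = 0 := by
      refine hb.lump _ ?_
      rcases hij with h | h
      · left; simp [h]
      · right; simp [h]
    rw [restrict, this, ENNReal.toReal_zero]
  · rw [hTc]
  · rw [hTl]
  · refine le_trans (le_of_eq_of_le (Finset.sum_comm) ?_) h
    have hm := hr.hasSum_marg.summable
    rw [l1Dist_split hω hm N]
    refine Finset.sum_le_sum fun a _ => ?_
    rw [Fin.sum_univ_castSucc]
    refine add_le_add (Finset.sum_le_sum fun i _ => ?_) ?_
    · rw [sum_restrict_lump_castSucc hch hr, hTc]
    · rw [sum_restrict_lump_last hch hr, hTl]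
      have s1 := summable_shift (summable_slice hm a) N
      have s2 := summable_shift (summable_slice hω a) N
      dsimp only at s1 s2
      -- The last bin compares sums, which differ by no more than the sum of the differences.
      rw [← s1.tsum_sub s2]
      have := norm_tsum_le_tsum_norm (s1.sub s2).norm
      simpa only [Real.norm_eq_abs] using this

/-- Stealthiness of a measure whose truncation is feasible in the finite program. -/
lemma l1Dist_le_of_truncFeasible (hch : ch.Proper) {ω : ℕ × ℕ → Fin 2 → ℝ}
    (hω : Summable fun x : ℕ × Fin 2 => marg ω x.1 x.2) (hω0 : ∀ i a, 0 ≤ marg ω i a) {εs : ℝ}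
    (hr : EOcc ch (· + 1) r) {ε : Fin (N + 1) → Fin 2 → ℝ}
    (h : TruncFeasible ch ω εs N (restrict N (lump N r)) ε) :
    l1Dist ω (realOcc r) ≤ εs + 2 * ∑ a, ∑' k, marg ω (N + k) a := by
  have hm := hr.hasSum_marg.summable
  rw [l1Dist_split hω hm N]
  have hbud : ∑ a, ∑ i, ε i a ≤ εs := le_of_eq_of_le Finset.sum_comm h.budget
  refine le_trans ?_ (add_le_add_left hbud _)
  rw [Finset.mul_sum, ← Finset.sum_add_distrib]
  refine Finset.sum_le_sum fun a _ => ?_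
  rw [Fin.sum_univ_castSucc, add_assoc]
  refine add_le_add (Finset.sum_le_sum fun i _ => ?_) ?_
  · have := h.stealth i a
    rwa [sum_restrict_lump_castSucc hch hr] at this
  · have h1 := h.stealth_last a
    rw [sum_restrict_lump_last hch hr] at h1
    have s1 := summable_shift (summable_slice hm a) N
    have s2 := summable_shift (summable_slice hω a) N
    dsimp only at s1 s2
    -- Behind the horizon only the total masses are known to be close. Bounding the difference by
    -- the sum, and the tail of `r` by that of `ω` plus the slack, yields twice the tail of `ω`.
    have h2 : ∑' k, |marg (realOcc r) (N + k) a - marg ω (N + k) a|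
        ≤ ∑' k, (marg (realOcc r) (N + k) a + marg ω (N + k) a) := by
      refine (summable_abs_sub s1 s2).tsum_le_tsum (fun k => ?_) (s1.add s2)
      have e1 := marg_nonneg r (N + k) a
      have e2 := hω0 (N + k) a
      rw [abs_le]; constructor <;> linarith
    rw [s1.tsum_add s2] at h2
    have := (abs_le.1 h1).2
    linarith

/-- The distance to the reference is continuous. -/
lemma l1Dist_le_add {ω : ℕ × ℕ → Fin 2 → ℝ}
    (hω : Summable fun x : ℕ × Fin 2 => marg ω x.1 x.2)
    (hr : EOcc ch nxt r) (hr' : EOcc ch nxt r') :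
    l1Dist ω (realOcc r') ≤ l1Dist ω (realOcc r)
      + 2 * (∑' s, ∑ a, (r s a - r' s a)).toReal := by
  have hm := hr.hasSum_marg
  have hm' := hr'.hasSum_marg
  set d : ℕ × ℕ → Fin 2 → ℝ≥0∞ := fun s a => r s a - r' s a with hd
  have hrow : ∑' x : ℕ × Fin 2, rowMass d x.1 x.2 = ∑' s, ∑ a, d s a := by
    rw [tsum_stateAction, ENNReal.tsum_prod']
    refine tsum_congr fun i => ?_
    rw [Summable.tsum_finsetSum fun _ _ => ENNReal.summable]
    rfl
  have hfin : ∑' s, ∑ a, d s a ≠ ⊤ := by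
    refine ne_top_of_le_ne_top ENNReal.one_ne_top (hr.total ▸ ENNReal.tsum_le_tsum fun s => ?_)
    exact Finset.sum_le_sum fun a _ => tsub_le_self
  have hrowt : ∀ x : ℕ × Fin 2, rowMass d x.1 x.2 ≠ ⊤ :=
    ENNReal.ne_top_of_tsum_ne_top (by rwa [hrow])
  have hDs : Summable fun x : ℕ × Fin 2 => (rowMass d x.1 x.2).toReal :=
    ENNReal.summable_toReal (by rwa [hrow])
  have hDsum : ∑' x : ℕ × Fin 2, (rowMass d x.1 x.2).toReal = (∑' s, ∑ a, d s a).toReal := by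
    rw [← ENNReal.tsum_toReal_eq hrowt, hrow]
  have hle : ∀ x : ℕ × Fin 2, marg (realOcc r) x.1 x.2
      ≤ marg (realOcc r') x.1 x.2 + (rowMass d x.1 x.2).toReal := by
    intro x
    rw [hr.marg_eq, hr'.marg_eq, ← ENNReal.toReal_add (hr'.rowMass_ne_top _ _) (hrowt x)]
    refine ENNReal.toReal_mono (ENNReal.add_ne_top.2 ⟨hr'.rowMass_ne_top _ _, hrowt x⟩) ?_
    rw [rowMass, rowMass, rowMass, ← ENNReal.tsum_add]
    exact ENNReal.tsum_le_tsum fun j => le_add_tsub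
  have hs := summable_abs_sub hm.summable hω
  have hs' := summable_abs_sub hm'.summable hω
  -- With $d$ the row mass of the deficit $(r-r')^+$, the marginals satisfy
  -- $|r'_s-r_s|\le(r'_s-r_s)+2d$. The first bracket sums to zero because both measures have mass
  -- $1$, so the deficit alone controls the distance.
  have h2 : ∑' x : ℕ × Fin 2, |marg (realOcc r') x.1 x.2 - marg ω x.1 x.2|
      ≤ ∑' x : ℕ × Fin 2, (|marg (realOcc r) x.1 x.2 - marg ω x.1 x.2|
        + ((marg (realOcc r') x.1 x.2 - marg (realOcc r) x.1 x.2)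
          + 2 * (rowMass d x.1 x.2).toReal)) := by
    refine hs'.tsum_le_tsum (fun x => ?_)
      (hs.add ((hm'.summable.sub hm.summable).add (hDs.mul_left 2)))
    have e1 := hle x
    have e2 : 0 ≤ (rowMass d x.1 x.2).toReal := ENNReal.toReal_nonneg
    have e3 := le_abs_self (marg (realOcc r) x.1 x.2 - marg ω x.1 x.2)
    have e4 := neg_abs_le (marg (realOcc r) x.1 x.2 - marg ω x.1 x.2)
    rw [abs_le]; constructor <;> linarith
  rw [hs.tsum_add ((hm'.summable.sub hm.summable).add (hDs.mul_left 2)),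
    (hm'.summable.sub hm.summable).tsum_add (hDs.mul_left 2),
    hm'.summable.tsum_sub hm.summable, hm'.tsum_eq, hm.tsum_eq, tsum_mul_left, hDsum, sub_self,
    zero_add] at h2
  exact h2

/-- A mixture of state-action measures. -/
def mix (θ : ℝ) (r r' : ℕ × ℕ → Fin 2 → ℝ≥0∞) (s : ℕ × ℕ) (a : Fin 2) : ℝ≥0∞ :=
  ENNReal.ofReal (1 - θ) * r s a + ENNReal.ofReal θ * r' s a

lemma stateMass_mix (θ : ℝ) (r r' : ℕ × ℕ → Fin 2 → ℝ≥0∞) (s : ℕ × ℕ) :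
    stateMass (mix θ r r') s
      = ENNReal.ofReal (1 - θ) * stateMass r s + ENNReal.ofReal θ * stateMass r' s := by
  simp only [stateMass, mix, Finset.sum_add_distrib, Finset.mul_sum]

lemma tsum_stateMass_mix_mul (θ : ℝ) (r r' : ℕ × ℕ → Fin 2 → ℝ≥0∞) (g : ℕ × ℕ → ℝ≥0∞) :
    ∑' s, stateMass (mix θ r r') s * g s = ENNReal.ofReal (1 - θ) * ∑' s, stateMass r s * g s
      + ENNReal.ofReal θ * ∑' s, stateMass r' s * g s := by
  simp only [stateMass_mix, add_mul, ENNReal.tsum_add, mul_assoc, ENNReal.tsum_mul_left]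

lemma EOcc.mix {θ : ℝ} (h0 : 0 ≤ θ) (h1 : θ ≤ 1) (hr : EOcc ch nxt r) (hr' : EOcc ch nxt r') :
    EOcc ch nxt (mix θ r r') := by
  constructor
  · have := tsum_stateMass_mix_mul θ r r' fun _ => 1
    simp only [mul_one] at this
    refine this.trans ?_
    simp only [stateMass]
    rw [hr.total, hr'.total, mul_one, mul_one, ← ENNReal.ofReal_add (by linarith) h0]
    simp
  · intro s'
    refine (stateMass_mix θ r r' s').trans ?_
    rw [stateMass, stateMass, hr.balance, hr'.balance, ← ENNReal.tsum_mul_left,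
      ← ENNReal.tsum_mul_left, ← ENNReal.tsum_add]
    refine tsum_congr fun s => ?_
    rw [Finset.mul_sum, Finset.mul_sum, ← Finset.sum_add_distrib]
    refine Finset.sum_congr rfl fun a _ => ?_
    rw [Eavesdrop.mix]; ring

lemma BoundaryTransmits.mix (θ : ℝ) (h : BoundaryTransmits N r) (h' : BoundaryTransmits N r') :
    BoundaryTransmits N (mix θ r r') := fun s hs => by
  rw [Eavesdrop.mix, h s hs, h' s hs, mul_zero, mul_zero, add_zero]

lemma BoundaryTransmits.mono {M : ℕ} (h : BoundaryTransmits N r) (hM : N ≤ M) :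
    BoundaryTransmits M r := fun s hs => h s (by omega)

lemma l1Dist_mix_le {θ : ℝ} (h0 : 0 ≤ θ) (h1 : θ ≤ 1) {ω : ℕ × ℕ → Fin 2 → ℝ}
    (hω : Summable fun x : ℕ × Fin 2 => marg ω x.1 x.2)
    (hr : EOcc ch nxt r) (hr' : EOcc ch nxt r') :
    l1Dist ω (realOcc (mix θ r r'))
      ≤ (1 - θ) * l1Dist ω (realOcc r) + θ * l1Dist ω (realOcc r') := by
  have h1' : 0 ≤ 1 - θ := by linarith
  have hmx : ∀ i a, marg (realOcc (mix θ r r')) i a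
      = (1 - θ) * marg (realOcc r) i a + θ * marg (realOcc r') i a := by
    intro i a
    have e : rowMass (mix θ r r') i a
        = ENNReal.ofReal (1 - θ) * rowMass r i a + ENNReal.ofReal θ * rowMass r' i a := by
      rw [rowMass, rowMass, rowMass, ← ENNReal.tsum_mul_left, ← ENNReal.tsum_mul_left,
        ← ENNReal.tsum_add]
      rfl
    rw [(hr.mix h0 h1 hr').marg_eq, hr.marg_eq, hr'.marg_eq, e, ENNReal.toReal_add
      (ENNReal.mul_ne_top ENNReal.ofReal_ne_top (hr.rowMass_ne_top _ _))
      (ENNReal.mul_ne_top ENNReal.ofReal_ne_top (hr'.rowMass_ne_top _ _)), ENNReal.toReal_mul,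
      ENNReal.toReal_mul, ENNReal.toReal_ofReal h0, ENNReal.toReal_ofReal h1']
  have hs := summable_abs_sub hr.hasSum_marg.summable hω
  have hs' := summable_abs_sub hr'.hasSum_marg.summable hω
  rw [l1Dist, l1Dist, l1Dist, ← tsum_mul_left, ← tsum_mul_left,
    ← (hs.mul_left (1 - θ)).tsum_add (hs'.mul_left θ)]
  refine (summable_abs_sub (hr.mix h0 h1 hr').hasSum_marg.summable hω).tsum_le_tsum (fun x => ?_)
    ((hs.mul_left (1 - θ)).add (hs'.mul_left θ))
  rw [hmx]
  calc |(1 - θ) * marg (realOcc r) x.1 x.2 + θ * marg (realOcc r') x.1 x.2 - marg ω x.1 x.2|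
      = |(1 - θ) * (marg (realOcc r) x.1 x.2 - marg ω x.1 x.2)
          + θ * (marg (realOcc r') x.1 x.2 - marg ω x.1 x.2)| := by congr 1; ring
    _ ≤ _ := by
        refine (abs_add_le _ _).trans ?_
        rw [abs_mul, abs_mul, abs_of_nonneg h0, abs_of_nonneg h1']

end Stealth

/-! ### Existence of an optimal solution of the finite program -/

section FiniteProgram

variable {n : ℕ} {ch : Channels} {A Q P : Matrix (Fin n) (Fin n) ℝ} {B : ℝ≥0∞} {N : ℕ}

lemma tailCost_ne_top (hch : ch.Proper) (hB : CostBound ch (ecost A Q P) B) (N : ℕ) :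
    ∑' k : ℕ, ENNReal.ofReal (ch.adv * (1 - ch.adv) ^ k * (errCov A Q P (N + k)).trace) ≠ ⊤ := by
  refine ne_top_of_le_ne_top (ENNReal.mul_ne_top (ENNReal.ofReal_ne_top (r := ch.adv))
    (ENNReal.mul_ne_top hB.bound_ne_top (ENNReal.add_ne_top.2 ⟨ENNReal.one_ne_top, hB.ne_top N⟩)))
    (le_trans (le_of_eq ?_) (mul_le_mul' le_rfl (hB.le N)))
  rw [discounted, ← ENNReal.tsum_mul_left]
  refine tsum_congr fun k => ?_
  have h0 : 0 ≤ 1 - ch.adv := by linarith [hch.adv_lt]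
  rw [mul_assoc, ENNReal.ofReal_mul hch.adv_pos.le, ENNReal.ofReal_mul (pow_nonneg h0 k),
    ENNReal.ofReal_pow h0]
  rfl

lemma truncCost_ne_top (hch : ch.Proper) (hB : CostBound ch (ecost A Q P) B)
    (ρ : Fin (N + 1) × Fin (N + 1) → Fin 2 → ℝ) : truncCost ch A Q P N ρ ≠ ⊤ := by
  refine ENNReal.add_ne_top.2 ⟨?_, ?_⟩
  · exact ENNReal.sum_ne_top.2 fun _ _ => ENNReal.sum_ne_top.2 fun _ _ =>
      ENNReal.sum_ne_top.2 fun _ _ => ENNReal.ofReal_ne_top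
  · exact ENNReal.sum_ne_top.2 fun _ _ =>
      ENNReal.mul_ne_top ENNReal.ofReal_ne_top (tailCost_ne_top hch hB N)

lemma continuous_truncCost (hch : ch.Proper) (hB : CostBound ch (ecost A Q P) B) :
    Continuous (truncCost ch A Q P N) := by
  unfold truncCost
  refine Continuous.add ?_ ?_
  · refine continuous_finsetSum _ fun i _ => continuous_finsetSum _ fun j _ =>
      continuous_finsetSum _ fun a _ => ENNReal.continuous_ofReal.comp ?_
    fun_prop
  · refine continuous_finsetSum _ fun i _ =>
      (ENNReal.continuous_mul_const (tailCost_ne_top hch hB N)).comp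
        (ENNReal.continuous_ofReal.comp ?_)
    fun_prop

lemma isClosed_truncFeasible (ω : ℕ × ℕ → Fin 2 → ℝ) (εs : ℝ) :
    IsClosed {x : (Fin (N + 1) × Fin (N + 1) → Fin 2 → ℝ) × (Fin (N + 1) → Fin 2 → ℝ) |
      TruncFeasible ch ω εs N x.1 x.2} := by
  have : {x : (Fin (N + 1) × Fin (N + 1) → Fin 2 → ℝ) × (Fin (N + 1) → Fin 2 → ℝ) |
      TruncFeasible ch ω εs N x.1 x.2} = {x |
        ((∀ s a, x.1 s a ∈ Set.Icc (0 : ℝ) 1) ∧ (∑ s, ∑ a, x.1 s a = 1) ∧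
          ∀ s', ∑ a, x.1 s' a = ∑ s, ∑ a, x.1 s a * truncTrans ch N s a s') ∧
        (∀ i j, i = Fin.last N ∨ j = Fin.last N → x.1 (i, j) 0 = 0) ∧
        (∀ (i : Fin N) (a : Fin 2),
          |∑ j, x.1 (i.castSucc, j) a - marg ω i a| ≤ x.2 i.castSucc a) ∧
        (∀ a : Fin 2, |∑ j, x.1 (Fin.last N, j) a - ∑' k : ℕ, marg ω (N + k) a|
          ≤ x.2 (Fin.last N) a) ∧ ∑ i, ∑ a, x.2 i a ≤ εs} := by
    ext x
    exact ⟨fun ⟨⟨h1, h2, h3⟩, h4, h5, h6, h7⟩ => ⟨⟨h1, h2, h3⟩, h4, h5, h6, h7⟩,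
      fun ⟨⟨h1, h2, h3⟩, h4, h5, h6, h7⟩ => ⟨⟨h1, h2, h3⟩, h4, h5, h6, h7⟩⟩
  rw [this]
  simp only [Set.ofPred_and, Set.ofPred_forall]
  refine IsClosed.inter (IsClosed.inter ?_ (IsClosed.inter ?_ ?_))
    (IsClosed.inter ?_ (IsClosed.inter ?_ (IsClosed.inter ?_ ?_)))
  · refine isClosed_iInter fun s => isClosed_iInter fun a => isClosed_Icc.preimage ?_
    fun_prop
  · exact isClosed_eq (by fun_prop) continuous_const
  · exact isClosed_iInter fun s' => isClosed_eq (by fun_prop) (by fun_prop)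
  · exact isClosed_iInter fun i => isClosed_iInter fun j => isClosed_iInter fun _ =>
      isClosed_eq (by fun_prop) continuous_const
  · exact isClosed_iInter fun i => isClosed_iInter fun a => isClosed_le (by fun_prop) (by fun_prop)
  · exact isClosed_iInter fun a => isClosed_le (by fun_prop) (by fun_prop)
  · exact isClosed_le (by fun_prop) continuous_const

lemma TruncFeasible.slack_nonneg {ω : ℕ × ℕ → Fin 2 → ℝ} {εs : ℝ}
    {ρ : Fin (N + 1) × Fin (N + 1) → Fin 2 → ℝ} {ε : Fin (N + 1) → Fin 2 → ℝ}
    (h : TruncFeasible ch ω εs N ρ ε) (i : Fin (N + 1)) (a : Fin 2) : 0 ≤ ε i a := by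
  induction i using Fin.lastCases with
  | last => exact (abs_nonneg _).trans (h.stealth_last a)
  | cast i => exact (abs_nonneg _).trans (h.stealth i a)

lemma TruncFeasible.slack_le {ω : ℕ × ℕ → Fin 2 → ℝ} {εs : ℝ}
    {ρ : Fin (N + 1) × Fin (N + 1) → Fin 2 → ℝ} {ε : Fin (N + 1) → Fin 2 → ℝ}
    (h : TruncFeasible ch ω εs N ρ ε) (i : Fin (N + 1)) (a : Fin 2) : ε i a ≤ εs := by
  have h1 : ε i a ≤ ∑ a, ε i a :=
    Finset.single_le_sum (f := ε i) (fun a _ => h.slack_nonneg i a) (Finset.mem_univ a)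
  have h2 : ∑ a, ε i a ≤ ∑ i, ∑ a, ε i a :=
    Finset.single_le_sum (f := fun i => ∑ a, ε i a)
      (fun i _ => Finset.sum_nonneg fun a _ => h.slack_nonneg i a) (Finset.mem_univ i)
  exact (h1.trans h2).trans h.budget

/-- The slacks dominate absolute values, hence are nonnegative, and the budget confines each to
$[0,\epsilon_s]$; the feasible set is closed in a box. -/
lemma isCompact_truncFeasible (ω : ℕ × ℕ → Fin 2 → ℝ) (εs : ℝ) :
    IsCompact {x : (Fin (N + 1) × Fin (N + 1) → Fin 2 → ℝ) × (Fin (N + 1) → Fin 2 → ℝ) |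
      TruncFeasible ch ω εs N x.1 x.2} := by
  have h1 : IsCompact (Set.univ.pi fun _ : Fin (N + 1) × Fin (N + 1) =>
      Set.univ.pi fun _ : Fin 2 => Set.Icc (0 : ℝ) 1) :=
    isCompact_univ_pi fun _ => isCompact_univ_pi fun _ => isCompact_Icc
  have h2 : IsCompact (Set.univ.pi fun _ : Fin (N + 1) =>
      Set.univ.pi fun _ : Fin 2 => Set.Icc (0 : ℝ) εs) :=
    isCompact_univ_pi fun _ => isCompact_univ_pi fun _ => isCompact_Icc
  refine (h1.prod h2).of_isClosed_subset (isClosed_truncFeasible ω εs) fun x hx => ?_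
  have hx' : TruncFeasible ch ω εs N x.1 x.2 := hx
  simp only [Set.mem_prod, Set.mem_univ_pi]
  exact ⟨hx'.occupation.mem_Icc, fun i a => ⟨hx'.slack_nonneg i a, hx'.slack_le i a⟩⟩

/-- The finite program is solvable if it is feasible. -/
lemma exists_isTruncOptimal (hch : ch.Proper) (hB : CostBound ch (ecost A Q P) B)
    {ω : ℕ × ℕ → Fin 2 → ℝ} {εs : ℝ}
    (h : ∃ ρ ε, TruncFeasible ch ω εs N ρ ε) : ∃ ρ ε, IsTruncOptimal ch A Q P ω εs N ρ ε := by
  obtain ⟨ρ, ε, hρ⟩ := h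
  have hcont : Continuous fun x : (Fin (N + 1) × Fin (N + 1) → Fin 2 → ℝ) ×
      (Fin (N + 1) → Fin 2 → ℝ) => truncCost ch A Q P N x.1 :=
    (continuous_truncCost hch hB).comp continuous_fst
  obtain ⟨x, hx, hmin⟩ := (isCompact_truncFeasible ω εs).exists_isMinOn ⟨(ρ, ε), hρ⟩
    hcont.continuousOn
  refine ⟨x.1, x.2, hx, fun ρ' ε' h' => ?_⟩
  exact isMinOn_iff.1 hmin (ρ', ε') h'

end FiniteProgram

/-! ### Optimal values and their convergence -/

section Values

variable {n : ℕ} {ch : Channels} {A Q P : Matrix (Fin n) (Fin n) ℝ} {B : ℝ≥0∞}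
  {r : ℕ × ℕ → Fin 2 → ℝ≥0∞} {ω : ℕ × ℕ → Fin 2 → ℝ} {εs : ℝ}

lemma occCost_eq {ρ : ℕ × ℕ → Fin 2 → ℝ} (h : ∀ s a, 0 ≤ ρ s a) :
    occCost A Q P ρ
      = ∑' s, stateMass (fun s a => ENNReal.ofReal (ρ s a)) s * ecost A Q P s.2 := by
  rw [occCost]
  simp only [stateMass, Finset.sum_mul]
  rw [← tsum_stateAction fun s a => ENNReal.ofReal (ρ s a) * ecost A Q P s.2]
  exact tsum_congr fun x => ENNReal.ofReal_mul (h _ _)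

lemma occCost_realOcc {nxt : ℕ → ℕ} (hr : EOcc ch nxt r) :
    occCost A Q P (realOcc r) = ∑' s, stateMass r s * ecost A Q P s.2 := by
  rw [occCost_eq (ρ := realOcc r) fun _ _ => ENNReal.toReal_nonneg]
  have : (fun s a => ENNReal.ofReal (realOcc r s a)) = r := ofReal_toReal_occ hr.ne_top
  rw [this]

/-- Cost and feasibility in the finite program of a measure that transmits beyond the horizon. -/
lemma truncCost_restrict_lump {N : ℕ} (hch : ch.Proper) (hr : EOcc ch (· + 1) r)
    (hb : BoundaryTransmits N r) :
    truncCost ch A Q P N (restrict N (lump N r)) = ∑' s, stateMass r s * ecost A Q P s.2 := by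
  refine truncCost_eq_of_lump hch A Q P (fun _ _ => ENNReal.toReal_nonneg) (fun i => ?_) hr hb
    (extend_restrict hch (hr.lump hch N))
  rw [restrict, hb.lump _ (Or.inr (by simp)), ENNReal.toReal_zero]

lemma cost_ne_top_of_boundary {N : ℕ} (hch : ch.Proper) (hB : CostBound ch (ecost A Q P) B)
    (hr : EOcc ch (· + 1) r) (hb : BoundaryTransmits N r) :
    ∑' s, stateMass r s * ecost A Q P s.2 ≠ ⊤ := by
  rw [← truncCost_restrict_lump hch hr hb]
  exact truncCost_ne_top hch hB _

/-- A strictly stealthy policy which transmits beyond some horizon. -/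
lemma exists_strictly_feasible (hch : ch.Proper) (hω : IsOccupation ch ω) (hεs : 0 < εs) :
    ∃ M r, EOcc ch (· + 1) r ∧ BoundaryTransmits M r ∧ l1Dist ω (realOcc r) ≤ εs / 2 := by
  have he := hω.eocc hch
  have hreal : realOcc (fun s a => ENNReal.ofReal (ω s a)) = ω := toReal_ofReal_occ hω.nonneg
  have hm : Summable fun x : ℕ × Fin 2 => marg ω x.1 x.2 := by
    have := he.hasSum_marg.summable
    rwa [hreal] at this
  obtain ⟨r', h1, h2, -⟩ := exists_transmitting_approx hch he
  have h3 := (ENNReal.tendsto_toReal ENNReal.zero_ne_top).comp h2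
  rw [ENNReal.toReal_zero] at h3
  -- The reference `ω` has distance $0$ to itself, so a late approximant of it is stealthy with half
  -- the budget.
  obtain ⟨M, hM, hM1⟩ := ((h3.eventually_lt_const (show (0 : ℝ) < εs / 4 by linarith)).and
    (eventually_ge_atTop 1)).exists
  refine ⟨M, r' M, (h1 M hM1).1, (h1 M hM1).2, ?_⟩
  have h4 := l1Dist_le_add hm he (h1 M hM1).1
  have h5 : l1Dist ω (realOcc fun s a => ENNReal.ofReal (ω s a)) = 0 := by
    rw [hreal, l1Dist]; simp
  simp only [Function.comp_apply] at hM
  linarith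

/-- Measures feasible in the infinite program are approximated by the finite programs. -/
lemma eventually_exists_truncFeasible (hch : ch.Proper) (hB : CostBound ch (ecost A Q P) B)
    (hω : IsOccupation ch ω) (hεs : 0 < εs) (hr : EOcc ch (· + 1) r)
    (hd : l1Dist ω (realOcc r) ≤ εs) {v : ℝ≥0∞}
    (hv : ∑' s, stateMass r s * ecost A Q P s.2 < v) :
    ∀ᶠ N in atTop, ∃ ρ ε, TruncFeasible ch ω εs N ρ ε ∧ truncCost ch A Q P N ρ < v := by
  have he := hω.eocc hch
  have hreal : realOcc (fun s a => ENNReal.ofReal (ω s a)) = ω := toReal_ofReal_occ hω.nonneg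
  have hm : Summable fun x : ℕ × Fin 2 => marg ω x.1 x.2 := by
    have := he.hasSum_marg.summable
    rwa [hreal] at this
  obtain ⟨M, r₁, e₁, b₁, d₁⟩ := exists_strictly_feasible hch hω hεs
  have c₁ := cost_ne_top_of_boundary hch hB e₁ b₁
  set c := ∑' s, stateMass r₁ s * ecost A Q P s.2 with hc
  set c₀ := ∑' s, stateMass r s * ecost A Q P s.2 with hc₀
  -- The weight of the strictly stealthy measure `r₁` is chosen so small that its finite cost keeps
  -- the mixture below `v`; it is fixed before $N$.
  obtain ⟨θ, hθ0, hθ1, hθv⟩ : ∃ θ : ℝ, 0 < θ ∧ θ ≤ 1 ∧ c₀ + ENNReal.ofReal θ * c < v := by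
    have h1 : Tendsto (fun θ : ℝ => c₀ + ENNReal.ofReal θ * c) (𝓝[>] 0) (𝓝 c₀) := by
      have h2 : Tendsto (fun θ : ℝ => ENNReal.ofReal θ) (𝓝[>] 0) (𝓝 0) := by
        have := (ENNReal.continuous_ofReal.tendsto 0).mono_left
          (nhdsWithin_le_nhds (s := Set.Ioi (0 : ℝ)))
        rwa [ENNReal.ofReal_zero] at this
      have h3 := (tendsto_const_nhds (x := c₀)).add
        (ENNReal.Tendsto.mul_const (b := c) h2 (Or.inr c₁))
      rwa [zero_mul, add_zero] at h3
    obtain ⟨θ, h2, h3⟩ := ((h1.eventually_lt_const hv).and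
      (Ioc_mem_nhdsGT (zero_lt_one (α := ℝ)))).exists
    exact ⟨θ, h3.1, h3.2, h2⟩
  obtain ⟨r', h1, h2, h3⟩ := exists_transmitting_approx hch hr
  obtain ⟨u, hu, hle⟩ := h3 _ _ hB (ne_top_of_lt hv)
  have h4 := (ENNReal.tendsto_toReal ENNReal.zero_ne_top).comp h2
  rw [ENNReal.toReal_zero] at h4
  have h5 : Tendsto (fun N => u N + ENNReal.ofReal θ * c) atTop
      (𝓝 (c₀ + ENNReal.ofReal θ * c)) := hu.add tendsto_const_nhds
  filter_upwards [h4.eventually_lt_const (show (0 : ℝ) < θ * εs / 4 by positivity),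
    h5.eventually_lt_const hθv, eventually_ge_atTop 1, eventually_ge_atTop M] with N e1 e2 e3 e4
  obtain ⟨eN, bN⟩ := h1 N e3
  have em := eN.mix hθ0.le hθ1 e₁
  have bm := bN.mix θ (b₁.mono e4)
  have hl1 : l1Dist ω (realOcc (mix θ (r' N) r₁)) ≤ εs := by
    have f1 := l1Dist_mix_le hθ0.le hθ1 hm eN e₁
    have f2 := l1Dist_le_add hm hr eN
    simp only [Function.comp_apply] at e1
    have f3 : l1Dist ω (realOcc (r' N)) ≤ εs + θ * εs / 2 := by linarith
    have f4 := mul_le_mul_of_nonneg_left f3 (show 0 ≤ 1 - θ by linarith)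
    have f5 := mul_le_mul_of_nonneg_left d₁ hθ0.le
    -- The mixture has distance at most
    -- $(1-\theta)(1+\theta/2)\epsilon_s+\theta\epsilon_s/2=(1-\theta^2/2)\epsilon_s$.
    nlinarith [mul_pos hθ0 (mul_pos hθ0 hεs)]
  obtain ⟨ε, hε⟩ := exists_truncFeasible hch hm em bm hl1
  refine ⟨_, ε, hε, ?_⟩
  rw [truncCost_restrict_lump hch em bm, tsum_stateMass_mix_mul]
  refine lt_of_le_of_lt (add_le_add_left ?_ _) e2
  refine le_trans ?_ (hle N)
  refine mul_le_of_le_one_left zero_le ?_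
  rw [ENNReal.ofReal_le_one]; linarith

/-- The optimal value of the infinite program. -/
def infValue (ch : Channels) (A Q P : Matrix (Fin n) (Fin n) ℝ) (ω : ℕ × ℕ → Fin 2 → ℝ)
    (εs : ℝ) : ℝ≥0∞ := ⨅ (ρ) (_ : Feasible ch ω εs ρ), occCost A Q P ρ

/-- The optimal value of the finite program. -/
def finValue (ch : Channels) (A Q P : Matrix (Fin n) (Fin n) ℝ) (ω : ℕ × ℕ → Fin 2 → ℝ)
    (εs : ℝ) (N : ℕ) : ℝ≥0∞ :=
  ⨅ (x : (Fin (N + 1) × Fin (N + 1) → Fin 2 → ℝ) × (Fin (N + 1) → Fin 2 → ℝ))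
    (_ : TruncFeasible ch ω εs N x.1 x.2), truncCost ch A Q P N x.1

lemma infValue_ne_top (hch : ch.Proper) (hB : CostBound ch (ecost A Q P) B)
    (hω : IsOccupation ch ω) (hεs : 0 < εs) : infValue ch A Q P ω εs ≠ ⊤ := by
  obtain ⟨M, r₁, e₁, b₁, d₁⟩ := exists_strictly_feasible hch hω hεs
  refine ne_top_of_le_ne_top (cost_ne_top_of_boundary hch hB e₁ b₁) ?_
  rw [← occCost_realOcc e₁]
  exact iInf₂_le _ ⟨e₁.isOccupation hch, by linarith⟩

lemma eventually_finValue_lt (hch : ch.Proper) (hB : CostBound ch (ecost A Q P) B)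
    (hω : IsOccupation ch ω) (hεs : 0 < εs) {v : ℝ≥0∞} (hv : infValue ch A Q P ω εs < v) :
    ∀ᶠ N in atTop, (∃ ρ ε, TruncFeasible ch ω εs N ρ ε) ∧ finValue ch A Q P ω εs N < v := by
  obtain ⟨ρ, hρ⟩ := iInf_lt_iff.1 hv
  obtain ⟨hf, hlt⟩ := iInf_lt_iff.1 hρ
  have he := hf.1.eocc hch
  have hreal : realOcc (fun s a => ENNReal.ofReal (ρ s a)) = ρ := toReal_ofReal_occ hf.1.nonneg
  rw [occCost_eq hf.1.nonneg] at hlt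
  filter_upwards [eventually_exists_truncFeasible hch hB hω hεs he (by rw [hreal]; exact hf.2) hlt]
    with N hN
  obtain ⟨ρt, ε, h1, h2⟩ := hN
  refine ⟨⟨ρt, ε, h1⟩, lt_of_le_of_lt ?_ h2⟩
  exact iInf₂_le (f := fun x (_ : TruncFeasible ch ω εs N x.1 x.2) => truncCost ch A Q P N x.1)
    (ρt, ε) h1

/-- The optimality gap of the finite program. -/
def valueGap (ch : Channels) (A Q P : Matrix (Fin n) (Fin n) ℝ) (ω : ℕ × ℕ → Fin 2 → ℝ)
    (εs : ℝ) (N : ℕ) : ℝ := (finValue ch A Q P ω εs N - infValue ch A Q P ω εs).toReal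

/-- The relaxed last bin may push the finite value below the infinite one; the truncated subtraction
ignores this, so only the upper bound on the finite values enters. -/
lemma tendsto_valueGap (hch : ch.Proper) (hB : CostBound ch (ecost A Q P) B)
    (hω : IsOccupation ch ω) (hεs : 0 < εs) :
    Tendsto (valueGap ch A Q P ω εs) atTop (𝓝 0) := by
  have ht := infValue_ne_top hch hB hω hεs
  have h : Tendsto (fun N => finValue ch A Q P ω εs N - infValue ch A Q P ω εs) atTop (𝓝 0) := by
    rw [ENNReal.tendsto_nhds_zero]
    intro δ hδ
    filter_upwards [eventually_finValue_lt hch hB hω hεs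
      (ENNReal.lt_add_right ht hδ.ne')] with N hN
    exact tsub_le_iff_left.2 hN.2.le
  have := (ENNReal.tendsto_toReal ENNReal.zero_ne_top).comp h
  rwa [ENNReal.toReal_zero] at this

lemma tendsto_tail_marg (ω : ℕ × ℕ → Fin 2 → ℝ) :
    Tendsto (fun N => 2 * ∑ a, ∑' k, marg ω (N + k) a) atTop (𝓝 0) := by
  have h : ∀ a, Tendsto (fun N => ∑' k, marg ω (N + k) a) atTop (𝓝 0) := fun a => by
    have := tendsto_sum_nat_add fun k => marg ω k a
    simpa only [add_comm] using this
  have := (tendsto_finsetSum (Finset.univ : Finset (Fin 2)) fun a _ => h a).const_mul 2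
  simpa using this

end Values

/-! ### Compatibility of the truncated policy with lumping -/

section TruncatedPolicy

variable {ch : Channels} {N : ℕ} {τ : ℕ × ℕ → ℝ}

/-- A policy equal to $1$ beyond the horizon is constant on the fibres of `clamp`, so merging states
does not change the conditional law of the action. -/
lemma disintegrates_lump (hbd : ∀ s : ℕ × ℕ, N ≤ s.1 ∨ N ≤ s.2 → τ s = 1)
    {r : ℕ × ℕ → Fin 2 → ℝ≥0∞} (hr : Disintegrates r τ) : Disintegrates (lump N r) τ := by
  have hcl : ∀ t, τ (clamp N t) = τ t := by
    intro t
    by_cases h : N ≤ t.1 ∨ N ≤ t.2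
    · rw [hbd t h, hbd]
      simp only [clamp]; omega
    · have : clamp N t = t := Prod.ext (by simp only [clamp]; omega) (by simp only [clamp]; omega)
      rw [this]
  intro s a
  rw [stateMass]
  simp only [lump]
  rw [← Summable.tsum_finsetSum fun _ _ => ENNReal.summable, ← ENNReal.tsum_mul_left]
  refine tsum_congr fun t => ?_
  split_ifs with h
  · rw [h, hcl, hr t a]; rfl
  · simp

lemma TruncInduces.disintegrates {ρ : Fin (N + 1) × Fin (N + 1) → Fin 2 → ℝ}
    (h : TruncInduces N ρ τ) (h0 : ∀ x a, 0 ≤ ρ x a)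
    (hb : ∀ i j, i = Fin.last N ∨ j = Fin.last N → ρ (i, j) 0 = 0) :
    Disintegrates (extend N ρ) τ := by
  intro s a
  by_cases hs : s.1 < N + 1 ∧ s.2 < N + 1
  · simp only [stateMass, extend, dif_pos hs]
    refine ofReal_actProb_mul (h.1 s) (h0 _) ?_ a
    by_cases hi : s.1 < N ∧ s.2 < N
    · exact h.2.1 ⟨s.1, hi.1⟩ ⟨s.2, hi.2⟩
    · have h1 : τ s = 1 := h.2.2 s.1 s.2 (by omega)
      rw [h1, one_mul, Fin.sum_univ_two, hb, zero_add]
      by_cases hN : s.1 = N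
      · left; ext; simpa using hN
      · right; ext; simp only [Fin.val_last]; omega
  · rw [extend_eq_zero ρ hs, stateMass, Finset.sum_eq_zero fun a _ => extend_eq_zero ρ hs a,
      mul_zero]

lemma restrict_extend {ρ : Fin (N + 1) × Fin (N + 1) → Fin 2 → ℝ} (h0 : ∀ x a, 0 ≤ ρ x a) :
    restrict N (extend N ρ) = ρ := by
  funext x a
  rw [restrict, extend_coe, ENNReal.toReal_ofReal (h0 x a)]

end TruncatedPolicy

end Eavesdrop

end

/-! ### The main theorem -/

open Eavesdrop

theorem mainTheorem6 {n m : ℕ}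
    (A Q P0 P : Matrix (Fin n) (Fin n) ℝ) (C : Matrix (Fin m) (Fin n) ℝ)
    (R : Matrix (Fin m) (Fin m) ℝ)
    (hQ : Q.PosSemidef) (hR : R.PosDef) (hP0 : P0.PosSemidef)
    (hP : Eavesdrop.IsSteadyState A Q C R P0 P)
    (ch : Eavesdrop.Channels)
    (hlegit : 0 < ch.legit ∧ ch.legit ≤ 1) (hack : 0 < ch.ack ∧ ch.ack ≤ 1)
    (hadv : 0 < ch.adv ∧ ch.adv < 1)
    (hadvA : (1 - ch.adv) * Eavesdrop.maxEig A ^ 2 < 1)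
    (τref : ℕ → ℝ) (ω : ℕ × ℕ → Fin 2 → ℝ)
    (hω : Eavesdrop.IsStationary ch (fun s => τref s.1) ω)
    (εs : ℝ) (hεs : 0 < εs) :
    ∃ εg εω : ℕ → ℝ,
      Tendsto εg atTop (𝓝 0) ∧ Tendsto εω atTop (𝓝 0) ∧
      -- the finite program is solvable for all large horizons
      (∀ᶠ N in atTop, ∃ ρt ε, Eavesdrop.IsTruncOptimal ch A Q P ω εs N ρt ε) ∧
      ∀ (N : ℕ) (ρt : Fin (N + 1) × Fin (N + 1) → Fin 2 → ℝ) (ε : Fin (N + 1) → Fin 2 → ℝ),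
        Eavesdrop.IsTruncOptimal ch A Q P ω εs N ρt ε →
        ∀ τc : ℕ × ℕ → ℝ, Eavesdrop.TruncInduces N ρt τc →
          -- stealthiness of the truncated policy
          (∃! ρ, Eavesdrop.IsStationary ch τc ρ) ∧
          (∀ ρ, Eavesdrop.IsStationary ch τc ρ → Eavesdrop.l1Dist ω ρ ≤ εs + εω N) ∧
          -- performance of the truncated policy
          ∃ Jc : ℝ, (∀ s₀, Eavesdrop.IsAEEC ch A Q P τc s₀ Jc) ∧
            ∀ ρstar : ℕ × ℕ → Fin 2 → ℝ, Eavesdrop.IsOptimal ch A Q P ω εs ρstar →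
              ∀ τstar : ℕ × ℕ → ℝ, Eavesdrop.Induces ρstar τstar →
                ∃ Jstar : ℝ, Eavesdrop.occCost A Q P ρstar = ENNReal.ofReal Jstar ∧
                  (∀ s₀, 0 < ∑ a, ρstar s₀ a → Eavesdrop.IsAEEC ch A Q P τstar s₀ Jstar) ∧
                  Jc ≤ Jstar + εg N := by
  have hch : ch.Proper := ⟨mul_pos hlegit.1 hack.1,
    mul_le_one₀ hlegit.2 hack.1.le hack.2, hadv.1, hadv.2⟩
  have hPs := posSemidef_steadyState hQ hR hP0 hP
  obtain ⟨B, hB⟩ := exists_costBound hch hQ hPs hadvA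
  have hω1 := hω.1
  have hreal : realOcc (fun s a => ENNReal.ofReal (ω s a)) = ω := toReal_ofReal_occ hω1.nonneg
  have hm : Summable fun x : ℕ × Fin 2 => marg ω x.1 x.2 := by
    have := (hω1.eocc hch).hasSum_marg.summable
    rwa [hreal] at this
  have hm0 : ∀ i a, 0 ≤ marg ω i a := fun i a => tsum_nonneg fun j => hω1.nonneg _ _
  have hinf := infValue_ne_top (A := A) (Q := Q) (P := P) hch hB hω1 hεs
  refine ⟨valueGap ch A Q P ω εs, fun N => 2 * ∑ a, ∑' k, marg ω (N + k) a,
    tendsto_valueGap hch hB hω1 hεs, tendsto_tail_marg ω, ?_, ?_⟩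
  · filter_upwards [eventually_finValue_lt hch hB hω1 hεs (lt_top_iff_ne_top.2 hinf)] with N hN
    exact exists_isTruncOptimal hch hB hN.1
  intro N ρt ε hopt τc hτc
  have hfeas := hopt.1
  have hτ := hτc.1
  have hbd : ∀ s : ℕ × ℕ, N ≤ s.1 ∨ N ≤ s.2 → τc s = 1 := fun s hs => hτc.2.2 s.1 s.2 hs
  have h0 : ∀ x a, 0 ≤ ρt x a := fun x a => (hfeas.occupation.mem_Icc x a).1
  obtain ⟨S, hS1, hS⟩ := exists_invariant_of_boundary hch hτ hbd
  set r : ℕ × ℕ → Fin 2 → ENNReal := fun s a => ENNReal.ofReal (actProb (τc s) a) * S s with hr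
  have hrS : stateMass r = S := stateMass_actProb hτ S
  have hre : EOcc ch (· + 1) r := EOcc.of_invariant hτ hS1 hS
  have hrd : Disintegrates r τc := fun s a => by rw [hrS]
  have hrb : BoundaryTransmits N r := fun s hs => by
    simp [hr, hbd s hs, actProb]
  -- Both sides are occupation measures of the truncated chain under the same policy `τc`, and such
  -- a measure is unique. This links the optimal solution of the finite program with the true
  -- stationary measure.
  have hlump : extend N ρt = lump N r := by
    refine EOcc.unique hch hτ (fun s => ?_) (hfeas.occupation.eocc hch) (hre.lump hch N)
      (hτc.disintegrates h0 hfeas.boundary) (disintegrates_lump hbd hrd)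
    by_cases h : N ≤ s.1
    · exact Or.inl (hbd s (Or.inl h))
    · refine Or.inr fun t ht => ?_
      simp only [truncNext] at ht
      omega
  have hres : restrict N (lump N r) = ρt := by rw [← hlump, restrict_extend h0]
  have hstat : IsStationary ch τc (realOcc r) :=
    ⟨hre.isOccupation hch, hrd.induces hτ hre.ne_top⟩
  have huniq : ∀ ρ, IsStationary ch τc ρ → ρ = realOcc r := by
    intro ρ hρ
    have h1 := EOcc.unique hch hτ (fun s => Or.inr fun t h => h) (hρ.1.eocc hch) hre
      (hρ.2.disintegrates hρ.1.nonneg) hrd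
    rw [← h1]
    exact (toReal_ofReal_occ hρ.1.nonneg).symm
  have hcost : truncCost ch A Q P N ρt = ∑' s, S s * ecost A Q P s.2 := by
    rw [← hres, truncCost_restrict_lump hch hre hrb, hrS]
  refine ⟨⟨realOcc r, hstat, huniq⟩, fun ρ hρ => ?_, (∑' s, S s * ecost A Q P s.2).toReal,
    fun s₀ => isAEEC_of_boundary hch hτ hbd s₀ hQ hPs hB hS1 hS, ?_⟩
  · rw [huniq ρ hρ]
    rw [← hres] at hfeas
    exact l1Dist_le_of_truncFeasible hch hm hm0 hre hfeas
  intro ρstar hstar τstar hτstar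
  have hs0 := hstar.1.1.nonneg
  have hse := hstar.1.1.eocc hch
  have hlow : infValue ch A Q P ω εs ≤ occCost A Q P ρstar := iInf₂_le _ hstar.1
  -- A strictly stealthy measure transmitting beyond some horizon is feasible with finite cost, so
  -- the optimum is finite.
  have hcost_ne_top : occCost A Q P ρstar ≠ ⊤ :=
    ne_top_of_le_ne_top hinf (le_iInf₂ fun ρ hρ => hstar.2 ρ hρ)
  refine ⟨(occCost A Q P ρstar).toReal, (ENNReal.ofReal_toReal hcost_ne_top).symm, fun s₀ hs₀ => ?_, ?_⟩
  · rw [occCost_eq hs0] at hcost_ne_top ⊢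
    refine isAEEC_of_charged hch hτstar.1 hQ hPs hse.total
      ((hτstar.disintegrates hs0).invariant hse) hcost_ne_top ?_
    rw [← ENNReal.ofReal_sum_of_nonneg fun a _ => hs0 s₀ a, Ne, ENNReal.ofReal_eq_zero,
      not_le]
    exact hs₀
  · have hle : truncCost ch A Q P N ρt ≤ finValue ch A Q P ω εs N :=
      le_iInf₂ fun x hx => hopt.2 x.1 x.2 hx
    have hge : finValue ch A Q P ω εs N ≤ truncCost ch A Q P N ρt :=
      iInf₂_le (f := fun x (_ : TruncFeasible ch ω εs N x.1 x.2) => truncCost ch A Q P N x.1)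
        (ρt, ε) hopt.1
    have hfin := ne_top_of_le_ne_top (truncCost_ne_top hch hB ρt) hge
    -- The stationary cost of `τc` is the finite optimal value. Its finiteness ensures that `toReal`
    -- in the gap does not hide an infinite difference.
    rw [← hcost, valueGap, ← ENNReal.toReal_add hcost_ne_top (ne_top_of_le_ne_top hfin tsub_le_self)]
    refine ENNReal.toReal_mono (ENNReal.add_ne_top.2
      ⟨hcost_ne_top, ne_top_of_le_ne_top hfin tsub_le_self⟩) (hle.trans ?_)
    exact le_add_tsub.trans (add_le_add_left hlow _)
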